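/- Let $a,\varepsilon_0,\varepsilon_1>0$. On $\mathbb R^6(\mathbf M,\boldsymbol\alpha)=e(3)^*$ with the Lie–Poisson bracket $\{M_i,M_j\}=\epsilon_{ijk}M_k$, $\{M_i,\alpha_j\}=\epsilon_{ijk}\alpha_k$, $\{\alpha_i,\alpha_j\}=0$ put $L=\tfrac12\mathbf M\cdot\boldsymbol\alpha$, $\Gamma=\boldsymbol\alpha^2$, $$H=\tfrac14(M_1^2+M_2^2+2M_3^2)+\varepsilon_1(\alpha_3M_2-\alpha_2M_3)-\varepsilon_0\alpha_1,$$ $$K=\bigl[\tfrac14(M_1^2-M_2^2)+\varepsilon_1(\alpha_2M_3-\alpha_3M_2)-\varepsilon_1^2\boldsymbol\alpha^2+\varepsilon_0\alpha_1\bigr]^2+\bigl[\tfrac12M_1M_2+\varepsilon_1(\alpha_3M_1-\alpha_1M_3)+\varepsilon_0\alpha_2\bigr]^2$$ (the Kovalevskaya–Sokolov top). Let $\mathcal P^5=\{\Gamma=a^2\}$ and $\mathcal P^4_\ell=\{L=\ell,\ \Gamma=a^2\}$ (the symplectic leaves in $\mathcal P^5$), and let $\mathcal C\subset\mathcal P^5$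 be the set of critical points of the momentum map $H\times L\times K:\mathcal P^5\to\mathbb R^3$. Define the critical subsystems $\mathcal M_1,\dots,\mathcal M_4\subset\mathcal P^5$ as follows. $\mathcal M_1$ is given in $\mathcal P^5$ by $Z^{(1)}_1=Z^{(1)}_2=0$, where $Z^{(1)}_1=\tfrac14(M_1^2-M_2^2)+\varepsilon_1(\alpha_2M_3-\alpha_3M_2)+\varepsilon_0\alpha_1-\varepsilon_1^2a^2$ and $Z^{(1)}_2=\tfrac12M_1M_2+\varepsilon_1(\alpha_3M_1-\alpha_1M_3)+\varepsilon_0\alpha_2$. $\mathcal M_2$ is given in $\mathcal P^5$ by $Z^{(2)}_1=Z^{(2)}_2=0$, where $$Z_1^{(2)}=\frac{\sqrt{\varepsilon_0^2+\varepsilon_1^2(M_1^2+M_3^2)}}{\varepsilon_1\sqrt{\varepsilon_0^2+\varepsilon_1^2M_3^2}}\bigl[\varepsilon_1^2(M_3-2\varepsilon_1\alpha_2)M_3-2\varepsilon_0\varepsilon_1^2\alpha_1+\varepsilon_0^2\bigr],$$ $$Z_2^{(2)}=\frac{1}{\sqrt{\varepsilon_0^2+\varepsilon_1^2M_3^2}}\bigl[\varepsilon_1^2(M_2+2\varepsilon_1\alpha_3)M_3^2+2\varepsilon_1^3\alpha_1M_1M_3+\varepsilon_0(\varepsilon_0M_2-2\varepsilon_1^2\alpha_2M_1+2\varepsilon_0\varepsilon_1\alpha_3)\bigr].$$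 With $w_{1,2}=\tfrac12(M_1\pm iM_2)$, $x_{1,2}=\alpha_1\pm i\alpha_2$, $\xi_{1,2}=Z_1^{(1)}\pm iZ_2^{(1)}$, $\mathcal M_3$ is the closure of the set of points of $\mathcal P^5$ with $x_1x_2\ne0$ and $Z^{(3)}_1=Z^{(3)}_2=0$, where $$Z_1^{(3)}=\sqrt{x_1x_2}\,M_3-\frac{1}{\sqrt{x_1x_2}}\bigl[(w_1x_2+w_2x_1)\alpha_3-ia^2\varepsilon_1(x_1-x_2)\bigr],\qquad Z_2^{(3)}=\frac1i\Bigl(\frac{x_2}{x_1}\xi_1-\frac{x_1}{x_2}\xi_2\Bigr).$$ $\mathcal M_4$ is given in $\mathcal P^5$ by $M_2=0$ and $\tfrac12M_1M_3-\varepsilon_1\alpha_2M_1+\varepsilon_0\alpha_3=0$. For a function $f$ on $\mathbb R^6$ and a zero $x$ of its Hamiltonian field $\operatorname{sgrad}f=\{f,\cdot\}$, let $A_f$ be the linearization of this field at $x$. A point of $\mathcal P^5$ has rank $0$ if the differential of $H\times K$ vanishes on the tangent space of the leaf $\mathcal P^4_\ell$ through it. At a point of rank $0$ call a linear combination of $A_H,A_K$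 regular if the four roots of its characteristic polynomial divided by $\mu^2$ are distinct. The point is non-degenerate if $A_H,A_K$ are linearly independent and a regular combination exists; it is of type center-center, saddle-saddle or center-saddle if these four roots, for every regular combination, are respectively all purely imaginary, all real, or one purely imaginary pair and one real pair. A point $x\in\mathcal M_i$ of rank $0$ has external type center (saddle) with respect to $\mathcal M_i$ if the operator $A_{\Phi_i\circ(H,L,K)}$ at $x$ has characteristic polynomial $\mu^4(\mu^2-\lambda)$ with $\lambda<0$ ($\lambda>0$). Here $$\Phi_1=k,\quad \Phi_2=k-\tfrac{1}{4\varepsilon_1^4}[2\varepsilon_1^2(h+\varepsilon_1^2a^2)+\varepsilon_0^2]^2,\quad \Phi_3=k-\tfrac{1}{a^4}[a^2(h+\varepsilon_1^2a^2)-2\ell^2]^2,\quad \Phi_4=k-2(h_0+\varepsilon_1^2a^2-s_0)h,$$ where in $\Phi_4$ the constants are $h_0=H(x)$ and $s_0=S(x)$, with $S=M_3(\tfrac12M_3-\varepsilon_1\alpha_2)-\varepsilon_0\alpha_1$ (on $\mathcal M_4$ this equals $-2\varepsilon_0L/M_1$ wherever $M_1\ne0$). Theorem. (1) $\mathcal C=\mathcal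 M_1\cup\mathcal M_2\cup\mathcal M_3\cup\mathcal M_4$. (2) Every non-degenerate point $x$ of rank $0$ belongs to exactly two of the subsystems, $\mathcal M_i$ and $\mathcal M_j$ with $i\ne j$, and is a transversal intersection of open parts of them: near $x$ the sets $\mathcal M_i,\mathcal M_j$ are smooth three-dimensional submanifolds meeting transversally at $x$ in $\mathcal P^5$, and their intersections with the leaf $\mathcal P^4_\ell\ni x$ are, near $x$, smooth two-dimensional submanifolds meeting transversally at $x$ in $\mathcal P^4_\ell$. (3) At such a point $x$ both external types, with respect to $\mathcal M_i$ and with respect to $\mathcal M_j$, are defined, and they determine the type of $x$: two centers give center-center, two saddles give saddle-saddle, a center and a saddle give center-saddle. -/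

import Mathlib

open Polynomial
open scoped ContDiff Matrix

namespace KS

noncomputable section

/-- The physical parameters: the radius `a` of the Poisson sphere, the potential parameter `e0`
and the gyroscopic parameter `e1`. -/
structure Params where
  a : ℝ
  e0 : ℝ
  e1 : ℝ

/-- The coalgebra `e(3)* = ℝ⁶`; a point is a pair `(M, α)`.
The coordinates are numbered `0, 1, 2`, so `x.1 0` is `M₁` and `x.2 2` is `α₃`. -/
abbrev Phase : Type := (Fin 3 → ℝ) × (Fin 3 → ℝ)

/-- The gradient of `f` in the variables `M`. -/
def gradM (f : Phase → ℝ) (x : Phase) : Fin 3 → ℝ :=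
  fun i => fderiv ℝ f x (Pi.single i 1, 0)

/-- The gradient of `f` in the variables `α`. -/
def gradA (f : Phase → ℝ) (x : Phase) : Fin 3 → ℝ :=
  fun i => fderiv ℝ f x (0, Pi.single i 1)

/-- The Hamiltonian vector field `x' = {f, x}` of `f` for the Lie-Poisson bracket
`{Mᵢ, Mⱼ} = εᵢⱼₖ Mₖ`, `{Mᵢ, αⱼ} = εᵢⱼₖ αₖ`, `{αᵢ, αⱼ} = 0`, that is
`M' = M × ∂f/∂M + α × ∂f/∂α`, `α' = α × ∂f/∂M`. -/
def sgrad (f : Phase → ℝ) (x : Phase) : Phase :=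
  (x.1 ⨯₃ gradM f x + x.2 ⨯₃ gradA f x, x.2 ⨯₃ gradM f x)

/-- The operator on `ℝ⁶` of the linearization at `x` of the Hamiltonian field of `f`. -/
def linOp (f : Phase → ℝ) (x : Phase) : Module.End ℝ Phase :=
  (fderiv ℝ (sgrad f) x : Phase →ₗ[ℝ] Phase)

/-! ### First integrals -/

/-- The area integral, a Casimir function. -/
def L (x : Phase) : ℝ := (x.1 ⬝ᵥ x.2) / 2

/-- The geometric integral, a Casimir function. -/
def Gam (x : Phase) : ℝ := x.2 ⬝ᵥ x.2

/-- The Hamiltonian. -/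
def H (p : Params) (x : Phase) : ℝ :=
  (x.1 0 ^ 2 + x.1 1 ^ 2 + 2 * x.1 2 ^ 2) / 4
    + p.e1 * (x.2 2 * x.1 1 - x.2 1 * x.1 2) - p.e0 * x.2 0

/-- The additional first integral. -/
def K (p : Params) (x : Phase) : ℝ :=
  ((x.1 0 ^ 2 - x.1 1 ^ 2) / 4 + p.e1 * (x.2 1 * x.1 2 - x.2 2 * x.1 1)
      - p.e1 ^ 2 * (x.2 0 ^ 2 + x.2 1 ^ 2 + x.2 2 ^ 2) + p.e0 * x.2 0) ^ 2
    + (x.1 0 * x.1 1 / 2 + p.e1 * (x.2 2 * x.1 0 - x.2 0 * x.1 2) + p.e0 * x.2 1) ^ 2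

/-- The momentum map `H × L × K`. -/
def momentumMap (p : Params) (x : Phase) : ℝ × ℝ × ℝ := (H p x, L x, K p x)

/-! ### Phase spaces, critical points, rank -/

/-- The five-dimensional phase space `ℝ³ × S²`, `α² = a²`. -/
def P5 (p : Params) : Set Phase := {x | Gam x = p.a ^ 2}

/-- The four-dimensional phase space of the reduced system, `L = l`, `α² = a²`. -/
def P4 (p : Params) (l : ℝ) : Set Phase := {x | L x = l ∧ Gam x = p.a ^ 2}

/-- The tangent space of `P5` at `x`. -/
def T5 (x : Phase) : Submodule ℝ Phase :=
  LinearMap.ker (fderiv ℝ Gam x : Phase →ₗ[ℝ] ℝ)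

/-- The tangent space at `x` of the symplectic leaf `P4` through `x`. -/
def T4 (x : Phase) : Submodule ℝ Phase :=
  LinearMap.ker (fderiv ℝ L x : Phase →ₗ[ℝ] ℝ) ⊓ T5 x

/-- The critical points of the momentum map `H × L × K : P5 → ℝ³`: the points at which
its differential is not onto. -/
def criticalSet (p : Params) : Set Phase :=
  {x | x ∈ P5 p ∧ ¬ Function.Surjective (fun v : T5 x => fderiv ℝ (momentumMap p) x v)}

/-- The rank at `x` of the momentum map `H × K` of the reduced system on the leaf through `x`. -/
def reducedRank (p : Params) (x : Phase) : ℕ :=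
  Module.finrank ℝ (LinearMap.range
    ((fderiv ℝ (fun y => (H p y, K p y)) x : Phase →ₗ[ℝ] ℝ × ℝ).domRestrict (T4 x)))

/-- The points of rank `0`. -/
def rankZeroSet (p : Params) : Set Phase := {x | x ∈ P5 p ∧ reducedRank p x = 0}

/-! ### Non-degenerate points of rank zero and their types -/

/-- The characteristic polynomial divided by `μ²` (two eigenvalues on `ℝ⁶` vanish because of
the two Casimir functions). -/
def redCharpoly (A : Module.End ℝ Phase) : ℝ[X] := A.charpoly.divX.divX

/-- The complex roots, with multiplicity, of the reduced characteristic polynomial. -/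
def eigs (A : Module.End ℝ Phase) : Multiset ℂ :=
  ((redCharpoly A).map (algebraMap ℝ ℂ)).roots

/-- `A` is a regular element at `x`: a linear combination of the linearizations of the fields of
`H` and `K` all of whose four eigenvalues are distinct. -/
def IsRegularElement (p : Params) (x : Phase) (A : Module.End ℝ Phase) : Prop :=
  (∃ c d : ℝ, A = c • linOp (H p) x + d • linOp (K p) x) ∧ (eigs A).Nodup

/-- Non-degenerate points of rank `0`. -/
def IsNondegenerate (p : Params) (x : Phase) : Prop :=
  x ∈ rankZeroSet p ∧ LinearIndependent ℝ ![linOp (H p) x, linOp (K p) x] ∧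
    ∃ A, IsRegularElement p x A

/-- The possible types of non-degenerate points of rank `0`. -/
inductive PointType
  | centerCenter
  | centerSaddle
  | saddleSaddle
  | focusFocus

/-- The type prescribed by the eigenvalues of a regular element. -/
def EigsHaveType (s : Multiset ℂ) : PointType → Prop
  | .centerCenter => ∀ z ∈ s, z.re = 0
  | .centerSaddle => ∃ r t : ℝ, r ≠ 0 ∧ t ≠ 0 ∧
      s = {(r : ℂ) * Complex.I, -((r : ℂ) * Complex.I), (t : ℂ), -(t : ℂ)}
  | .saddleSaddle => ∀ z ∈ s, z.im = 0
  | .focusFocus => ∃ r t : ℝ, r ≠ 0 ∧ t ≠ 0 ∧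
      s = {(t : ℂ) + (r : ℂ) * Complex.I, (t : ℂ) - (r : ℂ) * Complex.I,
        -(t : ℂ) + (r : ℂ) * Complex.I, -(t : ℂ) - (r : ℂ) * Complex.I}

/-- The non-degenerate point `x` of rank `0` has type `t`. -/
def HasPointType (p : Params) (x : Phase) (t : PointType) : Prop :=
  IsNondegenerate p x ∧ ∀ A, IsRegularElement p x A → EigsHaveType (eigs A) t

/-! ### The critical subsystems -/

/-- The first pair of invariant relations. -/
def Z11 (p : Params) (x : Phase) : ℝ :=
  (x.1 0 ^ 2 - x.1 1 ^ 2) / 4 + p.e1 * (x.2 1 * x.1 2 - x.2 2 * x.1 1)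
    + p.e0 * x.2 0 - p.e1 ^ 2 * p.a ^ 2

/-- See `Z11`. -/
def Z12 (p : Params) (x : Phase) : ℝ :=
  x.1 0 * x.1 1 / 2 + p.e1 * (x.2 2 * x.1 0 - x.2 0 * x.1 2) + p.e0 * x.2 1

/-- The second pair of invariant relations. -/
def Z21 (p : Params) (x : Phase) : ℝ :=
  √(p.e0 ^ 2 + p.e1 ^ 2 * (x.1 0 ^ 2 + x.1 2 ^ 2)) / (p.e1 * √(p.e0 ^ 2 + p.e1 ^ 2 * x.1 2 ^ 2))
    * (p.e1 ^ 2 * (x.1 2 - 2 * p.e1 * x.2 1) * x.1 2 - 2 * p.e0 * p.e1 ^ 2 * x.2 0 + p.e0 ^ 2)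

/-- See `Z21`. -/
def Z22 (p : Params) (x : Phase) : ℝ :=
  1 / √(p.e0 ^ 2 + p.e1 ^ 2 * x.1 2 ^ 2)
    * (p.e1 ^ 2 * (x.1 1 + 2 * p.e1 * x.2 2) * x.1 2 ^ 2
      + 2 * p.e1 ^ 3 * x.2 0 * x.1 0 * x.1 2
      + p.e0 * (p.e0 * x.1 1 - 2 * p.e1 ^ 2 * x.2 1 * x.1 0 + 2 * p.e0 * p.e1 * x.2 2))

/-- `w₁ = (M₁ + i M₂) / 2`. -/
def w1 (x : Phase) : ℂ := ((x.1 0 : ℂ) + Complex.I * (x.1 1 : ℂ)) / 2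

/-- `w₂ = (M₁ - i M₂) / 2`. -/
def w2 (x : Phase) : ℂ := ((x.1 0 : ℂ) - Complex.I * (x.1 1 : ℂ)) / 2

/-- `x₁ = α₁ + i α₂`. -/
def x1 (x : Phase) : ℂ := (x.2 0 : ℂ) + Complex.I * (x.2 1 : ℂ)

/-- `x₂ = α₁ - i α₂`. -/
def x2 (x : Phase) : ℂ := (x.2 0 : ℂ) - Complex.I * (x.2 1 : ℂ)

/-- `ξ₁`. -/
def xi1 (p : Params) (x : Phase) : ℂ := (Z11 p x : ℂ) + Complex.I * (Z12 p x : ℂ)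

/-- `ξ₂`. -/
def xi2 (p : Params) (x : Phase) : ℂ := (Z11 p x : ℂ) - Complex.I * (Z12 p x : ℂ)

/-- The positive root of `x₁ x₂ = α₁² + α₂²`. -/
def rho (x : Phase) : ℝ := √(x.2 0 ^ 2 + x.2 1 ^ 2)

/-- The third pair of invariant relations, meaningful where `x₁ x₂ ≠ 0` (the values are real
numbers, written in complex variables). -/
def Z31 (p : Params) (x : Phase) : ℂ :=
  (rho x : ℂ) * (x.1 2 : ℂ)
    - 1 / (rho x : ℂ) * ((w1 x * x2 x + w2 x * x1 x) * (x.2 2 : ℂ)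
      - Complex.I * (p.a : ℂ) ^ 2 * (p.e1 : ℂ) * (x1 x - x2 x))

/-- See `Z31`. -/
def Z32 (p : Params) (x : Phase) : ℂ :=
  1 / Complex.I * (x2 x / x1 x * xi1 p x - x1 x / x2 x * xi2 p x)

/-- The fourth pair of invariant relations. -/
def Z41 (x : Phase) : ℝ := x.1 1

/-- See `Z41`. -/
def Z42 (p : Params) (x : Phase) : ℝ :=
  x.1 0 * x.1 2 / 2 - p.e1 * x.2 1 * x.1 0 + p.e0 * x.2 2

/-- The four critical subsystems (numbered `0, 1, 2, 3`); the third one is a closure. -/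
def subsystem (p : Params) : Fin 4 → Set Phase
  | 0 => {x | x ∈ P5 p ∧ Z11 p x = 0 ∧ Z12 p x = 0}
  | 1 => {x | x ∈ P5 p ∧ Z21 p x = 0 ∧ Z22 p x = 0}
  | 2 => closure {x | x ∈ P5 p ∧ x1 x * x2 x ≠ 0 ∧ Z31 p x = 0 ∧ Z32 p x = 0}
  | 3 => {x | x ∈ P5 p ∧ Z41 x = 0 ∧ Z42 p x = 0}

/-! ### External types -/

/-- The partial integral `S = -2 ε₀ L / M₁` of the fourth subsystem, in the polynomial form which
is defined also at the points of this subsystem with `M₁ = 0`. -/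
def S (p : Params) (x : Phase) : ℝ :=
  x.1 2 * (x.1 2 / 2 - p.e1 * x.2 1) - p.e0 * x.2 0

/-- On the fourth subsystem `S` is `-2 ε₀ L / M₁` wherever `M₁ ≠ 0`. -/
theorem S_eq (p : Params) (x : Phase) (h1 : Z41 x = 0) (h2 : Z42 p x = 0) (hM : x.1 0 ≠ 0) :
    S p x = -2 * p.e0 * L x / x.1 0 := by
  rw [eq_div_iff hM]
  simp only [Z41, Z42] at h1 h2
  simp only [S, L, dotProduct, Fin.sum_univ_three, h1]
  linear_combination x.1 2 * h2

/-- The functions `Φ(h, l, k)` generating the critical subsystems. For the fourth subsystem this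
is `k - 2 (h₀ + ε₁² a² - s₀) h`, the coefficient being a constant, calculated at the point `x₀`
under consideration; the first three functions do not depend on `x₀`. -/
def genFun (p : Params) (x₀ : Phase) : Fin 4 → ℝ → ℝ → ℝ → ℝ
  | 0 => fun _ _ k => k
  | 1 => fun h _ k =>
      k - 1 / (4 * p.e1 ^ 4) * (2 * p.e1 ^ 2 * (h + p.e1 ^ 2 * p.a ^ 2) + p.e0 ^ 2) ^ 2
  | 2 => fun h l k => k - (p.a ^ 2 * (h + p.e1 ^ 2 * p.a ^ 2) - 2 * l ^ 2) ^ 2 / p.a ^ 4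
  | 3 => fun h _ k => k - 2 * (H p x₀ + p.e1 ^ 2 * p.a ^ 2 - S p x₀) * h

/-- The symplectic operator at `x` of the `i`-th subsystem: the linearization of the Hamiltonian
field of the composition of the generating function with the momentum map. -/
def extOp (p : Params) (i : Fin 4) (x : Phase) : Module.End ℝ Phase :=
  linOp (fun y => genFun p x i (H p y) (L y) (K p y)) x

/-- External types. -/
inductive ExtType
  | center
  | saddle

/-- The sign of `c` prescribed by the external type. -/
def ExtType.SignOf : ExtType → ℝ → Prop
  | .center, c => c < 0
  | .saddle, c => 0 < c

/-- The external type of `x` with respect to the `i`-th subsystem is `e`: the characteristic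
polynomial is `μ⁴ (μ² - c)`, and `c < 0` for a center, `c > 0` for a saddle. -/
def HasExtType (p : Params) (i : Fin 4) (x : Phase) (e : ExtType) : Prop :=
  ∃ c : ℝ, (extOp p i x).charpoly = X ^ 4 * (X ^ 2 - C c) ∧ e.SignOf c

/-- The type of a point of rank `0` composed of two external types. -/
def combine : ExtType → ExtType → PointType
  | .center, .center => .centerCenter
  | .center, .saddle => .centerSaddle
  | .saddle, .center => .centerSaddle
  | .saddle, .saddle => .saddleSaddle

/-! ### Smooth pieces -/

/-- A neighbourhood of `x` in the set `N` is a smooth embedded `d`-dimensional submanifold of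
`ℝ⁶` through `x`, with tangent space `T` at `x`. -/
def IsSmoothPiece (N : Set Phase) (x : Phase) (d : ℕ) (T : Submodule ℝ Phase) : Prop :=
  x ∈ N ∧ ∃ m : ℕ, m + d = 6 ∧ ∃ U : Set Phase, IsOpen U ∧ x ∈ U ∧
    ∃ G : Phase → (Fin m → ℝ), ContDiffOn ℝ ∞ G U ∧
      (∀ y ∈ U, Function.Surjective (fderiv ℝ G y)) ∧
      N ∩ U = {y | y ∈ U ∧ G y = 0} ∧
      T = LinearMap.ker (fderiv ℝ G x : Phase →ₗ[ℝ] (Fin m → ℝ))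

/-- Near `x` the sets `N₁`, `N₂` are smooth three-dimensional submanifolds of `P5` which meet
transversally in `P5` at `x`, and their intersections with the leaf `P4` through `x` are smooth
two-dimensional submanifolds which meet transversally in `P4` at `x`. -/
def MeetTransversally (p : Params) (N₁ N₂ : Set Phase) (x : Phase) : Prop :=
  (∃ W₁ W₂ : Submodule ℝ Phase, IsSmoothPiece N₁ x 3 W₁ ∧ IsSmoothPiece N₂ x 3 W₂ ∧
    W₁ ⊔ W₂ = T5 x) ∧
  ∃ V₁ V₂ : Submodule ℝ Phase, IsSmoothPiece (N₁ ∩ P4 p (L x)) x 2 V₁ ∧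
    IsSmoothPiece (N₂ ∩ P4 p (L x)) x 2 V₂ ∧ V₁ ⊔ V₂ = T4 x

end

end KS

set_option linter.unusedSimpArgs false
set_option linter.flexible false

namespace KS

noncomputable section

/-! The linear change `red` replaces `M` by shifted angular velocities `O1`, `O2`, `r` and scales
`α` to `(a1, a2, z)`; only the parameter `e = ε₀/ε₁` is left. With `O = O1 + i O2`, `α = a1 + i a2`
one has `Z = Z1 + i Z2 = O² + α (e - a1 - i r)` and `K = |Z|²`, and most of the elimination below is
complex arithmetic written in real and imaginary parts.

Claim (1) is a Lagrange multiplier problem: a point is critical iff `A dK + B dH + C dL + D dΓ = 0`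
nontrivially. For `A = 0` the equations are linear and are solved by `equilibrium_cases`. For `A =
1` the horizontal equations read `2 Z Ō + B O + C α = 0`, a real linear system for `O` with
determinant governed by `4|Z|² - B²`; splitting by its vanishing leads to one of the four pairs of
relations (`CriticalRelation.alternative`). Over the poles `a1 = a2 = 0` the elimination leaves one
equation, whose solutions are limits of points of the third subsystem (`pole_mem_rsub_two`); this is
where the closure is needed. Conversely each pair of relations admits explicit multipliers
(`of_second`, `of_third`, `of_fourth`), and criticality is a closed condition.

For (2) and (3), rank `0` forces `dH` to be a combination of `dL` and `dΓ`, so the point lies in one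
of three explicit families, each contained in two subsystems: `axisPoint` (third and fourth),
`midPoint` (second and third), `sidePoint` (first and fourth). The multipliers show that the field
`X_K - σᵢ X_H` vanishes on the relations of the `i`-th subsystem. Its linearization at an
equilibrium is therefore expressed through the differentials of the two relations: it is an operator
`f ⊗ U + g ⊗ W` of rank at most two (`Branch`), and it equals the symplectic operator of the
subsystem. The operators of the two subsystems annihilate each other's images (`BranchPair`). If `σᵢ
≠ σⱼ`, every combination of `A_H`, `A_K` is a combination of these two blocks, so its reduced
characteristic polynomial is `(μ² - c² λᵢ)(μ² - d² λⱼ)`, where `λᵢ`, `λⱼ` are the external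
eigenvalues. Non-degeneracy gives `λᵢ, λⱼ ≠ 0`; this makes the four relations and the Casimir
functions independent, which is transversality, and the signs of `λᵢ`, `λⱼ` give the type. The same
inequalities exclude the remaining subsystems. The coincidence `σᵢ = σⱼ` occurs only on the axis
family, where all eigenvalues are double and the point is degenerate. -/

/-! ### Elimination of the multipliers -/

theorem equilibrium_cases {e O1 O2 r a1 a2 z C D : ℝ}
    (h1 : O1 = -C * a1) (h2 : O2 = -C * a2) (h3 : r = -C * z)
    (h4 : -e + 2 * C * O1 + 2 * D * a1 = 0) (h5 : -a2 + C * (2 * O2 - z) + 2 * D * a2 = 0)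
    (h6 : -2 * z + C * (r - a2) + 2 * D * z = 0) :
    (z = 0 ∧ a2 = 0) ∨ (e = 2 * a1 ∧ a2 = C * z) ∨ (e = (1 - C ^ 2) * a1 ∧ z = -C * a2) := by
  subst h1 h2 h3
  -- In terms of `E` the last two equations form a homogeneous linear system for `(a2, z)` with
  -- determinant `(E - 2) (E - 1 + C²)`. The three cases are the zero solution and the two roots.
  obtain ⟨E, hE⟩ : ∃ E, E = 2 * D - 2 * C ^ 2 := ⟨_, rfl⟩
  have k1 : e = E * a1 := by rw [hE]; linarith
  have k2 : C * z = (E - 1) * a2 := by rw [hE]; linarith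
  have k3 : z * (E + C ^ 2 - 2) = C * a2 := by rw [hE]; linarith
  by_cases hz : z = 0
  · subst hz
    by_cases ha : a2 = 0
    · exact Or.inl ⟨rfl, ha⟩
    · have hC : C = 0 := by
        have : C * a2 = 0 := by linarith
        simpa [ha] using this
      have hE1 : E = 1 := by
        have : (E - 1) * a2 = 0 := by linarith
        have := (mul_eq_zero.1 this).resolve_right ha
        linarith
      right; right
      rw [hE1] at k1
      rw [hC]
      constructor <;> linarith
  · have h : (E - 2) * (E - 1 + C ^ 2) = 0 := by
      have : z * ((E - 2) * (E - 1 + C ^ 2)) = 0 := by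
        linear_combination (E - 1) * k3 - C * k2
      exact (mul_eq_zero.1 this).resolve_left hz
    rcases mul_eq_zero.1 h with h | h
    · have hE2 : E = 2 := by linarith
      rw [hE2] at k1 k2
      right; left
      constructor <;> linarith
    · have hE2 : E = 1 - C ^ 2 := by linarith
      rw [hE2] at k1 k2 k3
      right; right
      refine ⟨k1, ?_⟩
      linear_combination -k3

/-- The conclusion of the elimination: a critical covector relation forces one of the four pairs
of invariant relations, or a point over the poles of the Poisson sphere. -/
def CriticalAlternative (e O1 O2 r a1 a2 z Z1 Z2 : ℝ) : Prop :=
  (Z1 = 0 ∧ Z2 = 0) ∨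
  (r ^ 2 - a2 ^ 2 - 2 * e * a1 + e ^ 2 = 0 ∧
    a1 * (e * O2 + (r + a2) * O1) + a2 * ((r + a2) * O2 - e * O1) = 0) ∨
  (a1 ^ 2 + a2 ^ 2 ≠ 0 ∧ (a1 ^ 2 + a2 ^ 2) * (r - a2) = 2 * (O1 * a1 + O2 * a2) * z ∧
    (a1 ^ 2 - a2 ^ 2) * Z2 - 2 * a1 * a2 * Z1 = 0) ∨
  (O2 = z ∧ O1 * (r - a2) + e * z = 0) ∨
  (a1 = 0 ∧ a2 = 0 ∧ O1 ^ 2 + O2 ^ 2 ≠ 0 ∧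
    e * z * O1 - r * z * O2 + (O1 ^ 2 + O2 ^ 2) * r = 0)

/-- The case of a relation without `dK`. The three solution families of `equilibrium_cases` fall
into the fourth, the third and the fourth subsystem respectively. -/
theorem criticalAlternative_of_energy {e O1 O2 r a1 a2 z Z1 Z2 C D : ℝ} (he : 0 < e)
    (hZ1 : Z1 = O1 ^ 2 - O2 ^ 2 + a1 * (e - a1) + a2 * r)
    (hZ2 : Z2 = 2 * O1 * O2 + a2 * (e - a1) - a1 * r)
    (h1 : O1 = -C * a1) (h2 : O2 = -C * a2) (h3 : r = -C * z)
    (h4 : -e + 2 * C * O1 + 2 * D * a1 = 0) (h5 : -a2 + C * (2 * O2 - z) + 2 * D * a2 = 0)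
    (h6 : -2 * z + C * (r - a2) + 2 * D * z = 0) :
    CriticalAlternative e O1 O2 r a1 a2 z Z1 Z2 := by
  rcases equilibrium_cases h1 h2 h3 h4 h5 h6 with ⟨hz, ha⟩ | ⟨hx, ha⟩ | ⟨hx, ha⟩
  · subst hz ha
    right; right; right; left
    rw [h2, h3]; constructor <;> ring
  · right; right; left
    have : a1 ≠ 0 := by rintro rfl; linarith
    refine ⟨by positivity, ?_, ?_⟩
    · rw [h1, h2, h3]; linear_combination (-(a1^2 + a2^2)) * ha
    · rw [hZ2, hZ1, h1, h2, h3, hx, ha]; ring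
  · right; right; right; left
    rw [h1, h2, h3, hx, ha]
    constructor <;> ring

/-- The case of vanishing horizontal components of `α`. -/
theorem criticalAlternative_pole {e O1 O2 r z B C : ℝ}
    (hO : O1 ^ 2 + O2 ^ 2 ≠ 0)
    (h1 : 4 * O1 * (O1 ^ 2 - O2 ^ 2) + 4 * O2 * (2 * O1 * O2) + 2 * B * O1 = 0)
    (h2 : -4 * O2 * (O1 ^ 2 - O2 ^ 2) + 4 * O1 * (2 * O1 * O2) + 2 * B * O2 = 0)
    (h3 : B * r + C * z = 0)
    (h4 : 2 * (O1 ^ 2 - O2 ^ 2) * e + 2 * (2 * O1 * O2) * (-r) - B * e + 2 * C * O1 = 0)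
    (h5 : 2 * (O1 ^ 2 - O2 ^ 2) * r + 2 * (2 * O1 * O2) * e + C * (2 * O2 - z) = 0) :
    e * z * O1 - r * z * O2 + (O1 ^ 2 + O2 ^ 2) * r = 0 := by
  -- Here `Z = O²`, so the first two equations say `(2|O|² + B) O = 0`.
  have hB : B = -2 * (O1 ^ 2 + O2 ^ 2) := by
    have : (O1 ^ 2 + O2 ^ 2) * (B + 2 * (O1 ^ 2 + O2 ^ 2)) = 0 := by
      linear_combination (O1 * h1 + O2 * h2) / 2
    have := (mul_eq_zero.1 this).resolve_left hO
    linarith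
  subst hB
  have hC : C * z = 2 * (O1 ^ 2 + O2 ^ 2) * r := by linarith
  have k4 : O1 * (e * z * O1 - r * z * O2 + (O1 ^ 2 + O2 ^ 2) * r) = 0 := by
    linear_combination z / 4 * h4 - O1 / 2 * hC
  have k5 : O2 * (e * z * O1 - r * z * O2 + (O1 ^ 2 + O2 ^ 2) * r) = 0 := by
    linear_combination z / 4 * h5 - (2 * O2 - z) / 4 * hC
  have : (O1 ^ 2 + O2 ^ 2) * (e * z * O1 - r * z * O2 + (O1 ^ 2 + O2 ^ 2) * r) = 0 := by
    linear_combination O1 * k4 + O2 * k5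
  exact (mul_eq_zero.1 this).resolve_left hO

/-- The coefficients of a critical covector relation `dK + B dH + C d(2L) + D dΓ = 0` in the
reduced coordinates. -/
structure CriticalRelation (e O1 O2 r a1 a2 z Z1 Z2 B C D : ℝ) : Prop where
  z1 : Z1 = O1 ^ 2 - O2 ^ 2 + a1 * (e - a1) + a2 * r
  z2 : Z2 = 2 * O1 * O2 + a2 * (e - a1) - a1 * r
  dO1 : 4 * O1 * Z1 + 4 * O2 * Z2 + 2 * B * O1 + 2 * C * a1 = 0
  dO2 : -4 * O2 * Z1 + 4 * O1 * Z2 + 2 * B * O2 + 2 * C * a2 = 0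
  dr : 2 * Z1 * a2 - 2 * Z2 * a1 + B * r + C * z = 0
  da1 : 2 * Z1 * (e - 2 * a1) - 2 * Z2 * (a2 + r) - B * e + 2 * C * O1 + 2 * D * a1 = 0
  da2 : 2 * Z1 * r + 2 * Z2 * (e - a1) - B * a2 + C * (2 * O2 - z) + 2 * D * a2 = 0
  dz : -2 * B * z + C * (r - a2) + 2 * D * z = 0

namespace CriticalRelation

variable {e O1 O2 r a1 a2 z Z1 Z2 B C D : ℝ}

/-- The equations `dO1`, `dO2` are `2 Z Ō + B O + C α = 0`. Eliminating `Ō` with the conjugate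
equation gives `(4|Z|² - B²) O + C (2 Z ᾱ - B α) = 0`; this is its real part, and `solve_O2` is the
imaginary part. -/
theorem solve_O1 (h : CriticalRelation e O1 O2 r a1 a2 z Z1 Z2 B C D) :
    (4 * (Z1 ^ 2 + Z2 ^ 2) - B ^ 2) * O1 + C * (2 * (Z1 * a1 + Z2 * a2) - B * a1) = 0 := by
  linear_combination Z1 * h.dO1 + Z2 * h.dO2 - B / 2 * h.dO1

theorem solve_O2 (h : CriticalRelation e O1 O2 r a1 a2 z Z1 Z2 B C D) :
    (4 * (Z1 ^ 2 + Z2 ^ 2) - B ^ 2) * O2 + C * (2 * (Z2 * a1 - Z1 * a2) - B * a2) = 0 := by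
  linear_combination Z2 * h.dO1 - Z1 * h.dO2 - B / 2 * h.dO2

/-- The relation evaluated on the rotation of `α` with unit speed and of `O` with speed one half.
These weights make both terms `O²` and `α (e - a1 - i r)` of `Z` turn alike, up to the variation of
`a1` in the second factor. -/
theorem torque (h : CriticalRelation e O1 O2 r a1 a2 z Z1 Z2 B C D) :
    -C * (O2 * a1 - O1 * a2) - 2 * (Z1 * a1 + Z2 * a2) * a2 + B * a2 * (a1 - e)
      + z * C * a1 = 0 := by
  linear_combination a2 * h.da1 - a1 * h.da2 + (O2 * h.dO1 - O1 * h.dO2) / 2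
    + 2 * (Z1 * h.z2 - Z2 * h.z1)

/-- The companion of `torque` for scaling: `α` has weight one and `O` weight one half. -/
theorem virial (h : CriticalRelation e O1 O2 r a1 a2 z Z1 Z2 B C D) :
    2 * (Z1 ^ 2 + Z2 ^ 2) + B * (O1 ^ 2 + O2 ^ 2) + 3 * C * (O1 * a1 + O2 * a2)
      - 2 * (Z1 * a1 + Z2 * a2) * a1 - B * (a2 ^ 2 + e * a1) - z * C * a2
      + 2 * D * (a1 ^ 2 + a2 ^ 2) = 0 := by
  linear_combination a1 * h.da1 + a2 * h.da2 + (O1 * h.dO1 + O2 * h.dO2) / 2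
    + 2 * (Z1 * h.z1 + Z2 * h.z2)

/-- Real part of `Z ᾱ = O (O ᾱ) + |α|² (e - a1 - i r)`; the imaginary part is `q_eq`. -/
theorem p_eq (h : CriticalRelation e O1 O2 r a1 a2 z Z1 Z2 B C D) :
    Z1 * a1 + Z2 * a2 = O1 * (O1 * a1 + O2 * a2) - O2 * (O2 * a1 - O1 * a2)
      + (a1 ^ 2 + a2 ^ 2) * (e - a1) := by
  linear_combination a1 * h.z1 + a2 * h.z2

theorem q_eq (h : CriticalRelation e O1 O2 r a1 a2 z Z1 Z2 B C D) :
    Z2 * a1 - Z1 * a2 = O1 * (O2 * a1 - O1 * a2) + O2 * (O1 * a1 + O2 * a2)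
      - (a1 ^ 2 + a2 ^ 2) * r := by
  linear_combination a1 * h.z2 - a2 * h.z1

/-- When the determinant vanishes and `C ≠ 0`, the solvability condition is `2 Z ᾱ = B α`. Hence `Z
ᾱ²` is real, which is the second relation of the third subsystem; the first one follows from `dr`.
-/
theorem alternative_of_double_of_ne (h : CriticalRelation e O1 O2 r a1 a2 z Z1 Z2 B C D)
    (hR : a1 ^ 2 + a2 ^ 2 ≠ 0) (hk : Z1 ^ 2 + Z2 ^ 2 ≠ 0)
    (hB : 4 * (Z1 ^ 2 + Z2 ^ 2) = B ^ 2) (hC : C ≠ 0) :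
    CriticalAlternative e O1 O2 r a1 a2 z Z1 Z2 := by
  have hB0 : B ≠ 0 := by
    rintro rfl
    exact hk (by linarith)
  have hp : 2 * (Z1 * a1 + Z2 * a2) - B * a1 = 0 := by
    have : C * (2 * (Z1 * a1 + Z2 * a2) - B * a1) = 0 := by
      linear_combination h.solve_O1 - O1 * hB
    exact (mul_eq_zero.1 this).resolve_left hC
  have hq : 2 * (Z2 * a1 - Z1 * a2) - B * a2 = 0 := by
    have : C * (2 * (Z2 * a1 - Z1 * a2) - B * a2) = 0 := by
      linear_combination h.solve_O2 - O2 * hB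
    exact (mul_eq_zero.1 this).resolve_left hC
  right; right; left
  refine ⟨hR, ?_, ?_⟩
  · have hu : 2 * B * (O1 * a1 + O2 * a2) + C * (a1 ^ 2 + a2 ^ 2) = 0 := by
      linear_combination (a1 * h.dO1 + a2 * h.dO2) / 2 - O1 * hp - O2 * hq
    have : B * ((a1 ^ 2 + a2 ^ 2) * (r - a2) - 2 * (O1 * a1 + O2 * a2) * z) = 0 := by
      linear_combination (a1 ^ 2 + a2 ^ 2) * h.dr - z * hu + (a1 ^ 2 + a2 ^ 2) * hq
    exact sub_eq_zero.1 ((mul_eq_zero.1 this).resolve_left hB0)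
  · linear_combination (a1 * hq - a2 * hp) / 2

theorem alternative_of_double_of_eq (h : CriticalRelation e O1 O2 r a1 a2 z Z1 Z2 B C D)
    (hR : a1 ^ 2 + a2 ^ 2 ≠ 0) (hk : Z1 ^ 2 + Z2 ^ 2 ≠ 0)
    (hB : 4 * (Z1 ^ 2 + Z2 ^ 2) = B ^ 2) (hC : C = 0) :
    CriticalAlternative e O1 O2 r a1 a2 z Z1 Z2 := by
  subst hC
  have hB0 : B ≠ 0 := by
    rintro rfl
    exact hk (by linarith)
  -- For `C = 0` and `a2 = 0` the identity `torque` is void, so this case is treated separately; if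
  -- moreover `r ≠ 0`, the rotation of `O` alone takes its place.
  by_cases ha : a2 = 0
  · subst ha
    have ha1 : a1 ≠ 0 := by
      rintro rfl
      exact hR (by ring)
    by_cases hr : r = 0
    · subst hr
      have hZ2 : Z2 = 0 := by
        have : a1 * Z2 = 0 := by linear_combination -h.dr / 2
        exact (mul_eq_zero.1 this).resolve_left ha1
      subst hZ2
      have hOO : O1 * O2 = 0 := by linear_combination -h.z2 / 2
      by_cases hOz : O1 * z = 0
      · right; right; left
        refine ⟨hR, ?_, by ring⟩
        linear_combination -2 * a1 * hOz
      · have hO1 : O1 ≠ 0 := left_ne_zero_of_mul hOz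
        have hz : z ≠ 0 := right_ne_zero_of_mul hOz
        have hO2 : O2 = 0 := (mul_eq_zero.1 hOO).resolve_left hO1
        have hZ1 : Z1 ≠ 0 := by
          rintro rfl
          exact hk (by ring)
        subst hO2
        have hB1 : B = -2 * Z1 := by
          have : O1 * (B + 2 * Z1) = 0 := by linear_combination h.dO1 / 2
          linarith [(mul_eq_zero.1 this).resolve_left hO1]
        have hD : D = B := by
          have : z * (D - B) = 0 := by linear_combination h.dz / 2
          linarith [(mul_eq_zero.1 this).resolve_left hz]
        have he : e = 2 * a1 := by
          have : Z1 * (e - 2 * a1) = 0 := by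
            have := h.da1
            rw [hD, hB1] at this
            linear_combination this / 4
          linarith [(mul_eq_zero.1 this).resolve_left hZ1]
        right; left
        subst he
        constructor <;> ring
    · have hZ2 : Z2 ≠ 0 := by
        rintro rfl
        have : B * r = 0 := by linear_combination h.dr
        exact (mul_ne_zero hB0 hr) this
      have hZ1 : Z1 * r + Z2 * (e - a1) = 0 := by
        have : a1 * (Z1 * r + Z2 * (e - a1)) = 0 := by
          linear_combination (O2 * h.dO1 - O1 * h.dO2) / 4 + Z1 * h.z2 - Z2 * h.z1
        exact (mul_eq_zero.1 this).resolve_left ha1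
      have hN : (e - a1) ^ 2 + r ^ 2 - a1 ^ 2 = 0 := by
        have : Z2 ^ 2 * ((e - a1) ^ 2 + r ^ 2 - a1 ^ 2) = 0 := by
          linear_combination r ^ 2 / 4 * hB + (Z2 * (e - a1) - Z1 * r) * hZ1
            + (B * r + 2 * Z2 * a1) / 4 * h.dr
        exact (mul_eq_zero.1 this).resolve_left (pow_ne_zero 2 hZ2)
      have hF : e * O2 + r * O1 = 0 := by
        have : Z2 * (e * O2 + r * O1) = 0 := by
          linear_combination r / 4 * h.dO2 + O2 * hZ1 - O2 / 2 * h.dr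
        exact (mul_eq_zero.1 this).resolve_left hZ2
      right; left
      constructor
      · linear_combination hN
      · linear_combination a1 * hF
  -- Now `hp` and `hq` say `2 Z ᾱ = B (a1 - e + i r)`. Comparing moduli gives `hN`; multiplying `2 Z
  -- Ō + B O = 0` by `ᾱ` gives `hre` and `him`, that is `(a1 - e + i r) Ō + O ᾱ = 0`.
  · have hp : 2 * (Z1 * a1 + Z2 * a2) - B * (a1 - e) = 0 := by
      have : a2 * (2 * (Z1 * a1 + Z2 * a2) - B * (a1 - e)) = 0 := by
        linear_combination -h.torque
      exact (mul_eq_zero.1 this).resolve_left ha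
    have hq : 2 * (Z2 * a1 - Z1 * a2) - B * r = 0 := by linear_combination -h.dr
    have hN : (a1 - e) ^ 2 + r ^ 2 - (a1 ^ 2 + a2 ^ 2) = 0 := by
      have : B ^ 2 * ((a1 - e) ^ 2 + r ^ 2 - (a1 ^ 2 + a2 ^ 2)) = 0 := by
        linear_combination (a1 ^ 2 + a2 ^ 2) * hB
          - (2 * (Z1 * a1 + Z2 * a2) + B * (a1 - e)) * hp
          - (2 * (Z2 * a1 - Z1 * a2) + B * r) * hq
      exact (mul_eq_zero.1 this).resolve_left (pow_ne_zero 2 hB0)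
    have hre : 2 * a1 * O1 - e * O1 + r * O2 + a2 * O2 = 0 := by
      have : B * (2 * a1 * O1 - e * O1 + r * O2 + a2 * O2) = 0 := by
        linear_combination (a1 * h.dO1 + a2 * h.dO2) / 2 - O1 * hp - O2 * hq
      exact (mul_eq_zero.1 this).resolve_left hB0
    have him : e * O2 + r * O1 - a2 * O1 = 0 := by
      have : B * (e * O2 + r * O1 - a2 * O1) = 0 := by
        linear_combination (a1 * h.dO2 - a2 * h.dO1) / 2 + O2 * hp - O1 * hq
      exact (mul_eq_zero.1 this).resolve_left hB0
    right; left
    constructor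
    · linear_combination hN
    · linear_combination a1 * him + a2 * hre

/-- For `O = 0` one has `Z = α (e - a1 - i r)`, and the equations for `r` and for the torque acquire
the common factor `B + 2|α|²` (once `D = B`). If it vanishes, `virial` leads to the second
subsystem; otherwise `r = 0`, and `a1 = e` is excluded by `Z ≠ 0`. -/
theorem alternative_of_rest (h : CriticalRelation e O1 O2 r a1 a2 z Z1 Z2 B C D)
    (hR : a1 ^ 2 + a2 ^ 2 ≠ 0) (hk : Z1 ^ 2 + Z2 ^ 2 ≠ 0) (hO1 : O1 = 0) (hO2 : O2 = 0) :
    CriticalAlternative e O1 O2 r a1 a2 z Z1 Z2 := by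
  subst hO1 hO2
  have hC : C = 0 := by
    have : (a1 ^ 2 + a2 ^ 2) * C = 0 := by
      linear_combination (a1 * h.dO1 + a2 * h.dO2) / 2
    exact (mul_eq_zero.1 this).resolve_left hR
  subst hC
  by_cases hz : z = 0
  · subst hz
    right; right; right; left
    constructor <;> ring
  have hD : D = B := by
    have : z * (D - B) = 0 := by linear_combination h.dz / 2
    linarith [(mul_eq_zero.1 this).resolve_left hz]
  subst hD
  have hp := h.p_eq
  have hq := h.q_eq
  have hkk : Z1 ^ 2 + Z2 ^ 2 = (a1 ^ 2 + a2 ^ 2) * ((e - a1) ^ 2 + r ^ 2) := by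
    rw [h.z1, h.z2]; ring
  have k1 : (D + 2 * (a1 ^ 2 + a2 ^ 2)) * r = 0 := by linear_combination h.dr + 2 * hq
  have k2 : (D + 2 * (a1 ^ 2 + a2 ^ 2)) * (a2 * (a1 - e)) = 0 := by
    linear_combination h.torque + 2 * a2 * hp
  by_cases hB : D + 2 * (a1 ^ 2 + a2 ^ 2) = 0
  · right; left
    refine ⟨?_, by ring⟩
    have : (a1 ^ 2 + a2 ^ 2) * (r ^ 2 - a2 ^ 2 - 2 * e * a1 + e ^ 2) = 0 := by
      linear_combination h.virial / 2 - hkk + a1 * hp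
        + ((a2 ^ 2 + e * a1) / 2 - (a1 ^ 2 + a2 ^ 2)) * hB
    exact (mul_eq_zero.1 this).resolve_left hR
  · have hr := (mul_eq_zero.1 k1).resolve_left hB
    subst hr
    rcases mul_eq_zero.1 ((mul_eq_zero.1 k2).resolve_left hB) with ha | ha
    · subst ha
      right; right; left
      refine ⟨hR, by ring, ?_⟩
      rw [h.z2]; ring
    · exact absurd hkk (by
        have : e - a1 = 0 := by linarith
        rw [this]; simpa using hk)

/-- When the determinant is nonzero, `O = γ (2 Z ᾱ - B α)`. Rewriting everything through `β = γ B`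
and `δ = γ² (4|Z|² - B²)` removes `Z` and yields the relation `F`, which together with `O2 = z`
defines the fourth subsystem. The assumption `O2 ≠ z` leaves only the second subsystem. -/
theorem alternative_of_simple (h : CriticalRelation e O1 O2 r a1 a2 z Z1 Z2 B C D) (he : 0 < e)
    (hR : a1 ^ 2 + a2 ^ 2 ≠ 0) (hk : Z1 ^ 2 + Z2 ^ 2 ≠ 0)
    (hB : 4 * (Z1 ^ 2 + Z2 ^ 2) - B ^ 2 ≠ 0) :
    CriticalAlternative e O1 O2 r a1 a2 z Z1 Z2 := by
  by_cases hW : O1 = 0 ∧ O2 = 0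
  · exact h.alternative_of_rest hR hk hW.1 hW.2
  obtain ⟨Δ, hΔ⟩ : ∃ Δ, Δ = 4 * (Z1 ^ 2 + Z2 ^ 2) - B ^ 2 := ⟨_, rfl⟩
  rw [← hΔ] at hB
  obtain ⟨γ, hγ⟩ : ∃ γ, γ * Δ = -C := ⟨-C / Δ, by field_simp⟩
  have s1 : O1 = γ * (2 * (Z1 * a1 + Z2 * a2) - B * a1) := by
    apply mul_left_cancel₀ hB
    linear_combination h.solve_O1 + (2 * (Z1 * a1 + Z2 * a2) - B * a1) * -hγ + O1 * hΔ
  have s2 : O2 = γ * (2 * (Z2 * a1 - Z1 * a2) - B * a2) := by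
    apply mul_left_cancel₀ hB
    linear_combination h.solve_O2 + (2 * (Z2 * a1 - Z1 * a2) - B * a2) * -hγ + O2 * hΔ
  obtain ⟨β, hβ⟩ : ∃ β, β = γ * B := ⟨_, rfl⟩
  obtain ⟨δ, hδ⟩ : ∃ δ, δ = Δ * γ ^ 2 := ⟨_, rfl⟩
  have c1 : δ * z = β * (r - a2) - O2 := by
    rw [hδ, hβ]
    linear_combination z * γ * hγ - γ * h.dr + s2
  have c2 : δ * ((O2 * a1 - O1 * a2) - z * a1) = a2 * (O1 + β * e) := by
    rw [hδ, hβ]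
    linear_combination ((O2 * a1 - O1 * a2) - z * a1) * γ * hγ + γ * h.torque - a2 * s1
  -- The squared modulus of `2 γ Z ᾱ = O + β α`.
  have c3 : δ * (a1 ^ 2 + a2 ^ 2) = O1 ^ 2 + O2 ^ 2 + 2 * β * (O1 * a1 + O2 * a2) := by
    rw [hδ, hβ, hΔ]
    linear_combination -(O1 + γ * (2 * (Z1 * a1 + Z2 * a2)) + γ * B * a1) * s1
      - (O2 + γ * (2 * (Z2 * a1 - Z1 * a2)) + γ * B * a2) * s2
  have c4 : -(O2 * a1 - O1 * a2) * δ + O2 * (e - a1) + r * O1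
      + β * (a2 * (e - a1) + a1 * r) = 0 := by
    -- The two expressions for `Z ᾱ`, from `s1`, `s2` and from `p_eq`, `q_eq`, are compared and `c3`
    -- is used to split off `|α|²`.
    have : (a1 ^ 2 + a2 ^ 2) * (-(O2 * a1 - O1 * a2) * δ + O2 * (e - a1) + r * O1
      + β * (a2 * (e - a1) + a1 * r)) = 0 := by
      rw [hβ] at c3 ⊢
      linear_combination -(O2 * a1 - O1 * a2) * c3 - (Z2 * a1 - Z1 * a2) * s1
        + (Z1 * a1 + Z2 * a2) * s2 - (O2 + γ * B * a2) * h.p_eq + (O1 + γ * B * a1) * h.q_eq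
    exact (mul_eq_zero.1 this).resolve_left hR
  have F : O1 * (r - a2) + e * O2 = 0 := by
    linear_combination c4 + c2 + a1 * c1
  by_cases hE : O2 = z
  · right; right; right; left
    refine ⟨hE, ?_⟩
    rw [← hE]; exact F
  have hE' : O2 - z ≠ 0 := sub_ne_zero.2 hE
  have c5 : (O2 * a1 - O1 * a2) * ((1 + δ) * O1 + β * e) = 0 := by
    linear_combination O1 * c2 + O1 * a1 * c1 + β * a1 * F
  by_cases hv : O2 * a1 - O1 * a2 = 0
  -- If `O` is parallel to `α`, then `F` allows `e = ε a1`, `r = (1 - ε) a2`, and `Z` becomes the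
  -- real multiple `n α²`.
  · obtain ⟨κ, k1, k2⟩ : ∃ κ, O1 = κ * a1 ∧ O2 = κ * a2 := by
      refine ⟨(O1 * a1 + O2 * a2) / (a1 ^ 2 + a2 ^ 2), ?_, ?_⟩
      · field_simp
        linear_combination -a2 * hv
      · field_simp
        linear_combination a1 * hv
    have hκ : κ ≠ 0 := by
      rintro rfl
      exact hW ⟨by simpa using k1, by simpa using k2⟩
    have F' : a1 * (r - a2) + e * a2 = 0 := by
      have : κ * (a1 * (r - a2) + e * a2) = 0 := by
        rw [k1, k2] at F; linear_combination F
      exact (mul_eq_zero.1 this).resolve_left hκ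
    have ha1 : a1 ≠ 0 := by
      rintro rfl
      have : e * a2 = 0 := by linear_combination F'
      have : a2 = 0 := (mul_eq_zero.1 this).resolve_left he.ne'
      exact hR (by rw [this]; ring)
    obtain ⟨ε, hε⟩ : ∃ ε, e = ε * a1 := ⟨e / a1, by field_simp⟩
    have hr : r = (1 - ε) * a2 := by
      apply mul_left_cancel₀ ha1
      rw [hε] at F'; linear_combination F'
    obtain ⟨n, hn⟩ : ∃ n, n = κ ^ 2 + ε - 1 := ⟨_, rfl⟩
    obtain ⟨R, hRR⟩ : ∃ R, R = a1 ^ 2 + a2 ^ 2 := ⟨_, rfl⟩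
    have hZ1 : Z1 = n * (a1 ^ 2 - a2 ^ 2) := by rw [h.z1, k1, k2, hr, hε, hn]; ring
    have hZ2 : Z2 = n * (2 * a1 * a2) := by rw [h.z2, k1, k2, hr, hε, hn]; ring
    have hC : C = -κ * (2 * n * R + B) := by
      apply mul_left_cancel₀ hR
      have := h.dO1
      have h' := h.dO2
      rw [k1, k2, hZ1, hZ2] at this h'
      rw [hRR]
      linear_combination (a1 * this + a2 * h') / 2
    have e1 : B * (2 - ε) * a2 = (2 * n * R + B) * (a2 + κ * z) := by
      have := h.dr
      rw [hZ1, hZ2, hr, hC, hRR] at this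
      rw [hRR]
      linear_combination this
    have e2 : z * ((2 * n * R + B) * (ε - 2 - 2 * κ ^ 2) + 2 * B * (2 - ε))
        - κ * (2 * n * R + B) * ε * a2 = 0 := by
      have w := h.virial
      have w' := h.dz
      have hR' : R ≠ 0 := hRR ▸ hR
      apply mul_left_cancel₀ hR'
      rw [hZ1, hZ2, k1, k2, hε, hC] at w
      rw [hr, hC] at w'
      rw [hRR] at *
      rw [hn] at *
      linear_combination z * w - (a1 ^ 2 + a2 ^ 2) * w' + a2 * z * e1
    have e3 : (2 * n * R - B) * ((2 - ε) * (κ * a2 - z)) = 0 := by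
      linear_combination e2 - 2 * κ * e1
    -- It divides the determinant: `4|Z|² - B² = (2nR)² - B²`.
    have hne : 2 * n * R - B ≠ 0 := by
      intro h0
      apply hB
      rw [hΔ, hZ1, hZ2]
      rw [hRR] at h0
      linear_combination (2 * n * (a1 ^ 2 + a2 ^ 2) + B) * h0
    rcases mul_eq_zero.1 ((mul_eq_zero.1 e3).resolve_left hne) with h0 | h0
    · right; left
      have hε2 : ε = 2 := by linarith
      rw [hr, k1, k2, hε, hε2]
      constructor <;> ring
    · exact absurd (by linarith : O2 = z) hE
  · exfalso
    -- If `O` is not parallel to `α`, every branch ends in `O = 0`, which has been excluded.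
    have c6 := (mul_eq_zero.1 c5).resolve_left hv
    have c7 : O1 * ((O2 - z) * δ) = 0 := by
      linear_combination (-O1) * c1 + O2 * c6 - β * F
    rcases mul_eq_zero.1 c7 with h0 | h0
    · apply hW
      refine ⟨h0, ?_⟩
      have : e * O2 = 0 := by rw [h0] at F; linear_combination F
      exact (mul_eq_zero.1 this).resolve_left he.ne'
    · have hδ0 := (mul_eq_zero.1 h0).resolve_left hE'
      have : γ = 0 := by
        rw [hδ0] at hδ
        exact pow_eq_zero_iff (two_ne_zero) |>.1 ((mul_eq_zero.1 hδ.symm).resolve_left hB)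
      rw [this] at s1 s2
      exact hW ⟨by simpa using s1, by simpa using s2⟩

theorem alternative (h : CriticalRelation e O1 O2 r a1 a2 z Z1 Z2 B C D) (he : 0 < e)
    (ha : a1 ^ 2 + a2 ^ 2 + z ^ 2 ≠ 0) :
    CriticalAlternative e O1 O2 r a1 a2 z Z1 Z2 := by
  by_cases hk : Z1 ^ 2 + Z2 ^ 2 = 0
  · left
    constructor <;> nlinarith [sq_nonneg Z1, sq_nonneg Z2]
  by_cases hR : a1 ^ 2 + a2 ^ 2 = 0
  · have h1 : a1 = 0 := by nlinarith [sq_nonneg a1, sq_nonneg a2]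
    have h2 : a2 = 0 := by nlinarith [sq_nonneg a1, sq_nonneg a2]
    subst h1 h2
    have hz1 : Z1 = O1 ^ 2 - O2 ^ 2 := by rw [h.z1]; ring
    have hz2 : Z2 = 2 * O1 * O2 := by rw [h.z2]; ring
    subst hz1 hz2
    have hO : O1 ^ 2 + O2 ^ 2 ≠ 0 := by
      intro h0
      apply hk
      linear_combination (O1 ^ 2 + O2 ^ 2) * h0
    right; right; right; right
    refine ⟨rfl, rfl, hO, criticalAlternative_pole (B := B) (C := C) hO ?_ ?_ ?_ ?_ ?_⟩
    · linear_combination h.dO1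
    · linear_combination h.dO2
    · linear_combination h.dr
    · linear_combination h.da1
    · linear_combination h.da2
  by_cases hB : 4 * (Z1 ^ 2 + Z2 ^ 2) = B ^ 2
  · by_cases hC : C = 0
    · exact h.alternative_of_double_of_eq hR hk hB hC
    · exact h.alternative_of_double_of_ne hR hk hB hC
  · exact h.alternative_of_simple he hR hk (sub_ne_zero.2 hB)

/-! ### Explicit multipliers on the subsystems -/

/-- On the fourth subsystem `H - S = O1²`, so `B` is minus the coefficient `2 (h + ε₁² a² - s)` of
`h` in the generating function. After substitution each equation is a multiple of the second
relation. -/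
theorem of_fourth {e O1 r a1 a2 z Z1 Z2 : ℝ}
    (hZ1 : Z1 = O1 ^ 2 - z ^ 2 + a1 * (e - a1) + a2 * r)
    (hZ2 : Z2 = 2 * O1 * z + a2 * (e - a1) - a1 * r)
    (h : O1 * (r - a2) + e * z = 0) :
    ∃ B C D, CriticalRelation e O1 z r a1 a2 z Z1 Z2 B C D := by
  refine ⟨-2 * (O1 ^ 2 + (a1 ^ 2 + a2 ^ 2 + z ^ 2)), 2 * (2 * a1 * O1 + z * (r + a2) - e * O1),
    -2 * (O1 ^ 2 + (a1 ^ 2 + a2 ^ 2 + z ^ 2)) + 2 * e * a1 - e ^ 2 - (r ^ 2 - a2 ^ 2),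
    hZ1, hZ2, ?_, ?_, ?_, ?_, ?_, ?_⟩ <;> subst hZ1 hZ2
  · linear_combination 4 * a2 * h
  · linear_combination -4 * a1 * h
  · linear_combination -2 * O1 * h
  · ring
  · linear_combination 2 * O1 * h
  · linear_combination (4 * a1 - 2 * e) * h

/-- The multipliers are the derivatives of `Φ₂` with `a²` replaced by `Γ`, so `C = 0` and `D = B`.
They are written in a rational parametrization of the subsystem: with `m = r + a2` the first
relation is linear in `a1`, and `η` is the parameter for which `a1 = e/2 - m η`; the second relation
then reduces to `O2 = 2 O1 η`, because `e² + m² > 0`. -/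
theorem of_second {e O1 O2 r a1 a2 z Z1 Z2 : ℝ} (he : 0 < e)
    (hZ1 : Z1 = O1 ^ 2 - O2 ^ 2 + a1 * (e - a1) + a2 * r)
    (hZ2 : Z2 = 2 * O1 * O2 + a2 * (e - a1) - a1 * r)
    (h1 : r ^ 2 - a2 ^ 2 - 2 * e * a1 + e ^ 2 = 0)
    (h2 : a1 * (e * O2 + (r + a2) * O1) + a2 * ((r + a2) * O2 - e * O1) = 0) :
    ∃ B C D, CriticalRelation e O1 O2 r a1 a2 z Z1 Z2 B C D := by
  obtain ⟨m, hm⟩ : ∃ m, m = r + a2 := ⟨_, rfl⟩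
  obtain ⟨η, hη⟩ : ∃ η, a2 = e * η + m / 2 := ⟨(a2 - m / 2) / e, by field_simp; ring⟩
  have ha1 : a1 = e / 2 - m * η := by
    apply mul_left_cancel₀ he.ne'
    have hr : r = m - a2 := by linarith
    rw [hr, hη] at h1
    linear_combination -h1 / 2
  have hr : r = m / 2 - e * η := by linarith
  have hO : O2 = 2 * O1 * η := by
    have hN : e ^ 2 + m ^ 2 ≠ 0 := by positivity
    apply mul_left_cancel₀ hN
    rw [ha1, hr, hη] at h2
    linear_combination 2 * h2
  refine ⟨-2 * (4 * O1 ^ 2 + e ^ 2 + m ^ 2) * (1 / 4 + η ^ 2), 0,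
    -2 * (4 * O1 ^ 2 + e ^ 2 + m ^ 2) * (1 / 4 + η ^ 2), hZ1, hZ2, ?_, ?_, ?_, ?_, ?_, ?_⟩ <;>
    subst hZ1 hZ2 <;> simp only [hO, ha1, hr, hη] <;> ring

/-- Put `O = (s + i t) α`. The first relation becomes `r = a2 + 2 s z`, whence `s = rL / (2 rG)`,
and the second becomes `k4`. The multipliers are the derivatives of `Φ₃` with `a²` replaced by `Γ`.
-/
theorem of_third {e O1 O2 r a1 a2 z Z1 Z2 : ℝ} (hR : a1 ^ 2 + a2 ^ 2 ≠ 0)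
    (hZ1 : Z1 = O1 ^ 2 - O2 ^ 2 + a1 * (e - a1) + a2 * r)
    (hZ2 : Z2 = 2 * O1 * O2 + a2 * (e - a1) - a1 * r)
    (h1 : (a1 ^ 2 + a2 ^ 2) * (r - a2) = 2 * (O1 * a1 + O2 * a2) * z)
    (h2 : (a1 ^ 2 - a2 ^ 2) * Z2 - 2 * a1 * a2 * Z1 = 0) :
    ∃ B C D, CriticalRelation e O1 O2 r a1 a2 z Z1 Z2 B C D := by
  obtain ⟨s, hs⟩ : ∃ s, s = (O1 * a1 + O2 * a2) / (a1 ^ 2 + a2 ^ 2) := ⟨_, rfl⟩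
  obtain ⟨t, ht⟩ : ∃ t, t = (O2 * a1 - O1 * a2) / (a1 ^ 2 + a2 ^ 2) := ⟨_, rfl⟩
  have k1 : O1 = s * a1 - t * a2 := by rw [hs, ht]; field_simp; ring
  have k2 : O2 = s * a2 + t * a1 := by rw [hs, ht]; field_simp; ring
  have k3 : r = a2 + 2 * s * z := by
    apply mul_left_cancel₀ hR
    rw [k1, k2] at h1
    linear_combination h1
  have k4 : 2 * (a1 ^ 2 + a2 ^ 2) * s * t - 2 * s * z * a1 - e * a2 = 0 := by
    apply mul_left_cancel₀ hR
    rw [hZ1, hZ2, k1, k2, k3] at h2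
    linear_combination h2
  obtain ⟨B, hB⟩ : ∃ B, B = 2 * ((a1 ^ 2 + a2 ^ 2) * (s ^ 2 - t ^ 2) + a1 * (e - a1) - a2 * r) :=
    ⟨_, rfl⟩
  clear hs ht
  refine ⟨B, -2 * B * s, B + 2 * B * s ^ 2, hZ1, hZ2, ?_, ?_, ?_, ?_, ?_, ?_⟩ <;>
    subst hB hZ1 hZ2 k1 k2 k3
  · linear_combination (4 * a1 * t - 4 * a2 * s) * k4
  · linear_combination (4 * a1 * s + 4 * a2 * t) * k4
  · linear_combination -2 * a1 * k4
  · linear_combination (4 * a2 * s ^ 2 - 4 * a2 * t ^ 2 - 4 * s * z) * k4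
  · linear_combination (-4 * a1 * s ^ 2 + 4 * a1 * t ^ 2 + 2 * a1 - 2 * e) * k4
  · ring

end CriticalRelation

/-! ### Coordinates -/

/-- The coordinates in the first factor. -/
def cm (i : Fin 3) : Phase →L[ℝ] ℝ :=
  (ContinuousLinearMap.proj i).comp (ContinuousLinearMap.fst ℝ (Fin 3 → ℝ) (Fin 3 → ℝ))

/-- The coordinates in the second factor. -/
def ca (i : Fin 3) : Phase →L[ℝ] ℝ :=
  (ContinuousLinearMap.proj i).comp (ContinuousLinearMap.snd ℝ (Fin 3 → ℝ) (Fin 3 → ℝ))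

@[simp] theorem cm_apply (i : Fin 3) (v : Phase) : cm i v = v.1 i := rfl

@[simp] theorem ca_apply (i : Fin 3) (v : Phase) : ca i v = v.2 i := rfl

theorem fderiv_fst_apply (i : Fin 3) (u : Phase) :
    fderiv ℝ (fun y : Phase => y.1 i) u = cm i := (cm i).fderiv

theorem fderiv_snd_apply (i : Fin 3) (u : Phase) :
    fderiv ℝ (fun y : Phase => y.2 i) u = ca i := (ca i).fderiv

theorem phase_ext {u v : Phase} (h1 : u.1 0 = v.1 0) (h2 : u.1 1 = v.1 1) (h3 : u.1 2 = v.1 2)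
    (h4 : u.2 0 = v.2 0) (h5 : u.2 1 = v.2 1) (h6 : u.2 2 = v.2 2) : u = v := by
  apply Prod.ext <;> funext i <;> fin_cases i <;> assumption

theorem fderiv_fst_comp {F : Phase → Phase} {u : Phase} (hF : DifferentiableAt ℝ F u) (v : Phase)
    (i : Fin 3) : (fderiv ℝ F u v).1 i = fderiv ℝ (fun y => (F y).1 i) u v := by
  have := ((cm i).hasFDerivAt.comp u hF.hasFDerivAt).fderiv
  exact (congrArg (fun l : Phase →L[ℝ] ℝ => l v) this).symm

theorem fderiv_snd_comp {F : Phase → Phase} {u : Phase} (hF : DifferentiableAt ℝ F u) (v : Phase)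
    (i : Fin 3) : (fderiv ℝ F u v).2 i = fderiv ℝ (fun y => (F y).2 i) u v := by
  have := ((ca i).hasFDerivAt.comp u hF.hasFDerivAt).fderiv
  exact (congrArg (fun l : Phase →L[ℝ] ℝ => l v) this).symm

/-- The change of variables which replaces `M` by the angular velocity and scales `α`. -/
def redLin {s : ℝ} (hs : s ≠ 0) : Phase ≃ₗ[ℝ] Phase where
  toFun x := (![x.1 0 / 2, x.1 1 / 2 + s * x.2 2, x.1 2 - s * x.2 1],
    ![s * x.2 0, s * x.2 1, s * x.2 2])
  invFun u := (![2 * u.1 0, 2 * u.1 1 - 2 * u.2 2, u.1 2 + u.2 1],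
    ![s⁻¹ * u.2 0, s⁻¹ * u.2 1, s⁻¹ * u.2 2])
  map_add' x y := by
    apply phase_ext <;> simp <;> ring
  map_smul' c x := by
    apply phase_ext <;> simp <;> ring
  left_inv x := by
    apply phase_ext <;> simp <;> field_simp
    ring
  right_inv x := by
    apply phase_ext <;> simp <;> field_simp <;> ring

/-- The continuous version of `redLin`. -/
def red {s : ℝ} (hs : s ≠ 0) : Phase ≃L[ℝ] Phase := (redLin hs).toContinuousLinearEquiv

theorem red_apply {s : ℝ} (hs : s ≠ 0) (x : Phase) :
    red hs x = (![x.1 0 / 2, x.1 1 / 2 + s * x.2 2, x.1 2 - s * x.2 1],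
      ![s * x.2 0, s * x.2 1, s * x.2 2]) := rfl

/-! ### The integrals in the reduced coordinates -/

/-- The Hamiltonian. -/
def rH (e : ℝ) (u : Phase) : ℝ :=
  u.1 0 ^ 2 + u.1 1 ^ 2 + u.1 2 ^ 2 / 2 - u.2 2 ^ 2 - u.2 1 ^ 2 / 2 - e * u.2 0

/-- The real part of `ξ₁`. -/
def rZ1 (e : ℝ) (u : Phase) : ℝ :=
  u.1 0 ^ 2 - u.1 1 ^ 2 + u.2 0 * (e - u.2 0) + u.2 1 * u.1 2

/-- The imaginary part of `ξ₁`. -/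
def rZ2 (e : ℝ) (u : Phase) : ℝ :=
  2 * u.1 0 * u.1 1 + u.2 1 * (e - u.2 0) - u.2 0 * u.1 2

/-- The additional integral. -/
def rK (e : ℝ) (u : Phase) : ℝ := rZ1 e u ^ 2 + rZ2 e u ^ 2

/-- The doubled area integral. -/
def rL (u : Phase) : ℝ :=
  2 * (u.1 0 * u.2 0 + u.1 1 * u.2 1) + u.1 2 * u.2 2 - u.2 2 * u.2 1

/-- The geometric integral. -/
def rG (u : Phase) : ℝ := u.2 0 ^ 2 + u.2 1 ^ 2 + u.2 2 ^ 2

theorem H_eq (p : Params) (hs : p.e1 ≠ 0) : H p = fun x => rH (p.e0 / p.e1) (red hs x) := by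
  funext x
  simp [H, rH, red_apply]
  field_simp
  ring

theorem K_eq (p : Params) (hs : p.e1 ≠ 0) : K p = fun x => rK (p.e0 / p.e1) (red hs x) := by
  funext x
  have h1 : p.e0 / p.e1 * p.e1 = p.e0 := by field_simp
  have e1 : (x.1 0 ^ 2 - x.1 1 ^ 2) / 4 + p.e1 * (x.2 1 * x.1 2 - x.2 2 * x.1 1)
      - p.e1 ^ 2 * (x.2 0 ^ 2 + x.2 1 ^ 2 + x.2 2 ^ 2) + p.e0 * x.2 0
      = rZ1 (p.e0 / p.e1) (red hs x) := by
    simp [rZ1, red_apply]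
    linear_combination -x.2 0 * h1
  have e2 : x.1 0 * x.1 1 / 2 + p.e1 * (x.2 2 * x.1 0 - x.2 0 * x.1 2) + p.e0 * x.2 1
      = rZ2 (p.e0 / p.e1) (red hs x) := by
    simp [rZ2, red_apply]
    linear_combination -x.2 1 * h1
  simp only [K, rK, e1, e2]

theorem L_eq {s : ℝ} (hs : s ≠ 0) : L = fun x => (2 * s)⁻¹ * rL (red hs x) := by
  funext x
  simp [L, rL, red_apply, dotProduct, Fin.sum_univ_three]
  field_simp
  ring

theorem Gam_eq {s : ℝ} (hs : s ≠ 0) : Gam = fun x => (s ^ 2)⁻¹ * rG (red hs x) := by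
  funext x
  simp [Gam, rG, red_apply, dotProduct, Fin.sum_univ_three]
  field_simp

theorem fderiv_rH (e : ℝ) (u v : Phase) : fderiv ℝ (rH e) u v =
    2 * u.1 0 * v.1 0 + 2 * u.1 1 * v.1 1 + u.1 2 * v.1 2 - 2 * u.2 2 * v.2 2
      - u.2 1 * v.2 1 - e * v.2 0 := by
  unfold rH
  simp (disch := fun_prop) only [fderiv_fun_add, fderiv_fun_sub, fderiv_fun_mul, fderiv_fun_pow,
    fderiv_fst_apply, fderiv_snd_apply, div_eq_mul_inv, fderiv_fun_const]
  simp
  ring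

theorem fderiv_rZ1 (e : ℝ) (u v : Phase) : fderiv ℝ (rZ1 e) u v =
    2 * u.1 0 * v.1 0 - 2 * u.1 1 * v.1 1 + u.2 1 * v.1 2 + (e - 2 * u.2 0) * v.2 0
      + u.1 2 * v.2 1 := by
  unfold rZ1
  simp (disch := fun_prop) only [fderiv_fun_add, fderiv_fun_sub, fderiv_fun_mul, fderiv_fun_pow,
    fderiv_fst_apply, fderiv_snd_apply, div_eq_mul_inv, fderiv_fun_const]
  simp
  ring

theorem fderiv_rZ2 (e : ℝ) (u v : Phase) : fderiv ℝ (rZ2 e) u v =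
    2 * u.1 1 * v.1 0 + 2 * u.1 0 * v.1 1 - u.2 0 * v.1 2 - (u.2 1 + u.1 2) * v.2 0
      + (e - u.2 0) * v.2 1 := by
  unfold rZ2
  simp (disch := fun_prop) only [fderiv_fun_add, fderiv_fun_sub, fderiv_fun_mul, fderiv_fun_pow,
    fderiv_fst_apply, fderiv_snd_apply, div_eq_mul_inv, fderiv_fun_const]
  simp
  ring

theorem fderiv_rL (u v : Phase) : fderiv ℝ rL u v =
    2 * u.2 0 * v.1 0 + 2 * u.2 1 * v.1 1 + u.2 2 * v.1 2 + 2 * u.1 0 * v.2 0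
      + (2 * u.1 1 - u.2 2) * v.2 1 + (u.1 2 - u.2 1) * v.2 2 := by
  unfold rL
  simp (disch := fun_prop) only [fderiv_fun_add, fderiv_fun_sub, fderiv_fun_mul, fderiv_fun_pow,
    fderiv_fst_apply, fderiv_snd_apply, div_eq_mul_inv, fderiv_fun_const]
  simp
  ring

theorem fderiv_rG (u v : Phase) : fderiv ℝ rG u v =
    2 * u.2 0 * v.2 0 + 2 * u.2 1 * v.2 1 + 2 * u.2 2 * v.2 2 := by
  unfold rG
  simp (disch := fun_prop) only [fderiv_fun_add, fderiv_fun_sub, fderiv_fun_mul, fderiv_fun_pow,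
    fderiv_fst_apply, fderiv_snd_apply, div_eq_mul_inv, fderiv_fun_const]
  simp

@[fun_prop] theorem contDiff_rH (e : ℝ) {n : WithTop ℕ∞} : ContDiff ℝ n (rH e) := by
  unfold rH; fun_prop

@[fun_prop] theorem contDiff_rZ1 (e : ℝ) {n : WithTop ℕ∞} : ContDiff ℝ n (rZ1 e) := by
  unfold rZ1; fun_prop

@[fun_prop] theorem contDiff_rZ2 (e : ℝ) {n : WithTop ℕ∞} : ContDiff ℝ n (rZ2 e) := by
  unfold rZ2; fun_prop

@[fun_prop] theorem contDiff_rK (e : ℝ) {n : WithTop ℕ∞} : ContDiff ℝ n (rK e) := by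
  unfold rK; fun_prop

@[fun_prop] theorem contDiff_rL {n : WithTop ℕ∞} : ContDiff ℝ n rL := by
  unfold rL; fun_prop

@[fun_prop] theorem contDiff_rG {n : WithTop ℕ∞} : ContDiff ℝ n rG := by
  unfold rG; fun_prop

@[fun_prop] theorem differentiable_rH (e : ℝ) : Differentiable ℝ (rH e) :=
  (contDiff_rH e (n := 1)).differentiable one_ne_zero

@[fun_prop] theorem differentiable_rZ1 (e : ℝ) : Differentiable ℝ (rZ1 e) :=
  (contDiff_rZ1 e (n := 1)).differentiable one_ne_zero

@[fun_prop] theorem differentiable_rZ2 (e : ℝ) : Differentiable ℝ (rZ2 e) :=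
  (contDiff_rZ2 e (n := 1)).differentiable one_ne_zero

@[fun_prop] theorem differentiable_rK (e : ℝ) : Differentiable ℝ (rK e) :=
  (contDiff_rK e (n := 1)).differentiable one_ne_zero

@[fun_prop] theorem differentiable_rL : Differentiable ℝ rL :=
  (contDiff_rL (n := 1)).differentiable one_ne_zero

@[fun_prop] theorem differentiable_rG : Differentiable ℝ rG :=
  (contDiff_rG (n := 1)).differentiable one_ne_zero

theorem fderiv_rK (e : ℝ) (u v : Phase) : fderiv ℝ (rK e) u v =
    2 * rZ1 e u * fderiv ℝ (rZ1 e) u v + 2 * rZ2 e u * fderiv ℝ (rZ2 e) u v := by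
  unfold rK
  simp (disch := fun_prop) only [fderiv_fun_add, fderiv_fun_pow]
  simp

/-! ### Hamiltonian fields in the reduced coordinates -/

/-- The Hamiltonian field of a function of the reduced coordinates, as a linear function of the
differential `l` at `u`. -/
def ham (u : Phase) (l : Phase →L[ℝ] ℝ) : Phase :=
  let d := fun i : Fin 3 => l (Pi.single i 1, 0)
  let b := fun i : Fin 3 => l (0, Pi.single i 1)
  (![((2 * u.1 1 - 2 * u.2 2) * d 2 - (u.1 2 + u.2 1) * (d 1 / 2)
        + u.2 1 * (b 2 + d 1) - u.2 2 * (b 1 - d 2)) / 2,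
      ((u.1 2 + u.2 1) * (d 0 / 2) - 2 * u.1 0 * d 2 + u.2 2 * b 0
        - u.2 0 * (b 2 + d 1)) / 2 + (u.2 0 * (d 1 / 2) - u.2 1 * (d 0 / 2)),
      2 * u.1 0 * (d 1 / 2) - (2 * u.1 1 - 2 * u.2 2) * (d 0 / 2) + u.2 0 * (b 1 - d 2)
        - u.2 1 * b 0 - (u.2 2 * (d 0 / 2) - u.2 0 * d 2)],
    ![u.2 1 * d 2 - u.2 2 * (d 1 / 2), u.2 2 * (d 0 / 2) - u.2 0 * d 2,
      u.2 0 * (d 1 / 2) - u.2 1 * (d 0 / 2)])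

theorem ham_add (u : Phase) (l l' : Phase →L[ℝ] ℝ) : ham u (l + l') = ham u l + ham u l' := by
  apply phase_ext <;> simp [ham] <;> ring

theorem ham_smul (u : Phase) (c : ℝ) (l : Phase →L[ℝ] ℝ) : ham u (c • l) = c • ham u l := by
  apply phase_ext <;> simp [ham] <;> ring

theorem red_basis {s : ℝ} (hs : s ≠ 0) :
    red hs (Pi.single 0 1, 0) = (2⁻¹ : ℝ) • ((Pi.single 0 1, 0) : Phase) ∧
    red hs (Pi.single 1 1, 0) = (2⁻¹ : ℝ) • ((Pi.single 1 1, 0) : Phase) ∧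
    red hs (Pi.single 2 1, 0) = ((Pi.single 2 1, 0) : Phase) ∧
    red hs (0, Pi.single 0 1) = s • ((0, Pi.single 0 1) : Phase) ∧
    red hs (0, Pi.single 1 1) = s • ((0, Pi.single 1 1) - (Pi.single 2 1, 0) : Phase) ∧
    red hs (0, Pi.single 2 1) = s • ((0, Pi.single 2 1) + (Pi.single 1 1, 0) : Phase) := by
  refine ⟨?_, ?_, ?_, ?_, ?_, ?_⟩ <;> apply phase_ext <;> simp [red_apply]

/-- `ham` is the Poisson tensor carried over by the linear change `red`. All fields and their
linearizations can then be computed in the reduced coordinates. -/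
theorem sgrad_comp_red {s : ℝ} (hs : s ≠ 0) {F : Phase → ℝ} (hF : Differentiable ℝ F) (x : Phase) :
    sgrad (fun y => F (red hs y)) x = (red hs).symm (ham (red hs x) (fderiv ℝ F (red hs x))) := by
  have key : fderiv ℝ (fun y => F (red hs y)) x
      = (fderiv ℝ F (red hs x)).comp (red hs : Phase →L[ℝ] Phase) :=
    ((hF _).hasFDerivAt.comp x (red hs).hasFDerivAt).fderiv
  obtain ⟨b1, b2, b3, b4, b5, b6⟩ := red_basis hs
  set l := fderiv ℝ F (red hs x) with hl
  have g1 : gradM (fun y => F (red hs y)) x 0 = l (Pi.single 0 1, 0) / 2 := by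
    simp only [gradM, key, ContinuousLinearMap.comp_apply, ContinuousLinearEquiv.coe_coe, b1,
      map_smul, smul_eq_mul]
    ring
  have g2 : gradM (fun y => F (red hs y)) x 1 = l (Pi.single 1 1, 0) / 2 := by
    simp only [gradM, key, ContinuousLinearMap.comp_apply, ContinuousLinearEquiv.coe_coe, b2,
      map_smul, smul_eq_mul]
    ring
  have g3 : gradM (fun y => F (red hs y)) x 2 = l (Pi.single 2 1, 0) := by
    simp [gradM, key, b3]
  have g4 : gradA (fun y => F (red hs y)) x 0 = s * l (0, Pi.single 0 1) := by
    simp only [gradA, key, ContinuousLinearMap.comp_apply, ContinuousLinearEquiv.coe_coe, b4,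
      map_smul, smul_eq_mul]
  have g5 : gradA (fun y => F (red hs y)) x 1
      = s * (l (0, Pi.single 1 1) - l (Pi.single 2 1, 0)) := by
    simp only [gradA, key, ContinuousLinearMap.comp_apply, ContinuousLinearEquiv.coe_coe, b5,
      map_smul, map_sub, smul_eq_mul]
  have g6 : gradA (fun y => F (red hs y)) x 2
      = s * (l (0, Pi.single 2 1) + l (Pi.single 1 1, 0)) := by
    simp only [gradA, key, ContinuousLinearMap.comp_apply, ContinuousLinearEquiv.coe_coe, b6,
      map_smul, map_add, smul_eq_mul]
  rw [sgrad]
  generalize gradM (fun y => F (red hs y)) x = gM at *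
  generalize gradA (fun y => F (red hs y)) x = gA at *
  clear_value l
  rw [ContinuousLinearEquiv.eq_symm_apply]
  apply phase_ext <;>
    simp [red_apply, ham, crossProduct, g1, g2, g3, g4, g5, g6] <;> ring

/-- The Hamiltonian field of `rH`. -/
def rXH (e : ℝ) (u : Phase) : Phase :=
  (![(u.1 1 - u.2 2) * (u.1 2 + u.2 1) / 2,
      -(u.1 2 + u.2 1) * u.1 0 / 2 + u.2 2 * (u.2 0 - e / 2),
      u.2 2 * u.1 0 - u.2 1 * (u.2 0 - e)],
    ![u.2 1 * u.1 2 - u.2 2 * u.1 1, u.2 2 * u.1 0 - u.2 0 * u.1 2,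
      u.2 0 * u.1 1 - u.2 1 * u.1 0])

/-- The Hamiltonian field of `rZ1`. -/
def rX1 (e : ℝ) (u : Phase) : Phase :=
  (![(u.1 1 - u.2 2) * (u.1 2 + u.2 1) / 2,
      -u.2 0 * u.2 2 - 3 / 2 * u.2 1 * u.1 0 + e * u.2 2 / 2 + u.1 0 * u.1 2 / 2,
      2 * u.2 0 * u.2 1 + u.2 0 * u.1 2 - u.2 1 * e - 4 * u.1 0 * u.1 1 + u.1 0 * u.2 2],
    ![u.2 1 ^ 2 + u.1 1 * u.2 2, -u.2 0 * u.2 1 + u.1 0 * u.2 2,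
      -u.2 0 * u.1 1 - u.2 1 * u.1 0])

/-- The Hamiltonian field of `rZ2`. -/
def rX2 (e : ℝ) (u : Phase) : Phase :=
  (![-u.2 0 * u.1 1 + u.2 0 * u.2 2 + u.2 1 * u.1 0 / 2 - e * u.2 2 / 2 - u.1 0 * u.1 2 / 2,
      u.2 0 * u.1 0 - u.2 1 * u.1 1 / 2 - u.2 1 * u.2 2 / 2 + u.1 1 * u.1 2 / 2
        - u.1 2 * u.2 2 / 2,
      u.2 0 * e - u.2 0 ^ 2 + u.2 1 * u.1 2 + u.2 1 ^ 2 + 2 * u.1 0 ^ 2 + u.1 1 * u.2 2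
        - 2 * u.1 1 ^ 2],
    ![-u.2 0 * u.2 1 - u.1 0 * u.2 2, u.2 0 ^ 2 + u.1 1 * u.2 2,
      u.2 0 * u.1 0 - u.2 1 * u.1 1])

/-- The Hamiltonian field of `rK`. -/
def rXK (e : ℝ) (u : Phase) : Phase :=
  (2 * rZ1 e u) • rX1 e u + (2 * rZ2 e u) • rX2 e u

theorem ham_rH (e : ℝ) (u : Phase) : ham u (fderiv ℝ (rH e) u) = rXH e u := by
  apply phase_ext <;> simp [ham, rXH, fderiv_rH] <;> ring

theorem ham_rZ1 (e : ℝ) (u : Phase) : ham u (fderiv ℝ (rZ1 e) u) = rX1 e u := by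
  apply phase_ext <;> simp [ham, rX1, fderiv_rZ1] <;> ring

theorem ham_rZ2 (e : ℝ) (u : Phase) : ham u (fderiv ℝ (rZ2 e) u) = rX2 e u := by
  apply phase_ext <;> simp [ham, rX2, fderiv_rZ2] <;> ring

theorem ham_rL (u : Phase) : ham u (fderiv ℝ rL u) = 0 := by
  apply phase_ext <;> simp [ham, fderiv_rL] <;> ring

theorem ham_rK (e : ℝ) (u : Phase) : ham u (fderiv ℝ (rK e) u) = rXK e u := by
  have : fderiv ℝ (rK e) u
      = (2 * rZ1 e u) • fderiv ℝ (rZ1 e) u + (2 * rZ2 e u) • fderiv ℝ (rZ2 e) u := by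
    refine ContinuousLinearMap.ext fun v => ?_
    simp [fderiv_rK]
  rw [this, ham_add, ham_smul, ham_smul, ham_rZ1, ham_rZ2, rXK]

theorem sgrad_H (p : Params) (hs : p.e1 ≠ 0) (x : Phase) :
    sgrad (H p) x = (red hs).symm (rXH (p.e0 / p.e1) (red hs x)) := by
  rw [H_eq p hs, sgrad_comp_red hs (differentiable_rH _), ham_rH]

theorem sgrad_K (p : Params) (hs : p.e1 ≠ 0) (x : Phase) :
    sgrad (K p) x = (red hs).symm (rXK (p.e0 / p.e1) (red hs x)) := by
  rw [K_eq p hs, sgrad_comp_red hs (differentiable_rK _), ham_rK]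

/-! ### Linearizations -/

theorem differentiable_phase_mk {f0 f1 f2 g0 g1 g2 : Phase → ℝ} (h0 : Differentiable ℝ f0)
    (h1 : Differentiable ℝ f1) (h2 : Differentiable ℝ f2) (k0 : Differentiable ℝ g0)
    (k1 : Differentiable ℝ g1) (k2 : Differentiable ℝ g2) :
    Differentiable ℝ (fun u => ((![f0 u, f1 u, f2 u], ![g0 u, g1 u, g2 u]) : Phase)) := by
  refine Differentiable.prodMk (differentiable_pi.2 fun i => ?_) (differentiable_pi.2 fun i => ?_)
  all_goals fin_cases i <;> simpa

@[fun_prop] theorem differentiable_rXH (e : ℝ) : Differentiable ℝ (rXH e) := by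
  unfold rXH
  apply differentiable_phase_mk <;> fun_prop

@[fun_prop] theorem differentiable_rX1 (e : ℝ) : Differentiable ℝ (rX1 e) := by
  unfold rX1
  apply differentiable_phase_mk <;> fun_prop

@[fun_prop] theorem differentiable_rX2 (e : ℝ) : Differentiable ℝ (rX2 e) := by
  unfold rX2
  apply differentiable_phase_mk <;> fun_prop

@[fun_prop] theorem differentiable_rXK (e : ℝ) : Differentiable ℝ (rXK e) := by
  unfold rXK
  fun_prop

theorem fderiv_rXH (e : ℝ) (u v : Phase) : fderiv ℝ (rXH e) u v =
    (![((v.1 1 - v.2 2) * (u.1 2 + u.2 1) + (u.1 1 - u.2 2) * (v.1 2 + v.2 1)) / 2,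
      -(v.1 2 + v.2 1) * u.1 0 / 2 - (u.1 2 + u.2 1) * v.1 0 / 2 + v.2 2 * (u.2 0 - e / 2)
        + u.2 2 * v.2 0,
      v.2 2 * u.1 0 + u.2 2 * v.1 0 - v.2 1 * (u.2 0 - e) - u.2 1 * v.2 0],
    ![v.2 1 * u.1 2 + u.2 1 * v.1 2 - v.2 2 * u.1 1 - u.2 2 * v.1 1,
      v.2 2 * u.1 0 + u.2 2 * v.1 0 - v.2 0 * u.1 2 - u.2 0 * v.1 2,
      v.2 0 * u.1 1 + u.2 0 * v.1 1 - v.2 1 * u.1 0 - u.2 1 * v.1 0]) := by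
  apply phase_ext
  all_goals
    simp only [fderiv_fst_comp (differentiable_rXH e u), fderiv_snd_comp (differentiable_rXH e u),
      rXH, Matrix.cons_val]
    simp (disch := fun_prop) only [fderiv_fun_add, fderiv_fun_sub, fderiv_fun_mul, fderiv_fun_pow,
      fderiv_fun_neg, fderiv_fst_apply, fderiv_snd_apply, div_eq_mul_inv, fderiv_fun_const]
    simp
    ring

theorem fderiv_rX1 (e : ℝ) (u v : Phase) : fderiv ℝ (rX1 e) u v =
    (![((v.1 1 - v.2 2) * (u.1 2 + u.2 1) + (u.1 1 - u.2 2) * (v.1 2 + v.2 1)) / 2,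
      -v.2 0 * u.2 2 - u.2 0 * v.2 2 - 3 / 2 * (v.2 1 * u.1 0 + u.2 1 * v.1 0) + e * v.2 2 / 2
        + (v.1 0 * u.1 2 + u.1 0 * v.1 2) / 2,
      2 * (v.2 0 * u.2 1 + u.2 0 * v.2 1) + v.2 0 * u.1 2 + u.2 0 * v.1 2 - v.2 1 * e
        - 4 * (v.1 0 * u.1 1 + u.1 0 * v.1 1) + v.1 0 * u.2 2 + u.1 0 * v.2 2],
    ![2 * u.2 1 * v.2 1 + v.1 1 * u.2 2 + u.1 1 * v.2 2,
      -v.2 0 * u.2 1 - u.2 0 * v.2 1 + v.1 0 * u.2 2 + u.1 0 * v.2 2,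
      -v.2 0 * u.1 1 - u.2 0 * v.1 1 - v.2 1 * u.1 0 - u.2 1 * v.1 0]) := by
  apply phase_ext
  all_goals
    simp only [fderiv_fst_comp (differentiable_rX1 e u), fderiv_snd_comp (differentiable_rX1 e u),
      rX1, Matrix.cons_val]
    simp (disch := fun_prop) only [fderiv_fun_add, fderiv_fun_sub, fderiv_fun_mul, fderiv_fun_pow,
      fderiv_fun_neg, fderiv_fst_apply, fderiv_snd_apply, div_eq_mul_inv, fderiv_fun_const]
    simp
    ring

theorem fderiv_rX2 (e : ℝ) (u v : Phase) : fderiv ℝ (rX2 e) u v =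
    (![-v.2 0 * u.1 1 - u.2 0 * v.1 1 + v.2 0 * u.2 2 + u.2 0 * v.2 2
        + (v.2 1 * u.1 0 + u.2 1 * v.1 0) / 2 - e * v.2 2 / 2
        - (v.1 0 * u.1 2 + u.1 0 * v.1 2) / 2,
      v.2 0 * u.1 0 + u.2 0 * v.1 0 - (v.2 1 * u.1 1 + u.2 1 * v.1 1) / 2
        - (v.2 1 * u.2 2 + u.2 1 * v.2 2) / 2 + (v.1 1 * u.1 2 + u.1 1 * v.1 2) / 2
        - (v.1 2 * u.2 2 + u.1 2 * v.2 2) / 2,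
      v.2 0 * e - 2 * u.2 0 * v.2 0 + v.2 1 * u.1 2 + u.2 1 * v.1 2 + 2 * u.2 1 * v.2 1
        + 4 * u.1 0 * v.1 0 + v.1 1 * u.2 2 + u.1 1 * v.2 2 - 4 * u.1 1 * v.1 1],
    ![-v.2 0 * u.2 1 - u.2 0 * v.2 1 - v.1 0 * u.2 2 - u.1 0 * v.2 2,
      2 * u.2 0 * v.2 0 + v.1 1 * u.2 2 + u.1 1 * v.2 2,
      v.2 0 * u.1 0 + u.2 0 * v.1 0 - v.2 1 * u.1 1 - u.2 1 * v.1 1]) := by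
  apply phase_ext
  all_goals
    simp only [fderiv_fst_comp (differentiable_rX2 e u), fderiv_snd_comp (differentiable_rX2 e u),
      rX2, Matrix.cons_val]
    simp (disch := fun_prop) only [fderiv_fun_add, fderiv_fun_sub, fderiv_fun_mul, fderiv_fun_pow,
      fderiv_fun_neg, fderiv_fst_apply, fderiv_snd_apply, div_eq_mul_inv, fderiv_fun_const]
    simp
    ring

theorem fderiv_rXK (e : ℝ) (u v : Phase) : fderiv ℝ (rXK e) u v =
    (2 * fderiv ℝ (rZ1 e) u v) • rX1 e u + (2 * rZ1 e u) • fderiv ℝ (rX1 e) u v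
      + ((2 * fderiv ℝ (rZ2 e) u v) • rX2 e u + (2 * rZ2 e u) • fderiv ℝ (rX2 e) u v) := by
  unfold rXK
  simp (disch := fun_prop) only [fderiv_fun_add, fderiv_fun_smul, fderiv_const_mul]
  simp
  abel

theorem linOp_conj {s : ℝ} (hs : s ≠ 0) {f : Phase → ℝ} {X : Phase → Phase}
    (hf : ∀ x, sgrad f x = (red hs).symm (X (red hs x))) (hX : Differentiable ℝ X) (x : Phase) :
    linOp f x = (red hs).symm.toLinearEquiv.conj
      ((fderiv ℝ X (red hs x) : Phase →L[ℝ] Phase) : Phase →ₗ[ℝ] Phase) := by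
  have : sgrad f = fun x => (red hs).symm (X (red hs x)) := funext hf
  have key : fderiv ℝ (sgrad f) x = ((red hs).symm : Phase →L[ℝ] Phase).comp
      ((fderiv ℝ X (red hs x)).comp (red hs : Phase →L[ℝ] Phase)) := by
    rw [this]
    exact ((red hs).symm.hasFDerivAt.comp x
      ((hX _).hasFDerivAt.comp x (red hs).hasFDerivAt)).fderiv
  refine LinearMap.ext fun v => ?_
  rw [linOp, key]
  rfl

/-! ### Linear algebra -/

theorem not_surjective_iff_exists_dual {V W : Type*} [AddCommGroup V] [Module ℝ V]
    [AddCommGroup W] [Module ℝ W] (l : V →ₗ[ℝ] W) :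
    ¬ Function.Surjective l ↔ ∃ f : W →ₗ[ℝ] ℝ, f ≠ 0 ∧ ∀ v, f (l v) = 0 := by
  rw [← LinearMap.range_eq_top]
  constructor
  · intro h
    obtain ⟨f, hf, hle⟩ := Submodule.exists_le_ker_of_lt_top _ (lt_top_iff_ne_top.2 h)
    exact ⟨f, hf, fun v => hle (LinearMap.mem_range_self l v)⟩
  · rintro ⟨f, hf, h⟩ htop
    apply hf
    ext w
    obtain ⟨v, rfl⟩ := LinearMap.range_eq_top.1 htop w
    exact h v

theorem not_surjective_iff_exists_coeff {V : Type*} [AddCommGroup V] [Module ℝ V] {m : ℕ}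
    (l : V →ₗ[ℝ] (Fin m → ℝ)) :
    ¬ Function.Surjective l ↔ ∃ c : Fin m → ℝ, c ≠ 0 ∧ ∀ v, ∑ i, c i * l v i = 0 := by
  rw [not_surjective_iff_exists_dual]
  constructor
  · rintro ⟨f, hf, h⟩
    have key : ∀ w : Fin m → ℝ, f w = ∑ i, f (Pi.single i 1) * w i := by
      intro w
      conv_lhs => rw [← Finset.univ_sum_single w]
      rw [map_sum]
      refine Finset.sum_congr rfl fun i _ => ?_
      rw [mul_comm, ← smul_eq_mul, ← map_smul]
      congr 1
      rw [← Pi.single_smul]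
      simp
    refine ⟨fun i => f (Pi.single i 1), ?_, fun v => by rw [← key]; exact h v⟩
    rintro h0
    apply hf
    ext w
    simp only [LinearMap.comp_apply]
    rw [key]
    simp [fun i => congrFun h0 i]
  · rintro ⟨c, hc, h⟩
    refine ⟨∑ i, c i • LinearMap.proj i, ?_, fun v => by simpa using h v⟩
    rintro h0
    apply hc
    funext j
    have := congrArg (fun f : (Fin m → ℝ) →ₗ[ℝ] ℝ => f (Pi.single j 1)) h0
    simpa [Pi.single_apply] using this

/-- Regular points of a continuously differentiable map form an open set. -/
theorem isOpen_surjective_fderiv {m : ℕ} {G : Phase → Fin m → ℝ} (hG : ContDiff ℝ 1 G) :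
    IsOpen {y | Function.Surjective (fderiv ℝ G y)} := by
  have hcont : Continuous (fderiv ℝ G) := hG.continuous_fderiv one_ne_zero
  -- A point is singular iff some covector of norm one annihilates the image of the derivative. The
  -- set of such pairs is closed, and projection along the compact sphere is a closed map.
  have hcl : IsClosed {q : Metric.sphere (0 : Fin m → ℝ) 1 × Phase |
      ∀ v, ∑ i, (q.1 : Fin m → ℝ) i * fderiv ℝ G q.2 v i = 0} := by
    simp only [Set.ofPred_forall]
    refine isClosed_iInter fun v => isClosed_eq ?_ continuous_const
    refine continuous_finsetSum _ fun i _ => Continuous.mul ?_ ?_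
    · exact (continuous_apply i).comp (continuous_subtype_val.comp continuous_fst)
    · exact (continuous_apply i).comp ((hcont.comp continuous_snd).clm_apply continuous_const)
  have himg := isClosedMap_snd_of_compactSpace _ hcl
  rw [← isClosed_compl_iff]
  convert himg using 1
  ext y
  simp only [Set.mem_compl_iff, Set.mem_ofPred_eq, Set.mem_image, Prod.exists, exists_eq_right]
  have := not_surjective_iff_exists_coeff ((fderiv ℝ G y : Phase →L[ℝ] _) : Phase →ₗ[ℝ] (Fin m → ℝ))
  rw [ContinuousLinearMap.coe_coe] at this
  rw [this]
  constructor
  · rintro ⟨c, hc, h⟩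
    have hn : ‖c‖ ≠ 0 := norm_ne_zero_iff.2 hc
    refine ⟨⟨‖c‖⁻¹ • c, by simp [norm_smul, hn]⟩, fun v => ?_⟩
    have := h v
    simp only [Pi.smul_apply, smul_eq_mul, mul_assoc, ← Finset.mul_sum, this, mul_zero]
  · rintro ⟨⟨c, hc⟩, h⟩
    refine ⟨c, ?_, h⟩
    rintro rfl
    simp at hc

/-! ### Critical points -/

theorem fderiv_H (p : Params) (hs : p.e1 ≠ 0) (x v : Phase) :
    fderiv ℝ (H p) x v = fderiv ℝ (rH (p.e0 / p.e1)) (red hs x) (red hs v) := by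
  have := ((differentiable_rH (p.e0 / p.e1) _).hasFDerivAt.comp x (red hs).hasFDerivAt).fderiv
  rw [H_eq p hs]
  exact congrArg (fun l : Phase →L[ℝ] ℝ => l v) this

theorem fderiv_K (p : Params) (hs : p.e1 ≠ 0) (x v : Phase) :
    fderiv ℝ (K p) x v = fderiv ℝ (rK (p.e0 / p.e1)) (red hs x) (red hs v) := by
  have := ((differentiable_rK (p.e0 / p.e1) _).hasFDerivAt.comp x (red hs).hasFDerivAt).fderiv
  rw [K_eq p hs]
  exact congrArg (fun l : Phase →L[ℝ] ℝ => l v) this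

theorem hasFDerivAt_L {s : ℝ} (hs : s ≠ 0) (x : Phase) : HasFDerivAt L
    ((2 * s)⁻¹ • (fderiv ℝ rL (red hs x)).comp (red hs : Phase →L[ℝ] Phase)) x := by
  rw [L_eq hs]
  exact ((differentiable_rL _).hasFDerivAt.comp x (red hs).hasFDerivAt).const_mul _

theorem hasFDerivAt_Gam {s : ℝ} (hs : s ≠ 0) (x : Phase) : HasFDerivAt Gam
    ((s ^ 2)⁻¹ • (fderiv ℝ rG (red hs x)).comp (red hs : Phase →L[ℝ] Phase)) x := by
  rw [Gam_eq hs]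
  exact ((differentiable_rG _).hasFDerivAt.comp x (red hs).hasFDerivAt).const_mul _

theorem fderiv_L {s : ℝ} (hs : s ≠ 0) (x v : Phase) :
    fderiv ℝ L x v = (2 * s)⁻¹ * fderiv ℝ rL (red hs x) (red hs v) := by
  rw [(hasFDerivAt_L hs x).fderiv]; rfl

theorem fderiv_Gam {s : ℝ} (hs : s ≠ 0) (x v : Phase) :
    fderiv ℝ Gam x v = (s ^ 2)⁻¹ * fderiv ℝ rG (red hs x) (red hs v) := by
  rw [(hasFDerivAt_Gam hs x).fderiv]; rfl

theorem mem_T5 {s : ℝ} (hs : s ≠ 0) {x v : Phase} :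
    v ∈ T5 x ↔ fderiv ℝ rG (red hs x) (red hs v) = 0 := by
  rw [T5, LinearMap.mem_ker, ContinuousLinearMap.coe_coe, fderiv_Gam hs]
  simp [hs]

theorem mem_T4 {s : ℝ} (hs : s ≠ 0) {x v : Phase} :
    v ∈ T4 x ↔ fderiv ℝ rL (red hs x) (red hs v) = 0 ∧ fderiv ℝ rG (red hs x) (red hs v) = 0 := by
  rw [T4, Submodule.mem_inf, mem_T5 hs, LinearMap.mem_ker, ContinuousLinearMap.coe_coe,
    fderiv_L hs]
  simp [hs]

theorem differentiable_H (p : Params) (hs : p.e1 ≠ 0) : Differentiable ℝ (H p) := by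
  rw [H_eq p hs]; exact (differentiable_rH _).comp (red hs).differentiable

theorem differentiable_K (p : Params) (hs : p.e1 ≠ 0) : Differentiable ℝ (K p) := by
  rw [K_eq p hs]; exact (differentiable_rK _).comp (red hs).differentiable

theorem differentiable_L : Differentiable ℝ L :=
  fun x => (hasFDerivAt_L one_ne_zero x).differentiableAt

theorem fderiv_momentumMap (p : Params) (hs : p.e1 ≠ 0) (x v : Phase) :
    fderiv ℝ (momentumMap p) x v = (fderiv ℝ (H p) x v, fderiv ℝ L x v, fderiv ℝ (K p) x v) := by
  have := ((differentiable_H p hs x).hasFDerivAt.prodMk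
    ((differentiable_L x).hasFDerivAt.prodMk (differentiable_K p hs x).hasFDerivAt)).fderiv
  exact congrArg (fun l : Phase →L[ℝ] ℝ × ℝ × ℝ => l v) this

/-- A nontrivial linear relation of the differentials of the integrals at `u`. -/
def IsCritical (e : ℝ) (u : Phase) : Prop :=
  ∃ A B C D : ℝ, (A ≠ 0 ∨ B ≠ 0 ∨ C ≠ 0 ∨ D ≠ 0) ∧ ∀ w,
    A * fderiv ℝ (rK e) u w + B * fderiv ℝ (rH e) u w + C * fderiv ℝ rL u w
      + D * fderiv ℝ rG u w = 0

theorem rG_red {p : Params} (hs : p.e1 ≠ 0) {x : Phase} :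
    x ∈ P5 p ↔ rG (red hs x) = (p.e1 * p.a) ^ 2 := by
  simp only [P5, Set.mem_ofPred_eq, Gam_eq hs]
  constructor
  · intro h
    field_simp at h
    linarith
  · intro h
    rw [h]
    field_simp

theorem mem_span_pair_of_ker {V : Type*} [AddCommGroup V] [Module ℝ V] [FiniteDimensional ℝ V]
    {f g k : V →ₗ[ℝ] ℝ} (h : ∀ v, f v = 0 → g v = 0 → k v = 0) :
    ∃ c d : ℝ, ∀ v, k v = c * f v + d * g v := by
  have : k ∈ Submodule.span ℝ (Set.range ![f, g]) := by
    refine FiniteDimensional.mem_span_of_iInf_ker_le_ker fun v hv => ?_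
    simp only [Submodule.mem_iInf] at hv
    exact h v (hv 0) (hv 1)
  rw [Matrix.range_cons, Matrix.range_cons, Matrix.range_empty, Set.union_empty,
    Set.singleton_union, Submodule.mem_span_pair] at this
  obtain ⟨c, d, rfl⟩ := this
  exact ⟨c, d, fun v => by simp⟩

/-- A covector killing the image of `T5` pulls back to a multiple of `dΓ`, which supplies the
multiplier `D`. Conversely `dΓ ≠ 0` on `P5`, so a nontrivial relation cannot consist of `D` alone.
-/
theorem mem_criticalSet_iff (p : Params) (hs : p.e1 ≠ 0) (ha : p.a ≠ 0) (x : Phase) :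
    x ∈ criticalSet p ↔ x ∈ P5 p ∧ IsCritical (p.e0 / p.e1) (red hs x) := by
  rw [criticalSet, Set.mem_ofPred_eq]
  refine and_congr_right fun hx => ?_
  have hG : rG (red hs x) ≠ 0 := by
    rw [(rG_red hs).1 hx]; positivity
  have h1 := not_surjective_iff_exists_dual
    (((fderiv ℝ (momentumMap p) x : Phase →L[ℝ] ℝ × ℝ × ℝ) : Phase →ₗ[ℝ] ℝ × ℝ × ℝ).domRestrict
      (T5 x))
  have h2 : (fun v : T5 x => fderiv ℝ (momentumMap p) x v)
    = (((fderiv ℝ (momentumMap p) x : Phase →L[ℝ] ℝ × ℝ × ℝ) : Phase →ₗ[ℝ] ℝ × ℝ × ℝ).domRestrict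
      (T5 x)) := rfl
  rw [h2, h1]
  constructor
  · rintro ⟨f, hf, h⟩
    have hfe : ∀ y : ℝ × ℝ × ℝ, f y = f (1, 0, 0) * y.1 + f (0, 1, 0) * y.2.1
        + f (0, 0, 1) * y.2.2 := by
      intro y
      have : y = y.1 • (1, 0, 0) + y.2.1 • (0, 1, 0) + y.2.2 • ((0, 0, 1) : ℝ × ℝ × ℝ) := by
        ext <;> simp
      conv_lhs => rw [this]
      simp only [map_add, map_smul, smul_eq_mul]
      ring
    -- There is one constraint only, so the second functional is taken to be zero.
    obtain ⟨c, d, hcd⟩ := mem_span_pair_of_ker (V := Phase)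
      (f := ((fderiv ℝ Gam x : Phase →L[ℝ] ℝ) : Phase →ₗ[ℝ] ℝ)) (g := 0)
      (k := f.comp ((fderiv ℝ (momentumMap p) x : Phase →L[ℝ] ℝ × ℝ × ℝ) :
        Phase →ₗ[ℝ] ℝ × ℝ × ℝ)) (fun v hv _ => h ⟨v, hv⟩)
    refine ⟨f (0, 0, 1), f (1, 0, 0), (2 * p.e1)⁻¹ * f (0, 1, 0), -c * (p.e1 ^ 2)⁻¹, ?_, ?_⟩
    · by_contra! hz
      apply hf
      have hz' : f (0, 1, 0) = 0 := by
        have := hz.2.2.1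
        simpa [hs] using this
      apply LinearMap.ext
      intro y
      rw [hfe y, hz.1, hz.2.1, hz']
      simp
    · intro w
      have := hcd ((red hs).symm w)
      simp only [LinearMap.comp_apply, ContinuousLinearMap.coe_coe, LinearMap.zero_apply,
        mul_zero, add_zero] at this
      rw [hfe, fderiv_momentumMap p hs] at this
      simp only [fderiv_H p hs, fderiv_K p hs, fderiv_L hs, fderiv_Gam hs,
        ContinuousLinearEquiv.apply_symm_apply] at this
      linear_combination this
  · rintro ⟨A, B, C, D, hne, h⟩
    refine ⟨B • LinearMap.fst ℝ ℝ (ℝ × ℝ)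
      + (2 * p.e1 * C) • (LinearMap.fst ℝ ℝ ℝ).comp (LinearMap.snd ℝ ℝ (ℝ × ℝ))
      + A • (LinearMap.snd ℝ ℝ ℝ).comp (LinearMap.snd ℝ ℝ (ℝ × ℝ)), ?_, ?_⟩
    · intro h0
      have ev : ∀ y : ℝ × ℝ × ℝ, B * y.1 + 2 * p.e1 * C * y.2.1 + A * y.2.2 = 0 := fun y => by
        have := congrArg (fun f : ℝ × ℝ × ℝ →ₗ[ℝ] ℝ => f y) h0
        simpa using this
      have hB : B = 0 := by simpa using ev (1, 0, 0)
      have hA : A = 0 := by simpa using ev (0, 0, 1)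
      have hC : C = 0 := by simpa [hs] using ev (0, 1, 0)
      subst hA hB hC
      have hD : D = 0 := by
        -- Evaluation at the point itself: `Γ` is quadratic, so `dΓ` takes the value `2Γ ≠ 0` there.
        have := h (red hs x)
        rw [fderiv_rG] at this
        have h2 : D * (2 * rG (red hs x)) = 0 := by rw [rG]; linear_combination this
        simpa [hG] using h2
      simp [hD] at hne
    · rintro ⟨v, hv⟩
      rw [mem_T5 hs] at hv
      have hw := h (red hs v)
      rw [hv, ← fderiv_H p hs, ← fderiv_K p hs] at hw
      have hL := fderiv_L hs x v
      have e : (2 * p.e1) * fderiv ℝ L x v = fderiv ℝ rL (red hs x) (red hs v) := by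
        rw [hL]; field_simp
      rw [← e] at hw
      have hm := fderiv_momentumMap p hs x v
      simp only [LinearMap.domRestrict_apply, ContinuousLinearMap.coe_coe, hm,
        LinearMap.add_apply, LinearMap.smul_apply, LinearMap.comp_apply, LinearMap.fst_apply,
        LinearMap.snd_apply, smul_eq_mul]
      linear_combination hw

/-- Needed for the third subsystem, whose points over the poles are accessible only as limits. -/
theorem isClosed_isCritical (e : ℝ) : IsClosed {u | IsCritical e u} := by
  have hG : ContDiff ℝ 1 (fun u => ![rK e u, rH e u, rL u, rG u]) := by
    rw [contDiff_pi]
    intro i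
    fin_cases i <;> simp <;> fun_prop
  have := (isOpen_surjective_fderiv hG).isClosed_compl
  convert this using 1
  ext u
  have hc : ∀ w i, fderiv ℝ (fun u => ![rK e u, rH e u, rL u, rG u]) u w i
      = fderiv ℝ (fun u => ![rK e u, rH e u, rL u, rG u] i) u w := by
    intro w i
    have := fderiv_pi (𝕜 := ℝ) (φ := fun (i : Fin 4) u => ![rK e u, rH e u, rL u, rG u] i)
      (x := u) (fun i => by fin_cases i <;> simp <;> fun_prop)
    rw [this]
    rfl
  have hn := not_surjective_iff_exists_coeff
    ((fderiv ℝ (fun u => ![rK e u, rH e u, rL u, rG u]) u : Phase →L[ℝ] _) :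
      Phase →ₗ[ℝ] (Fin 4 → ℝ))
  rw [ContinuousLinearMap.coe_coe] at hn
  simp only [Set.mem_compl_iff, Set.mem_ofPred_eq, hn, hc,
    Fin.sum_univ_four]
  constructor
  · rintro ⟨A, B, C, D, hne, h⟩
    refine ⟨![A, B, C, D], ?_, h⟩
    intro h0
    have e0 := congrFun h0 0
    have e1 := congrFun h0 1
    have e2 := congrFun h0 2
    have e3 := congrFun h0 3
    simp at e0 e1 e2 e3
    simp [e0, e1, e2, e3] at hne
  · rintro ⟨c, hne, h⟩
    refine ⟨c 0, c 1, c 2, c 3, ?_, h⟩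
    by_contra! h0
    apply hne
    funext i
    fin_cases i
    exacts [h0.1, h0.2.1, h0.2.2.1, h0.2.2.2]

/-! ### The subsystems in the reduced coordinates -/

/-- The first relation of the second subsystem. -/
def rZ21 (e : ℝ) (u : Phase) : ℝ :=
  u.1 2 ^ 2 - u.2 1 ^ 2 - 2 * e * u.2 0 + e ^ 2

/-- The second relation of the second subsystem. -/
def rZ22 (e : ℝ) (u : Phase) : ℝ :=
  u.2 0 * (e * u.1 1 + (u.1 2 + u.2 1) * u.1 0) + u.2 1 * ((u.1 2 + u.2 1) * u.1 1 - e * u.1 0)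

/-- The first relation of the third subsystem. -/
def rZ31 (u : Phase) : ℝ :=
  (u.2 0 ^ 2 + u.2 1 ^ 2) * (u.1 2 - u.2 1) - 2 * (u.1 0 * u.2 0 + u.1 1 * u.2 1) * u.2 2

/-- The second relation of the third subsystem. -/
def rZ32 (e : ℝ) (u : Phase) : ℝ :=
  (u.2 0 ^ 2 - u.2 1 ^ 2) * rZ2 e u - 2 * u.2 0 * u.2 1 * rZ1 e u

/-- The first relation of the fourth subsystem. -/
def rZ41 (u : Phase) : ℝ := u.1 1 - u.2 2

/-- The second relation of the fourth subsystem. -/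
def rZ42 (e : ℝ) (u : Phase) : ℝ := u.1 0 * (u.1 2 - u.2 1) + e * u.2 2

/-- The pairs of relations. -/
def relA (e : ℝ) : Fin 4 → Phase → ℝ
  | 0 => rZ1 e
  | 1 => rZ21 e
  | 2 => rZ31
  | 3 => rZ41

/-- See `relA`. -/
def relB (e : ℝ) : Fin 4 → Phase → ℝ
  | 0 => rZ2 e
  | 1 => rZ22 e
  | 2 => rZ32 e
  | 3 => rZ42 e

/-- The subsystems in the reduced coordinates on the level `Γ = g`. -/
def rsub (e g : ℝ) : Fin 4 → Set Phase
  | 0 => {u | rG u = g ∧ rZ1 e u = 0 ∧ rZ2 e u = 0}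
  | 1 => {u | rG u = g ∧ rZ21 e u = 0 ∧ rZ22 e u = 0}
  | 2 => closure {u | u.2 0 ^ 2 + u.2 1 ^ 2 ≠ 0 ∧ rG u = g ∧ rZ31 u = 0 ∧ rZ32 e u = 0}
  | 3 => {u | rG u = g ∧ rZ41 u = 0 ∧ rZ42 e u = 0}

@[fun_prop] theorem contDiff_rZ21 (e : ℝ) {n : WithTop ℕ∞} : ContDiff ℝ n (rZ21 e) := by
  unfold rZ21; fun_prop

@[fun_prop] theorem contDiff_rZ22 (e : ℝ) {n : WithTop ℕ∞} : ContDiff ℝ n (rZ22 e) := by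
  unfold rZ22; fun_prop

@[fun_prop] theorem contDiff_rZ31 {n : WithTop ℕ∞} : ContDiff ℝ n rZ31 := by
  unfold rZ31; fun_prop

@[fun_prop] theorem contDiff_rZ32 (e : ℝ) {n : WithTop ℕ∞} : ContDiff ℝ n (rZ32 e) := by
  unfold rZ32; fun_prop

@[fun_prop] theorem contDiff_rZ41 {n : WithTop ℕ∞} : ContDiff ℝ n rZ41 := by
  unfold rZ41; fun_prop

@[fun_prop] theorem contDiff_rZ42 (e : ℝ) {n : WithTop ℕ∞} : ContDiff ℝ n (rZ42 e) := by
  unfold rZ42; fun_prop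

theorem contDiff_relA (e : ℝ) (i : Fin 4) {n : WithTop ℕ∞} : ContDiff ℝ n (relA e i) := by
  fin_cases i <;> simp only [relA] <;> fun_prop

theorem contDiff_relB (e : ℝ) (i : Fin 4) {n : WithTop ℕ∞} : ContDiff ℝ n (relB e i) := by
  fin_cases i <;> simp only [relB] <;> fun_prop

/-- Where `α₁² + α₂² ≠ 0` the third subsystem is given by its two relations. -/
theorem mem_rsub_two_iff {e g : ℝ} {u : Phase} (hu : u.2 0 ^ 2 + u.2 1 ^ 2 ≠ 0) :
    u ∈ rsub e g 2 ↔ rG u = g ∧ rZ31 u = 0 ∧ rZ32 e u = 0 := by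
  constructor
  · intro h
    have hc : IsClosed {u | rG u = g ∧ rZ31 u = 0 ∧ rZ32 e u = 0} := by
      have c1 : Continuous rG := (contDiff_rG (n := 0)).continuous
      have c2 : Continuous rZ31 := (contDiff_rZ31 (n := 0)).continuous
      have c3 : Continuous (rZ32 e) := (contDiff_rZ32 e (n := 0)).continuous
      exact (isClosed_eq c1 continuous_const).inter
        ((isClosed_eq c2 continuous_const).inter (isClosed_eq c3 continuous_const))
    exact closure_minimal (fun v hv => hv.2) hc h
  · intro h
    exact subset_closure ⟨hu, h⟩

theorem subsystem_zero (p : Params) (hs : p.e1 ≠ 0) :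
    subsystem p 0 = red hs ⁻¹' rsub (p.e0 / p.e1) ((p.e1 * p.a) ^ 2) 0 := by
  ext x
  simp only [subsystem, rsub, Set.mem_ofPred_eq, Set.mem_preimage]
  rw [rG_red hs]
  refine and_congr_right fun hG => ?_
  have h1 : p.e0 / p.e1 * p.e1 = p.e0 := by field_simp
  have e1 : Z11 p x = rZ1 (p.e0 / p.e1) (red hs x) := by
    simp [rZ1, Z11, rG, red_apply] at hG ⊢
    linear_combination hG - x.2 0 * h1
  have e2 : Z12 p x = rZ2 (p.e0 / p.e1) (red hs x) := by
    simp [rZ2, Z12, red_apply]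
    linear_combination -x.2 1 * h1
  rw [e1, e2]

theorem subsystem_one (p : Params) (hs : 0 < p.e1) (h0 : 0 < p.e0) :
    subsystem p 1 = red hs.ne' ⁻¹' rsub (p.e0 / p.e1) ((p.e1 * p.a) ^ 2) 1 := by
  ext x
  simp only [subsystem, rsub, Set.mem_ofPred_eq, Set.mem_preimage]
  rw [rG_red hs.ne']
  refine and_congr_right fun hG => ?_
  obtain ⟨e, he⟩ : ∃ e, e = p.e0 / p.e1 := ⟨_, rfl⟩
  have h1 : p.e0 = e * p.e1 := by rw [he]; field_simp
  rw [← he]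
  have e1 : Z21 p x = 0 ↔ rZ21 e (red hs.ne' x) = 0 := by
    have hpos : √(p.e0 ^ 2 + p.e1 ^ 2 * (x.1 0 ^ 2 + x.1 2 ^ 2)) /
        (p.e1 * √(p.e0 ^ 2 + p.e1 ^ 2 * x.1 2 ^ 2)) ≠ 0 := by positivity
    have : p.e1 ^ 2 * (x.1 2 - 2 * p.e1 * x.2 1) * x.1 2 - 2 * p.e0 * p.e1 ^ 2 * x.2 0 + p.e0 ^ 2
        = p.e1 ^ 2 * rZ21 e (red hs.ne' x) := by
      simp [rZ21, red_apply]
      rw [h1]; ring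
    rw [Z21, this, mul_eq_zero, mul_eq_zero]
    simp [hpos, hs.ne']
  rw [e1]
  refine and_congr_right fun hZ => ?_
  have hpos : 1 / √(p.e0 ^ 2 + p.e1 ^ 2 * x.1 2 ^ 2) ≠ 0 := by positivity
  -- The two forms of the second relation agree only modulo the first relation `hZ`.
  have : p.e1 ^ 2 * (x.1 1 + 2 * p.e1 * x.2 2) * x.1 2 ^ 2 + 2 * p.e1 ^ 3 * x.2 0 * x.1 0 * x.1 2
      + p.e0 * (p.e0 * x.1 1 - 2 * p.e1 ^ 2 * x.2 1 * x.1 0 + 2 * p.e0 * p.e1 * x.2 2)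
      = 4 * p.e1 ^ 2 * rZ22 e (red hs.ne' x) := by
    simp [rZ22, rZ21, red_apply] at hZ ⊢
    rw [h1]
    linear_combination p.e1 ^ 2 * (x.1 1 + 2 * p.e1 * x.2 2) * hZ
  rw [Z22, this, mul_eq_zero_iff_left hpos, mul_eq_zero_iff_left (by positivity)]

theorem subsystem_three (p : Params) (hs : p.e1 ≠ 0) :
    subsystem p 3 = red hs ⁻¹' rsub (p.e0 / p.e1) ((p.e1 * p.a) ^ 2) 3 := by
  ext x
  simp only [subsystem, rsub, Set.mem_ofPred_eq, Set.mem_preimage]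
  rw [rG_red hs]
  refine and_congr_right fun hG => ?_
  have h1 : p.e0 / p.e1 * p.e1 = p.e0 := by field_simp
  have e1 : rZ41 (red hs x) = Z41 x / 2 := by
    simp [rZ41, Z41, red_apply]
  have e2 : rZ42 (p.e0 / p.e1) (red hs x) = Z42 p x := by
    simp [rZ42, Z42, red_apply]
    linear_combination x.2 2 * h1
  rw [e1, e2]
  simp

/-- Multiplication by the positive number `rho x` clears the root, and `Γ = a²` turns the explicit
`a²` into a polynomial in `α`. -/
theorem Z31_eq_zero_iff (p : Params) (hs : p.e1 ≠ 0) {x : Phase}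
    (hG : rG (red hs x) = (p.e1 * p.a) ^ 2) (hx : x.2 0 ^ 2 + x.2 1 ^ 2 ≠ 0) :
    Z31 p x = 0 ↔ rZ31 (red hs x) = 0 := by
  have hpos : 0 < x.2 0 ^ 2 + x.2 1 ^ 2 := lt_of_le_of_ne (by positivity) hx.symm
  have hr : rho x ^ 2 = x.2 0 ^ 2 + x.2 1 ^ 2 := Real.sq_sqrt hpos.le
  have hr0 : rho x ≠ 0 := (Real.sqrt_pos.2 hpos).ne'
  have hrc : (rho x : ℂ) ≠ 0 := by exact_mod_cast hr0
  have key : (rho x : ℂ) * Z31 p x = (((x.2 0 ^ 2 + x.2 1 ^ 2) * x.1 2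
      - ((x.1 0 * x.2 0 + x.1 1 * x.2 1) * x.2 2 + 2 * p.a ^ 2 * p.e1 * x.2 1) : ℝ) : ℂ) := by
    rw [Z31, mul_sub, ← mul_assoc, ← mul_assoc, mul_one_div_cancel hrc, ← pow_two,
      ← Complex.ofReal_pow, hr, w1, w2, x1, x2]
    push_cast
    linear_combination ((x.1 1 : ℂ) * x.2 1 * x.2 2 + 2 * (p.a : ℂ) ^ 2 * p.e1 * x.2 1)
      * Complex.I_sq
  have key2 : p.e1 ^ 2 * ((x.2 0 ^ 2 + x.2 1 ^ 2) * x.1 2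
      - ((x.1 0 * x.2 0 + x.1 1 * x.2 1) * x.2 2 + 2 * p.a ^ 2 * p.e1 * x.2 1))
      = rZ31 (red hs x) := by
    simp [rG, rZ31, red_apply] at hG ⊢
    linear_combination 2 * p.e1 * x.2 1 * hG
  rw [← key2, mul_eq_zero_iff_left (pow_ne_zero 2 hs)]
  rw [← mul_eq_zero_iff_left hrc, key, Complex.ofReal_eq_zero]

/-- Multiplication by `x₁ x₂` turns the expression into `2 Im (ξ₁ x₂²)`. -/
theorem Z32_eq_zero_iff (p : Params) (hs : p.e1 ≠ 0) {x : Phase}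
    (hG : rG (red hs x) = (p.e1 * p.a) ^ 2) (hx : x.2 0 ^ 2 + x.2 1 ^ 2 ≠ 0) :
    Z32 p x = 0 ↔ rZ32 (p.e0 / p.e1) (red hs x) = 0 := by
  have h1 : p.e0 / p.e1 * p.e1 = p.e0 := by field_simp
  have e1 : Z11 p x = rZ1 (p.e0 / p.e1) (red hs x) := by
    simp [rZ1, Z11, rG, red_apply] at hG ⊢
    linear_combination hG - x.2 0 * h1
  have e2 : Z12 p x = rZ2 (p.e0 / p.e1) (red hs x) := by
    simp [rZ2, Z12, red_apply]
    linear_combination -x.2 1 * h1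
  have hprod : x1 x * x2 x = ((x.2 0 ^ 2 + x.2 1 ^ 2 : ℝ) : ℂ) := by
    rw [x1, x2]
    push_cast
    linear_combination -(x.2 1 : ℂ) ^ 2 * Complex.I_sq
  have hne : x1 x * x2 x ≠ 0 := by
    rw [hprod]; exact_mod_cast hx
  have h1' : x1 x ≠ 0 := left_ne_zero_of_mul hne
  have h2' : x2 x ≠ 0 := right_ne_zero_of_mul hne
  have key : (x1 x * x2 x) * Z32 p x = ((2 * ((x.2 0 ^ 2 - x.2 1 ^ 2) * Z12 p x
      - 2 * x.2 0 * x.2 1 * Z11 p x) : ℝ) : ℂ) := by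
    have : (x1 x * x2 x) * Z32 p x
        = 1 / Complex.I * (x2 x ^ 2 * xi1 p x - x1 x ^ 2 * xi2 p x) := by
      rw [Z32]; field_simp
    rw [this, one_div, Complex.inv_I, x1, x2, xi1, xi2]
    push_cast
    linear_combination (-2 * (x.2 0 : ℂ) ^ 2 * Z12 p x + 4 * (x.2 0 : ℂ) * x.2 1 * Z11 p x
      - 2 * (x.2 1 : ℂ) ^ 2 * Z12 p x * (Complex.I ^ 2 - 1)) * Complex.I_sq
  have key2 : p.e1 ^ 2 * ((x.2 0 ^ 2 - x.2 1 ^ 2) * Z12 p x - 2 * x.2 0 * x.2 1 * Z11 p x)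
      = rZ32 (p.e0 / p.e1) (red hs x) := by
    rw [rZ32, ← e1, ← e2]
    simp [red_apply]
    ring
  rw [← mul_eq_zero_iff_left hne, key, Complex.ofReal_eq_zero, ← key2,
    mul_eq_zero_iff_left (pow_ne_zero 2 hs)]
  simp

theorem subsystem_two (p : Params) (hs : p.e1 ≠ 0) :
    subsystem p 2 = red hs ⁻¹' rsub (p.e0 / p.e1) ((p.e1 * p.a) ^ 2) 2 := by
  have := (red hs).toHomeomorph.preimage_closure
    {u | u.2 0 ^ 2 + u.2 1 ^ 2 ≠ 0 ∧ rG u = (p.e1 * p.a) ^ 2 ∧ rZ31 u = 0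
      ∧ rZ32 (p.e0 / p.e1) u = 0}
  refine Eq.trans ?_ this.symm
  simp only [subsystem]
  congr 1
  ext x
  have hprod : x1 x * x2 x = ((x.2 0 ^ 2 + x.2 1 ^ 2 : ℝ) : ℂ) := by
    rw [x1, x2]
    push_cast
    linear_combination -(x.2 1 : ℂ) ^ 2 * Complex.I_sq
  have hne : x1 x * x2 x ≠ 0 ↔ x.2 0 ^ 2 + x.2 1 ^ 2 ≠ 0 := by
    rw [hprod, ne_eq, ne_eq, Complex.ofReal_eq_zero]
  have hne2 : (red hs x).2 0 ^ 2 + (red hs x).2 1 ^ 2 = p.e1 ^ 2 * (x.2 0 ^ 2 + x.2 1 ^ 2) := by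
    simp [red_apply]; ring
  have hne3 : (red hs x).2 0 ^ 2 + (red hs x).2 1 ^ 2 ≠ 0 ↔ x.2 0 ^ 2 + x.2 1 ^ 2 ≠ 0 := by
    rw [hne2, ne_eq, mul_eq_zero_iff_left (pow_ne_zero 2 hs)]
  change (x ∈ P5 p ∧ x1 x * x2 x ≠ 0 ∧ Z31 p x = 0 ∧ Z32 p x = 0) ↔
    ((red hs x).2 0 ^ 2 + (red hs x).2 1 ^ 2 ≠ 0 ∧ rG (red hs x) = (p.e1 * p.a) ^ 2 ∧
      rZ31 (red hs x) = 0 ∧ rZ32 (p.e0 / p.e1) (red hs x) = 0)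
  rw [rG_red hs, hne, hne3]
  constructor
  · rintro ⟨hG, hx, h1, h2⟩
    exact ⟨hx, hG, (Z31_eq_zero_iff p hs hG hx).1 h1, (Z32_eq_zero_iff p hs hG hx).1 h2⟩
  · rintro ⟨hx, hG, h1, h2⟩
    exact ⟨hG, hx, (Z31_eq_zero_iff p hs hG hx).2 h1, (Z32_eq_zero_iff p hs hG hx).2 h2⟩

theorem subsystem_eq (p : Params) (hs : 0 < p.e1) (h0 : 0 < p.e0) (i : Fin 4) :
    subsystem p i = red hs.ne' ⁻¹' rsub (p.e0 / p.e1) ((p.e1 * p.a) ^ 2) i := by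
  fin_cases i
  exacts [subsystem_zero p hs.ne', subsystem_one p hs h0, subsystem_two p hs.ne',
    subsystem_three p hs.ne']

/-! ### The critical set is the union of the subsystems -/

theorem isCritical_of_relation {e : ℝ} {u : Phase} {B C D : ℝ}
    (h : CriticalRelation e (u.1 0) (u.1 1) (u.1 2) (u.2 0) (u.2 1) (u.2 2) (rZ1 e u) (rZ2 e u)
      B C D) : IsCritical e u := by
  refine ⟨1, B, C, D, Or.inl one_ne_zero, fun w => ?_⟩
  rw [fderiv_rK, fderiv_rZ1, fderiv_rZ2, fderiv_rH, fderiv_rL, fderiv_rG]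
  linear_combination w.1 0 * h.dO1 + w.1 1 * h.dO2 + w.1 2 * h.dr + w.2 0 * h.da1 + w.2 1 * h.da2
    + w.2 2 * h.dz

/-- The coordinate form of a relation of the differentials. -/
theorem IsCritical.coords {e : ℝ} {u : Phase} (h : IsCritical e u) :
    ∃ A B C D : ℝ, (A ≠ 0 ∨ B ≠ 0 ∨ C ≠ 0 ∨ D ≠ 0) ∧
      A * (4 * u.1 0 * rZ1 e u + 4 * u.1 1 * rZ2 e u) + 2 * B * u.1 0 + 2 * C * u.2 0 = 0 ∧
      A * (-4 * u.1 1 * rZ1 e u + 4 * u.1 0 * rZ2 e u) + 2 * B * u.1 1 + 2 * C * u.2 1 = 0 ∧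
      A * (2 * rZ1 e u * u.2 1 - 2 * rZ2 e u * u.2 0) + B * u.1 2 + C * u.2 2 = 0 ∧
      A * (2 * rZ1 e u * (e - 2 * u.2 0) - 2 * rZ2 e u * (u.2 1 + u.1 2)) - B * e
        + 2 * C * u.1 0 + 2 * D * u.2 0 = 0 ∧
      A * (2 * rZ1 e u * u.1 2 + 2 * rZ2 e u * (e - u.2 0)) - B * u.2 1
        + C * (2 * u.1 1 - u.2 2) + 2 * D * u.2 1 = 0 ∧
      -2 * B * u.2 2 + C * (u.1 2 - u.2 1) + 2 * D * u.2 2 = 0 := by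
  obtain ⟨A, B, C, D, hne, h⟩ := h
  simp only [fderiv_rK, fderiv_rZ1, fderiv_rZ2, fderiv_rH, fderiv_rL, fderiv_rG] at h
  have h1 := h (Pi.single 0 1, 0)
  have h2 := h (Pi.single 1 1, 0)
  have h3 := h (Pi.single 2 1, 0)
  have h4 := h (0, Pi.single 0 1)
  have h5 := h (0, Pi.single 1 1)
  have h6 := h (0, Pi.single 2 1)
  simp at h1 h2 h3 h4 h5 h6
  refine ⟨A, B, C, D, hne, ?_, ?_, ?_, ?_, ?_, ?_⟩
  · linear_combination h1
  · linear_combination h2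
  · linear_combination h3
  · linear_combination h4
  · linear_combination h5
  · linear_combination h6

theorem rG_ne_zero_iff {u : Phase} : rG u ≠ 0 ↔ ¬ (u.2 0 = 0 ∧ u.2 1 = 0 ∧ u.2 2 = 0) := by
  rw [not_iff_not, rG]
  constructor
  · intro h
    refine ⟨?_, ?_, ?_⟩ <;> nlinarith [sq_nonneg (u.2 0), sq_nonneg (u.2 1), sq_nonneg (u.2 2)]
  · rintro ⟨h1, h2, h3⟩
    rw [h1, h2, h3]; ring

theorem IsCritical.alternative {e : ℝ} {u : Phase} (he : 0 < e) (hG : rG u ≠ 0)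
    (h : IsCritical e u) :
    CriticalAlternative e (u.1 0) (u.1 1) (u.1 2) (u.2 0) (u.2 1) (u.2 2) (rZ1 e u)
      (rZ2 e u) := by
  obtain ⟨A, B, C, D, hne, h1, h2, h3, h4, h5, h6⟩ := h.coords
  by_cases hA : A = 0
  · subst hA
    by_cases hB : B = 0
    · exfalso
      subst hB
      by_cases hC : C = 0
      · subst hC
        have hD : D ≠ 0 := by simpa using hne
        apply rG_ne_zero_iff.1 hG
        have k4 : 2 * D * u.2 0 = 0 := by linear_combination h4
        have k5 : 2 * D * u.2 1 = 0 := by linear_combination h5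
        have k6 : 2 * D * u.2 2 = 0 := by linear_combination h6
        simpa [hD] using And.intro k4 (And.intro k5 k6)
      · apply rG_ne_zero_iff.1 hG
        have k4 : 2 * C * u.2 0 = 0 := by linear_combination h1
        have k5 : 2 * C * u.2 1 = 0 := by linear_combination h2
        have k6 : 2 * C * u.2 2 = 0 := by linear_combination 2 * h3
        simpa [hC] using And.intro k4 (And.intro k5 k6)
    · refine criticalAlternative_of_energy (C := C / B) (D := D / B) he rfl rfl ?_ ?_ ?_ ?_ ?_ ?_
      · field_simp; linear_combination h1 / 2
      · field_simp; linear_combination h2 / 2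
      · field_simp; linear_combination h3
      · field_simp; linear_combination h4
      · field_simp; linear_combination h5
      · field_simp; linear_combination h6
  · refine CriticalRelation.alternative (B := B / A) (C := C / A) (D := D / A)
      ⟨rfl, rfl, ?_, ?_, ?_, ?_, ?_, ?_⟩ he hG
    · field_simp; linear_combination h1
    · field_simp; linear_combination h2
    · field_simp; linear_combination h3
    · field_simp; linear_combination h4
    · field_simp; linear_combination h5
    · field_simp; linear_combination h6

theorem isCritical_of_mem_rsub {e g : ℝ} (he : 0 < e) {u : Phase} {i : Fin 4}
    (h : u ∈ rsub e g i) : IsCritical e u := by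
  fin_cases i
  · obtain ⟨-, h1, h2⟩ := h
    refine ⟨1, 0, 0, 0, Or.inl one_ne_zero, fun w => ?_⟩
    rw [fderiv_rK, h1, h2]; ring
  · obtain ⟨-, h1, h2⟩ := h
    obtain ⟨B, C, D, hr⟩ := CriticalRelation.of_second (z := u.2 2) he
      (Z1 := rZ1 e u) (Z2 := rZ2 e u) rfl rfl h1 h2
    exact isCritical_of_relation hr
  · refine closure_minimal ?_ (isClosed_isCritical e) h
    rintro v ⟨hv, -, h1, h2⟩
    obtain ⟨B, C, D, hr⟩ := CriticalRelation.of_third hv (Z1 := rZ1 e v) (Z2 := rZ2 e v) rfl rfl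
      (sub_eq_zero.1 h1) h2
    exact isCritical_of_relation hr
  · obtain ⟨-, h1, h2⟩ := h
    have h1' : u.1 1 = u.2 2 := sub_eq_zero.1 h1
    obtain ⟨B, C, D, hr⟩ := CriticalRelation.of_fourth (e := e) (O1 := u.1 0) (r := u.1 2)
      (a1 := u.2 0) (a2 := u.2 1) (z := u.2 2) (Z1 := rZ1 e u) (Z2 := rZ2 e u)
      (by rw [rZ1, h1']) (by rw [rZ2, h1']) h2
    rw [← h1'] at hr
    refine isCritical_of_relation (B := B) (C := C) (D := D) ?_
    rw [← h1']
    exact hr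

/-- Here `O` is split into the component `q` along the horizontal part of `α` and the component `t`
across it; the factor `ρ²`, which degenerates at the pole, separates. -/
theorem rZ32_polar {e ρ c σ q t r z : ℝ} (hN : c ^ 2 + σ ^ 2 = 1) :
    rZ32 e (![q * c - t * σ, q * σ + t * c, r], ![ρ * c, ρ * σ, z])
      = ρ ^ 2 * (2 * q * t - ρ * (σ * (e - ρ * c) + r * c)) := by
  simp [rZ32, rZ1, rZ2]
  linear_combination (ρ ^ 2 * (2 * q * t) * (c ^ 2 + σ ^ 2 + 1)
    - ρ ^ 3 * (σ * (e - ρ * c) + r * c)) * hN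

/-- Critical points with `α₁ = α₂ = 0` are limits of points of the third subsystem. -/
theorem pole_mem_rsub_two {e g : ℝ} (he : 0 < e) {u : Phase} (hg : 0 < g) (hG : rG u = g)
    (h1 : u.2 0 = 0) (h2 : u.2 1 = 0) (hO : u.1 0 ^ 2 + u.1 1 ^ 2 ≠ 0)
    (h : e * u.2 2 * u.1 0 - u.1 2 * u.2 2 * u.1 1 + (u.1 0 ^ 2 + u.1 1 ^ 2) * u.1 2 = 0) :
    u ∈ rsub e g 2 := by
  obtain ⟨W, hW⟩ : ∃ W, W = u.1 0 ^ 2 + u.1 1 ^ 2 := ⟨_, rfl⟩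
  have hW0 : 0 < W := hW ▸ lt_of_le_of_ne (by positivity) hO.symm
  obtain ⟨t, ht⟩ : ∃ t, t = √W := ⟨_, rfl⟩
  have ht0 : 0 < t := ht ▸ Real.sqrt_pos.2 hW0
  have htW : t ^ 2 = W := ht ▸ Real.sq_sqrt hW0.le
  -- The direction `(c, σ)` from which the pole is approached is perpendicular to `O`: the first
  -- relation forces the component of `O` along `α` to vanish in the limit.
  obtain ⟨σ, hσ⟩ : ∃ σ, σ = -u.1 0 / t := ⟨_, rfl⟩
  obtain ⟨c, hc⟩ : ∃ c, c = u.1 1 / t := ⟨_, rfl⟩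
  have hO1 : u.1 0 = -t * σ := by rw [hσ]; field_simp
  have hO2 : u.1 1 = t * c := by rw [hc]; field_simp
  have hN : c ^ 2 + σ ^ 2 = 1 := by
    rw [hσ, hc]; field_simp; linarith
  have hz2 : u.2 2 ^ 2 = g := by rw [← hG, rG, h1, h2]; ring
  have hz : u.2 2 ≠ 0 := by
    intro h0
    rw [h0] at hz2
    linarith
  -- The hypothesis `h` is the limit at `ρ = 0` of the equation for `tf` below.
  have hcond : u.1 2 * t = u.2 2 * (e * σ + u.1 2 * c) := by
    rw [← hW, ← htW, hO1, hO2] at h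
    apply mul_left_cancel₀ ht0.ne'
    linear_combination h
  -- A curve with `α = (ρ c, ρ σ, z)` and constant `r` is built. The level of `Γ` determines `z = zf
  -- ρ`, the first relation determines `q = qf ρ`, and the second one is then a linear equation for
  -- `t = tf ρ`.
  obtain ⟨zf, hzf⟩ : ∃ zf : ℝ → ℝ, zf = fun ρ => u.2 2 * √(1 - ρ ^ 2 / g) := ⟨_, rfl⟩
  have hzc : Continuous zf := by rw [hzf]; fun_prop
  have hz0 : zf 0 = u.2 2 := by simp [hzf]
  have hzsq : ∀ᶠ ρ in nhds (0 : ℝ), zf ρ ^ 2 = g - ρ ^ 2 := by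
    have : ∀ᶠ ρ in nhds (0 : ℝ), 0 < 1 - ρ ^ 2 / g :=
      (Continuous.continuousAt (by fun_prop)).eventually_const_lt (by simp)
    filter_upwards [this] with ρ hρ
    rw [hzf]
    simp only
    rw [mul_pow, Real.sq_sqrt hρ.le, hz2]
    field_simp
  have hzne : ∀ᶠ ρ in nhds (0 : ℝ), zf ρ ≠ 0 :=
    hzc.continuousAt.eventually_ne (by rw [hz0]; exact hz)
  obtain ⟨tf, htc, htf0, htf⟩ : ∃ tf : ℝ → ℝ, ContinuousAt tf 0 ∧ tf 0 = t ∧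
      ∀ᶠ ρ in nhds (0 : ℝ), (u.1 2 - ρ * σ) * tf ρ
        = zf ρ * (e * σ + u.1 2 * c - ρ * σ * c) := by
    -- For `r = 0` the coefficient of `tf` vanishes at `ρ = 0`, but then `σ = 0` and the equation is
    -- void, so a constant will do.
    by_cases hr : u.1 2 = 0
    · have hσ0 : σ = 0 := by
        rw [hr] at hcond
        have : u.2 2 * e * σ = 0 := by linear_combination -hcond
        simpa [hz, he.ne'] using this
      exact ⟨fun _ => t, continuousAt_const, rfl, Filter.Eventually.of_forall fun ρ => by
        rw [hr, hσ0]; ring⟩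
    · have hne : ∀ᶠ ρ in nhds (0 : ℝ), u.1 2 - ρ * σ ≠ 0 :=
        ContinuousAt.eventually_ne (by fun_prop) (by simpa using hr)
      refine ⟨fun ρ => zf ρ * (e * σ + u.1 2 * c - ρ * σ * c) / (u.1 2 - ρ * σ), ?_, ?_, ?_⟩
      · refine ContinuousAt.div ?_ (by fun_prop) (by simpa using hr)
        exact (hzc.mul (by fun_prop)).continuousAt
      · simp only [hz0]
        rw [div_eq_iff (by simpa using hr)]
        linear_combination -hcond
      · filter_upwards [hne] with ρ hρ
        field_simp
  obtain ⟨qf, hqf⟩ : ∃ qf : ℝ → ℝ, qf = fun ρ => ρ * (u.1 2 - ρ * σ) / (2 * zf ρ) := ⟨_, rfl⟩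
  have hqc : ContinuousAt qf 0 := by
    rw [hqf]
    refine ContinuousAt.div (by fun_prop) (hzc.continuousAt.const_mul 2 |>.congr ?_) ?_
    · exact Filter.Eventually.of_forall fun _ => rfl
    · rw [hz0]; simpa using hz
  have hq0 : qf 0 = 0 := by simp [hqf]
  obtain ⟨γ, hγ⟩ : ∃ γ : ℝ → Phase, γ = fun ρ => (![qf ρ * c - tf ρ * σ, qf ρ * σ + tf ρ * c,
    u.1 2], ![ρ * c, ρ * σ, zf ρ]) := ⟨_, rfl⟩
  have hγ0 : γ 0 = u := by
    rw [hγ]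
    apply phase_ext <;> simp [hq0, htf0, hz0, h1, h2, hO1, hO2]
  have hγc : ContinuousAt γ 0 := by
    rw [hγ]
    refine ContinuousAt.prodMk (continuousAt_pi.2 fun i => ?_) (continuousAt_pi.2 fun i => ?_)
    · fin_cases i
      · exact (hqc.mul continuousAt_const).sub (htc.mul continuousAt_const)
      · exact (hqc.mul continuousAt_const).add (htc.mul continuousAt_const)
      · exact continuousAt_const
    · fin_cases i
      · exact continuousAt_id.mul continuousAt_const
      · exact continuousAt_id.mul continuousAt_const
      · exact hzc.continuousAt
  have hlim : Filter.Tendsto γ (nhdsWithin 0 (Set.Ioi 0)) (nhds u) := by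
    have := hγc.tendsto
    rw [hγ0] at this
    exact this.mono_left nhdsWithin_le_nhds
  refine mem_closure_of_tendsto hlim ?_
  filter_upwards [self_mem_nhdsWithin, nhdsWithin_le_nhds hzsq, nhdsWithin_le_nhds hzne,
    nhdsWithin_le_nhds htf] with ρ hρ e1 e2 e3
  have hρ0 : ρ ≠ 0 := (Set.mem_Ioi.1 hρ).ne'
  have e4 : 2 * qf ρ * zf ρ = ρ * (u.1 2 - ρ * σ) := by rw [hqf]; field_simp
  rw [hγ]
  refine ⟨?_, ?_, ?_, ?_⟩
  · have : (ρ * c) ^ 2 + (ρ * σ) ^ 2 = ρ ^ 2 := by linear_combination ρ ^ 2 * hN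
    simp [this, hρ0]
  · simp [rG]
    linear_combination e1 + ρ ^ 2 * hN
  · simp [rZ31]
    linear_combination (ρ ^ 2 * (u.1 2 - ρ * σ) - 2 * ρ * qf ρ * zf ρ) * hN - ρ * e4
  · rw [rZ32_polar hN]
    apply mul_eq_zero_of_right
    apply mul_left_cancel₀ e2
    linear_combination tf ρ * e4 + ρ * e3

theorem isCritical_iff {e g : ℝ} (he : 0 < e) (hg : 0 < g) {u : Phase} (hG : rG u = g) :
    IsCritical e u ↔ ∃ i, u ∈ rsub e g i := by
  constructor
  · intro h
    rcases h.alternative he (by rw [hG]; exact hg.ne') with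
      ⟨h1, h2⟩ | ⟨h1, h2⟩ | ⟨hR, h1, h2⟩ | ⟨h1, h2⟩ | ⟨h1, h2, hO, h3⟩
    · exact ⟨0, hG, h1, h2⟩
    · exact ⟨1, hG, h1, h2⟩
    · exact ⟨2, (mem_rsub_two_iff hR).2 ⟨hG, sub_eq_zero.2 h1, h2⟩⟩
    · exact ⟨3, hG, sub_eq_zero.2 h1, h2⟩
    · exact ⟨2, pole_mem_rsub_two he hg hG h1 h2 hO h3⟩
  · rintro ⟨i, hi⟩
    exact isCritical_of_mem_rsub he hi

theorem rG_of_mem_rsub {e g : ℝ} {u : Phase} {i : Fin 4} (h : u ∈ rsub e g i) : rG u = g := by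
  fin_cases i
  · exact h.1
  · exact h.1
  · have hc : IsClosed {u | rG u = g} :=
      isClosed_eq (contDiff_rG (n := 0)).continuous continuous_const
    exact closure_minimal (fun v hv => hv.2.1) hc h
  · exact h.1

theorem criticalSet_eq_iUnion (p : Params) (ha : 0 < p.a) (h0 : 0 < p.e0) (h1 : 0 < p.e1) :
    criticalSet p = ⋃ i : Fin 4, subsystem p i := by
  ext x
  have he : 0 < p.e0 / p.e1 := by positivity
  have hg : 0 < (p.e1 * p.a) ^ 2 := by positivity
  rw [mem_criticalSet_iff p h1.ne' ha.ne', rG_red h1.ne', Set.mem_iUnion]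
  simp only [subsystem_eq p h1 h0, Set.mem_preimage]
  constructor
  · rintro ⟨hG, hx⟩
    exact (isCritical_iff he hg hG).1 hx
  · rintro ⟨i, hi⟩
    have hG := rG_of_mem_rsub hi
    exact ⟨hG, (isCritical_iff he hg hG).2 ⟨i, hi⟩⟩

/-! ### Characteristic polynomials of operators of low rank -/

/-- The characteristic polynomial of an operator on `ℝ⁶` which factors through `ℝᵐ`. -/
theorem charpoly_of_factors {m : ℕ} (hm : m ≤ 6) {A : Module.End ℝ Phase} {V : Fin m → Phase →ₗ[ℝ] ℝ}
    {U : Fin m → Phase} (h : ∀ v, A v = ∑ k, V k v • U k) :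
    A.charpoly = X ^ (6 - m) * (Matrix.of fun i j => V i (U j)).charpoly := by
  let b := Module.finBasis ℝ Phase
  have hd : Module.finrank ℝ Phase = 6 := by simp [Phase]
  let B : Matrix (Fin (Module.finrank ℝ Phase)) (Fin m) ℝ := Matrix.of fun i k => b.repr (U k) i
  let D : Matrix (Fin m) (Fin (Module.finrank ℝ Phase)) ℝ := Matrix.of fun k j => V k (b j)
  have h1 : LinearMap.toMatrix b b A = B * D := by
    ext i j
    rw [LinearMap.toMatrix_apply, h, Matrix.mul_apply]
    simp [B, D, mul_comm]
  have h2 : D * B = Matrix.of fun i j => V i (U j) := by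
    ext i j
    rw [Matrix.mul_apply]
    conv_rhs => rw [Matrix.of_apply, ← b.sum_repr (U j), map_sum]
    simp [B, D, mul_comm]
  -- The products `B * D` and `D * B` have the same characteristic polynomial up to a power of `X`.
  rw [← LinearMap.charpoly_toMatrix A b, h1, Matrix.charpoly_mul_comm_of_le _ _ (by simp [hd, hm]),
    h2]
  simp [hd]

theorem charpoly_fin_four_of_block (M : Matrix (Fin 4) (Fin 4) ℝ)
    (h02 : M 0 2 = 0) (h03 : M 0 3 = 0) (h12 : M 1 2 = 0) (h13 : M 1 3 = 0)
    (h20 : M 2 0 = 0) (h21 : M 2 1 = 0) (h30 : M 3 0 = 0) (h31 : M 3 1 = 0)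
    (h11 : M 1 1 = -M 0 0) (h33 : M 3 3 = -M 2 2) :
    M.charpoly = (X ^ 2 - C (M 0 0 ^ 2 + M 0 1 * M 1 0)) * (X ^ 2 - C (M 2 2 ^ 2 + M 2 3 * M 3 2)) := by
  rw [Matrix.charpoly, Matrix.det_succ_row_zero]
  simp [Fin.sum_univ_succ, Matrix.det_fin_three, Matrix.charmatrix_apply, Fin.succAbove, h02, h03, h12, h13, h20, h21,
    h30, h31, h11, h33]
  ring

/-- The characteristic polynomial of a sum of two operators of rank two, whose images lie in the
kernels of each other. -/
theorem charpoly_block {A : Module.End ℝ Phase} {f1 f2 f3 f4 : Phase →ₗ[ℝ] ℝ}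
    {U1 U2 U3 U4 : Phase} {c d : ℝ}
    (h : ∀ v, A v = c • (f1 v • U1 + f2 v • U2) + d • (f3 v • U3 + f4 v • U4))
    (h13 : f1 U3 = 0) (h14 : f1 U4 = 0) (h23 : f2 U3 = 0) (h24 : f2 U4 = 0)
    (h31 : f3 U1 = 0) (h32 : f3 U2 = 0) (h41 : f4 U1 = 0) (h42 : f4 U2 = 0)
    (h22 : f2 U2 = -f1 U1) (h44 : f4 U4 = -f3 U3) :
    A.charpoly = X ^ 2 * ((X ^ 2 - C (c ^ 2 * (f1 U1 ^ 2 + f1 U2 * f2 U1)))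
      * (X ^ 2 - C (d ^ 2 * (f3 U3 ^ 2 + f3 U4 * f4 U3)))) := by
  rw [charpoly_of_factors (m := 4) (by norm_num) (V := ![f1, f2, f3, f4])
    (U := ![c • U1, c • U2, d • U3, d • U4]), charpoly_fin_four_of_block]
  · simp
    ring
  all_goals first | (simp [h13, h14, h23, h24, h31, h32, h41, h42, h22, h44]; done) | skip
  intro v
  rw [h v]
  simp [Fin.sum_univ_succ, smul_smul, mul_comm, add_assoc]

/-! ### Eigenvalues and types -/

theorem redCharpoly_of_charpoly {A : Module.End ℝ Phase} {q : ℝ[X]} (h : A.charpoly = X ^ 2 * q) :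
    redCharpoly A = q := by
  have hx : ∀ r : ℝ[X], (X * r).divX = r := fun r => by
    ext n; rw [coeff_divX, coeff_X_mul]
  rw [redCharpoly, h, pow_two, mul_assoc, hx, hx]

theorem eigs_of_charpoly {A : Module.End ℝ Phase} {α β : ℝ} {x y : ℂ}
    (h : A.charpoly = X ^ 2 * ((X ^ 2 - C α) * (X ^ 2 - C β))) (hx : x ^ 2 = α) (hy : y ^ 2 = β) :
    eigs A = {x, -x, y, -y} := by
  rw [eigs, redCharpoly_of_charpoly h]
  have : ((X ^ 2 - C α) * (X ^ 2 - C β) : ℝ[X]).map (algebraMap ℝ ℂ)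
      = (({x, -x, y, -y} : Multiset ℂ).map fun a => X - C a).prod := by
    simp only [Polynomial.map_mul, Polynomial.map_sub, Polynomial.map_pow, map_X, map_C,
      Complex.coe_algebraMap, ← hx, ← hy, Multiset.insert_eq_cons, Multiset.map_cons,
      Multiset.map_singleton, Multiset.prod_cons, Multiset.prod_singleton, map_neg, map_pow]
    ring
  rw [this, roots_multiset_prod_X_sub_C]

/-- The eigenvalues are `±x`, `±y` with `x² = α`, `y² = β`, so any of the three excluded equalities
produces a repeated one. -/
theorem eigs_nodup {A : Module.End ℝ Phase} {α β : ℝ}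
    (h : A.charpoly = X ^ 2 * ((X ^ 2 - C α) * (X ^ 2 - C β))) (hn : (eigs A).Nodup) :
    α ≠ 0 ∧ β ≠ 0 ∧ α ≠ β := by
  obtain ⟨x, hx⟩ := IsAlgClosed.exists_pow_nat_eq (α : ℂ) two_pos
  obtain ⟨y, hy⟩ := IsAlgClosed.exists_pow_nat_eq (β : ℂ) two_pos
  rw [eigs_of_charpoly h hx hy] at hn
  refine ⟨?_, ?_, ?_⟩
  · rintro rfl
    have : x = 0 := by simpa using hx
    subst this
    simp at hn
  · rintro rfl
    have : y = 0 := by simpa using hy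
    subst this
    simp at hn
  · rintro rfl
    rw [← hx] at hy
    rcases sq_eq_sq_iff_eq_or_eq_neg.1 hy with rfl | rfl <;> simp at hn

theorem exists_sq_of_signOf {t : ExtType} {α : ℝ} (h : t.SignOf α) : ∃ r : ℝ, r ≠ 0 ∧
    α = match t with
      | .center => -r ^ 2
      | .saddle => r ^ 2 := by
  cases t
  · refine ⟨√(-α), (Real.sqrt_pos.2 (neg_pos.2 h)).ne', ?_⟩
    simp [Real.sq_sqrt (neg_pos.2 h).le]
  · exact ⟨√α, (Real.sqrt_pos.2 h).ne', (Real.sq_sqrt (le_of_lt h)).symm⟩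

theorem eigsHaveType_combine {A : Module.End ℝ Phase} {α β : ℝ} {s t : ExtType}
    (h : A.charpoly = X ^ 2 * ((X ^ 2 - C α) * (X ^ 2 - C β)))
    (hs : s.SignOf α) (ht : t.SignOf β) : EigsHaveType (eigs A) (combine s t) := by
  obtain ⟨q, hq, hα⟩ := exists_sq_of_signOf hs
  obtain ⟨r, hr, hβ⟩ := exists_sq_of_signOf ht
  have hc : ∀ r : ℝ, ((r : ℂ) * Complex.I) ^ 2 = ((-r ^ 2 : ℝ) : ℂ) := fun r => by
    rw [mul_pow, Complex.I_sq]; push_cast; ring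
  have hd : ∀ r : ℝ, (r : ℂ) ^ 2 = ((r ^ 2 : ℝ) : ℂ) := fun r => by push_cast; ring
  cases s <;> cases t <;> simp only at hα hβ <;> subst hα hβ
  · rw [eigs_of_charpoly h (hc q) (hc r)]
    simp [combine, EigsHaveType]
  · rw [eigs_of_charpoly h (hc q) (hd r)]
    exact ⟨q, r, hq, hr, rfl⟩
  · rw [eigs_of_charpoly h (hd q) (hc r)]
    refine ⟨r, q, hr, hq, ?_⟩
    simp only [Multiset.insert_eq_cons, ← Multiset.singleton_add]
    abel
  · rw [eigs_of_charpoly h (hd q) (hd r)]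
    simp [combine, EigsHaveType]

theorem exists_signOf {c : ℝ} (h : c ≠ 0) : ∃ t : ExtType, t.SignOf c := by
  rcases lt_or_gt_of_ne h with h | h
  exacts [⟨.center, h⟩, ⟨.saddle, h⟩]

theorem ExtType.SignOf.mul_sq {t : ExtType} {c d : ℝ} (h : t.SignOf c) (hd : d ≠ 0) :
    t.SignOf (d ^ 2 * c) := by
  cases t
  · exact mul_neg_of_pos_of_neg (by positivity) h
  · exact mul_pos (by positivity) h

/-! ### The symplectic operators in the reduced coordinates -/

/-- The linearization of the field of `rH`. -/
def opH (e : ℝ) (u : Phase) : Module.End ℝ Phase := (fderiv ℝ (rXH e) u : Phase →ₗ[ℝ] Phase)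

/-- The linearization of the field of `rK`. -/
def opK (e : ℝ) (u : Phase) : Module.End ℝ Phase := (fderiv ℝ (rXK e) u : Phase →ₗ[ℝ] Phase)

/-- The coefficient `σ` for which the symplectic operator of the `i`-th subsystem at an
equilibrium is `opK - σ • opH`. -/
def extCoeff (e : ℝ) (u : Phase) : Fin 4 → ℝ
  | 0 => 0
  | 1 => 2 * (rH e u + rG u) + e ^ 2
  | 2 => 2 * (rH e u + rG u) - rL u ^ 2 / rG u
  | 3 => 2 * (rH e u + rG u - ((u.1 2 ^ 2 - u.2 1 ^ 2) / 2 - e * u.2 0))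

theorem linOp_H (p : Params) (hs : p.e1 ≠ 0) (x : Phase) :
    linOp (H p) x = (red hs).symm.toLinearEquiv.conj (opH (p.e0 / p.e1) (red hs x)) :=
  linOp_conj hs (sgrad_H p hs) (differentiable_rXH _) x

theorem linOp_K (p : Params) (hs : p.e1 ≠ 0) (x : Phase) :
    linOp (K p) x = (red hs).symm.toLinearEquiv.conj (opK (p.e0 / p.e1) (red hs x)) :=
  linOp_conj hs (sgrad_K p hs) (differentiable_rXK _) x

/-- This form covers all four generating functions. Since `L` is a Casimir function, the field is
`rXK - c • rXH` with a variable coefficient `c`; at a zero of `rXH` the derivative of `c` drops out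
of the linearization and only its value `σ` remains. -/
theorem linOp_quadratic {s : ℝ} (hs : s ≠ 0) {f : Phase → ℝ} {e σ κ τ B k : ℝ} {x : Phase}
    (h : rXH e (red hs x) = 0)
    (hf : ∀ y, f y = rK e (red hs y) - κ * rH e (red hs y)
      - τ * (rH e (red hs y) + B - k * rL (red hs y) ^ 2) ^ 2)
    (hσ : σ = κ + 2 * τ * (rH e (red hs x) + B - k * rL (red hs x) ^ 2)) :
    linOp f x = (red hs).symm.toLinearEquiv.conj (opK e (red hs x) - σ • opH e (red hs x)) := by
  obtain rfl := funext hf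
  rw [hσ]
  let c : Phase → ℝ := fun u => κ + 2 * τ * (rH e u + B - k * rL u ^ 2)
  let F : Phase → ℝ := fun u => rK e u - κ * rH e u - τ * (rH e u + B - k * rL u ^ 2) ^ 2
  have hc : Differentiable ℝ c := by fun_prop
  have hF : Differentiable ℝ F := by fun_prop
  have hd : ∀ u, fderiv ℝ F u = fderiv ℝ (rK e) u + (-c u) • fderiv ℝ (rH e) u
      + (4 * τ * k * rL u * (rH e u + B - k * rL u ^ 2)) • fderiv ℝ rL u := by
    intro u
    refine ContinuousLinearMap.ext fun v => ?_
    simp only [F, c]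
    simp (disch := fun_prop) only [fderiv_fun_add, fderiv_fun_sub, fderiv_fun_pow,
      fderiv_const_mul, fderiv_fun_const]
    simp
    ring
  have hX : ∀ u, ham u (fderiv ℝ F u) = rXK e u + (-c u) • rXH e u := by
    intro u
    rw [hd, ham_add, ham_add, ham_smul, ham_smul, ham_rK, ham_rH, ham_rL, smul_zero, add_zero]
  have hDX : Differentiable ℝ (fun u => rXK e u + (-c u) • rXH e u) := by fun_prop
  have key := linOp_conj hs (f := fun y => F (red hs y))
    (X := fun u => rXK e u + (-c u) • rXH e u)
    (fun y => by rw [sgrad_comp_red hs hF, hX]) hDX x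
  refine key.trans ?_
  congr 1
  refine LinearMap.ext fun v => ?_
  simp only [ContinuousLinearMap.coe_coe]
  rw [fderiv_fun_add (by fun_prop) (by fun_prop), fderiv_fun_smul (by fun_prop) (by fun_prop)]
  simp [h, opH, opK, c, sub_eq_add_neg]
  module

theorem extOp_eq (p : Params) (hs : p.e1 ≠ 0) (ha : p.a ≠ 0) {x : Phase} (hx : x ∈ P5 p)
    (h : rXH (p.e0 / p.e1) (red hs x) = 0) (i : Fin 4) :
    extOp p i x = (red hs).symm.toLinearEquiv.conj (opK (p.e0 / p.e1) (red hs x)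
      - extCoeff (p.e0 / p.e1) (red hs x) i • opH (p.e0 / p.e1) (red hs x)) := by
  have hG := (rG_red hs).1 hx
  have fH : ∀ y, H p y = rH (p.e0 / p.e1) (red hs y) := congrFun (H_eq p hs)
  have fK : ∀ y, K p y = rK (p.e0 / p.e1) (red hs y) := congrFun (K_eq p hs)
  have fL : ∀ y, L y = (2 * p.e1)⁻¹ * rL (red hs y) := congrFun (L_eq hs)
  fin_cases i
  · refine linOp_quadratic hs (κ := 0) (τ := 0) (B := 0) (k := 0) h (fun y => ?_) ?_
    · simp [genFun, fK]
    · simp [extCoeff]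
  · refine linOp_quadratic hs (κ := 0) (τ := 1)
      (B := (p.e1 * p.a) ^ 2 + (p.e0 / p.e1) ^ 2 / 2) (k := 0) h (fun y => ?_) ?_
    · simp only [genFun, fK, fH, fL]
      field_simp
      ring
    · simp only [extCoeff, hG]
      ring
  · refine linOp_quadratic hs (κ := 0) (τ := 1)
      (B := (p.e1 * p.a) ^ 2) (k := (2 * (p.e1 * p.a) ^ 2)⁻¹) h (fun y => ?_) ?_
    · simp only [genFun, fK, fH, fL]
      field_simp
      ring
    · simp only [extCoeff, hG]
      field_simp
      ring
  · refine linOp_quadratic hs (κ := 2 * (H p x + p.e1 ^ 2 * p.a ^ 2 - S p x)) (τ := 0)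
      (B := 0) (k := 0) h (fun y => ?_) ?_
    · simp [genFun, fK, fH]
    · simp only [extCoeff, hG, fH, S]
      simp [red_apply]
      field_simp
      ring

/-! ### Pairs of branches at an equilibrium -/

/-- The structure of the `i`-th subsystem at the equilibrium `u`: its symplectic operator is
`f ⊗ U + g ⊗ W`, and `f`, `g` generate the differentials of its two relations. -/
structure Branch (e : ℝ) (u : Phase) (i : Fin 4) (f g : Phase →ₗ[ℝ] ℝ) (U W : Phase) : Prop where
  op : ∀ v, opK e u v = extCoeff e u i • opH e u v + (f v • U + g v • W)
  trace : g W = -f U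
  dA : ∃ m, m ≠ 0 ∧ ∀ v, fderiv ℝ (relA e i) u v = m * f v
  dB : ∃ m n, n ≠ 0 ∧ ∀ v, fderiv ℝ (relB e i) u v = m * f v + n * g v
  L_left : fderiv ℝ rL u U = 0
  L_right : fderiv ℝ rL u W = 0
  G_left : fderiv ℝ rG u U = 0
  G_right : fderiv ℝ rG u W = 0

/-- Two transversal branches at the equilibrium `u`. -/
structure BranchPair (e : ℝ) (u : Phase) (i j : Fin 4) (f1 f2 f3 f4 : Phase →ₗ[ℝ] ℝ)
    (U1 U2 U3 U4 : Phase) : Prop where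
  left : Branch e u i f1 f2 U1 U2
  right : Branch e u j f3 f4 U3 U4
  c13 : f1 U3 = 0
  c14 : f1 U4 = 0
  c23 : f2 U3 = 0
  c24 : f2 U4 = 0
  c31 : f3 U1 = 0
  c32 : f3 U2 = 0
  c41 : f4 U1 = 0
  c42 : f4 U2 = 0
  ne : extCoeff e u i ≠ extCoeff e u j

/-- On the span of `U`, `W` the pair `(f, g)` has a trace-free matrix with determinant `-(f U² + f W
* g U)`. The same number is the external eigenvalue squared, so a nonzero eigenvalue makes the two
relations independent. -/
theorem Branch.solve {e : ℝ} {u : Phase} {i : Fin 4} {f g : Phase →ₗ[ℝ] ℝ} {U W : Phase}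
    (h : Branch e u i f g U W) (hl : f U ^ 2 + f W * g U ≠ 0) (a b : ℝ) :
    ∃ s t : ℝ, fderiv ℝ (relA e i) u (s • U + t • W) = a ∧
      fderiv ℝ (relB e i) u (s • U + t • W) = b := by
  obtain ⟨m, hm, hA⟩ := h.dA
  obtain ⟨k, n, hn, hB⟩ := h.dB
  have key : ∀ a b : ℝ, ∃ s t : ℝ, f (s • U + t • W) = a ∧ g (s • U + t • W) = b := by
    intro a b
    refine ⟨(a * f U + b * f W) / (f U ^ 2 + f W * g U),
      (a * g U - b * f U) / (f U ^ 2 + f W * g U), ?_, ?_⟩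
    · simp only [map_add, map_smul, smul_eq_mul]
      field_simp
      ring
    · simp only [map_add, map_smul, smul_eq_mul, h.trace]
      field_simp
      ring
  obtain ⟨s, t, h1, h2⟩ := key (a / m) ((b - k * (a / m)) / n)
  refine ⟨s, t, ?_, ?_⟩
  · rw [hA, h1]; field_simp
  · rw [hB, h1, h2]; field_simp; ring

theorem exists_fderiv_casimirs {u : Phase} (hu : u.2 0 ≠ 0) (a b : ℝ) :
    ∃ v, fderiv ℝ rL u v = a ∧ fderiv ℝ rG u v = b := by
  refine ⟨(![(a - u.1 0 * b / u.2 0) / (2 * u.2 0), 0, 0], ![b / (2 * u.2 0), 0, 0]), ?_, ?_⟩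
  · rw [fderiv_rL]; simp; field_simp; ring
  · rw [fderiv_rG]; simp; field_simp

namespace BranchPair

variable {e : ℝ} {u : Phase} {i j : Fin 4} {f1 f2 f3 f4 : Phase →ₗ[ℝ] ℝ} {U1 U2 U3 U4 : Phase}

/-- The differentials of the relations of both branches and of the Casimir functions are linearly
independent. -/
theorem surjective (h : BranchPair e u i j f1 f2 f3 f4 U1 U2 U3 U4) (hu : u.2 0 ≠ 0)
    (h1 : f1 U1 ^ 2 + f1 U2 * f2 U1 ≠ 0) (h2 : f3 U3 ^ 2 + f3 U4 * f4 U3 ≠ 0)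
    (a b c d k l : ℝ) : ∃ v, fderiv ℝ (relA e i) u v = a ∧ fderiv ℝ (relB e i) u v = b ∧
      fderiv ℝ (relA e j) u v = c ∧ fderiv ℝ (relB e j) u v = d ∧ fderiv ℝ rL u v = k ∧
      fderiv ℝ rG u v = l := by
  -- The values of the Casimir functions are fixed first. The corrections along `U1`, `U2` and along
  -- `U3`, `U4` are tangent to the leaf and do not affect the relations of the other branch.
  obtain ⟨v, hL, hG⟩ := exists_fderiv_casimirs hu k l
  obtain ⟨s, t, hs, ht⟩ := h.left.solve h1 (a - fderiv ℝ (relA e i) u v)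
    (b - fderiv ℝ (relB e i) u v)
  obtain ⟨s', t', hs', ht'⟩ := h.right.solve h2 (c - fderiv ℝ (relA e j) u v)
    (d - fderiv ℝ (relB e j) u v)
  obtain ⟨m, -, hA⟩ := h.left.dA
  obtain ⟨m', n', -, hB⟩ := h.left.dB
  obtain ⟨q, -, hA'⟩ := h.right.dA
  obtain ⟨q', r', -, hB'⟩ := h.right.dB
  refine ⟨v + (s • U1 + t • U2) + (s' • U3 + t' • U4), ?_, ?_, ?_, ?_, ?_, ?_⟩
  · have : fderiv ℝ (relA e i) u (s' • U3 + t' • U4) = 0 := by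
      rw [hA]; simp [h.c13, h.c14]
    rw [map_add, map_add, hs, this]; ring
  · have : fderiv ℝ (relB e i) u (s' • U3 + t' • U4) = 0 := by
      rw [hB]; simp [h.c13, h.c14, h.c23, h.c24]
    rw [map_add, map_add, ht, this]; ring
  · have : fderiv ℝ (relA e j) u (s • U1 + t • U2) = 0 := by
      rw [hA']; simp [h.c31, h.c32]
    rw [map_add, map_add, hs', this]; ring
  · have : fderiv ℝ (relB e j) u (s • U1 + t • U2) = 0 := by
      rw [hB']; simp [h.c31, h.c32, h.c41, h.c42]
    rw [map_add, map_add, ht', this]; ring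
  · simp [hL, h.left.L_left, h.left.L_right, h.right.L_left, h.right.L_right]
  · simp [hG, h.left.G_left, h.left.G_right, h.right.G_left, h.right.G_right]

/-- With `σ ≠ τ` the two coefficients, `c A_H + d A_K` equals `(c + dτ)/(τ - σ)` times `A_K - σ A_H`
plus `(c + dσ)/(σ - τ)` times `A_K - τ A_H`, and these are the two blocks. -/
theorem charpoly_comb (h : BranchPair e u i j f1 f2 f3 f4 U1 U2 U3 U4) (c d : ℝ) :
    (c • opH e u + d • opK e u).charpoly = X ^ 2 *
      ((X ^ 2 - C (((c + d * extCoeff e u j) / (extCoeff e u j - extCoeff e u i)) ^ 2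
        * (f1 U1 ^ 2 + f1 U2 * f2 U1)))
      * (X ^ 2 - C (((c + d * extCoeff e u i) / (extCoeff e u i - extCoeff e u j)) ^ 2
        * (f3 U3 ^ 2 + f3 U4 * f4 U3)))) := by
  refine charpoly_block (fun v => ?_) h.c13 h.c14 h.c23 h.c24 h.c31 h.c32 h.c41 h.c42
    h.left.trace h.right.trace
  have e1 := h.left.op v
  have e2 := h.right.op v
  set σ := extCoeff e u i
  set τ := extCoeff e u j
  have n1 : τ - σ ≠ 0 := sub_ne_zero.2 h.ne.symm
  have n2 : σ - τ ≠ 0 := sub_ne_zero.2 h.ne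
  have e3 : f1 v • U1 + f2 v • U2 = opK e u v - σ • opH e u v := by rw [e1]; abel
  have e4 : f3 v • U3 + f4 v • U4 = opK e u v - τ • opH e u v := by rw [e2]; abel
  rw [e3, e4]
  have n3 : (c + d * σ) / (σ - τ) = -((c + d * σ) / (τ - σ)) := by
    rw [← neg_sub τ σ, div_neg]
  have n4 : (c + d * τ) / (τ - σ) = (c + d * σ) / (τ - σ) + d := by field_simp; ring
  have n5 : c = (c + d * σ) / (τ - σ) * τ - ((c + d * σ) / (τ - σ) + d) * σ := by
    field_simp; ring
  rw [n3, n4]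
  simp only [LinearMap.add_apply, LinearMap.smul_apply, smul_sub, smul_smul]
  conv_lhs => rw [n5]
  module

theorem charpoly_left (h : BranchPair e u i j f1 f2 f3 f4 U1 U2 U3 U4) :
    (opK e u - extCoeff e u i • opH e u).charpoly
      = X ^ 4 * (X ^ 2 - C (f1 U1 ^ 2 + f1 U2 * f2 U1)) := by
  have := h.charpoly_comb (-extCoeff e u i) 1
  have n1 : extCoeff e u j - extCoeff e u i ≠ 0 := sub_ne_zero.2 h.ne.symm
  rw [show opK e u - extCoeff e u i • opH e u = -extCoeff e u i • opH e u + (1 : ℝ) • opK e u by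
    module, this, one_mul, one_mul, neg_add_cancel, neg_add_eq_sub, div_self n1]
  simp
  ring

theorem charpoly_right (h : BranchPair e u i j f1 f2 f3 f4 U1 U2 U3 U4) :
    (opK e u - extCoeff e u j • opH e u).charpoly
      = X ^ 4 * (X ^ 2 - C (f3 U3 ^ 2 + f3 U4 * f4 U3)) := by
  have := h.charpoly_comb (-extCoeff e u j) 1
  have n1 : extCoeff e u i - extCoeff e u j ≠ 0 := sub_ne_zero.2 h.ne
  rw [show opK e u - extCoeff e u j • opH e u = -extCoeff e u j • opH e u + (1 : ℝ) • opK e u by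
    module, this, one_mul, one_mul, neg_add_cancel, neg_add_eq_sub, div_self n1]
  simp
  ring

end BranchPair

/-! ### Smooth pieces of the subsystems -/

/-- A set given near `x` by `m` independent relations is a smooth piece. -/
theorem isSmoothPiece_of_relations {s : ℝ} (hs : s ≠ 0) {m d : ℕ} (hmd : m + d = 6)
    {h : Fin m → Phase → ℝ} (hc : ∀ i, ContDiff ℝ ∞ (h i)) {N O : Set Phase} (hO : IsOpen O)
    {x : Phase} (hx : red hs x ∈ O) (hN : ∀ y, red hs y ∈ O → (y ∈ N ↔ ∀ i, h i (red hs y) = 0))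
    (hxN : x ∈ N) (hsurj : ∀ w : Fin m → ℝ, ∃ v, ∀ i, fderiv ℝ (h i) (red hs x) v = w i)
    {T : Submodule ℝ Phase} (hT : ∀ v, v ∈ T ↔ ∀ i, fderiv ℝ (h i) (red hs x) (red hs v) = 0) :
    IsSmoothPiece N x d T := by
  let G : Phase → Fin m → ℝ := fun y i => h i (red hs y)
  have hG : ∀ n : ℕ, ContDiff ℝ n G := fun n =>
    contDiff_pi.2 fun i => ((hc i).of_le (by exact_mod_cast le_top)).comp (red hs).contDiff
  have hG' : ContDiff ℝ ∞ G := contDiff_pi.2 fun i => (hc i).comp (red hs).contDiff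
  have hd : ∀ y v i, fderiv ℝ G y v i = fderiv ℝ (h i) (red hs y) (red hs v) := by
    intro y v i
    have hi : ∀ i, HasFDerivAt (fun y => h i (red hs y))
        ((fderiv ℝ (h i) (red hs y)).comp (red hs : Phase →L[ℝ] Phase)) y := fun i =>
      (((hc i).differentiable (by simp)) _).hasFDerivAt.comp y (red hs).hasFDerivAt
    have := (hasFDerivAt_pi.2 hi).fderiv
    change fderiv ℝ (fun y i => h i (red hs y)) y v i = _
    rw [this]
    rfl
  have hopen := isOpen_surjective_fderiv (G := G) (by exact_mod_cast hG 1)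
  -- The neighbourhood is cut down to the open set where the relations remain independent.
  refine ⟨hxN, m, hmd, red hs ⁻¹' O ∩ {y | Function.Surjective (fderiv ℝ G y)},
    (hO.preimage (red hs).continuous).inter hopen, ⟨hx, ?_⟩, G, hG'.contDiffOn,
    fun y hy => hy.2, ?_, ?_⟩
  · intro w
    obtain ⟨v, hv⟩ := hsurj w
    refine ⟨(red hs).symm v, funext fun i => ?_⟩
    rw [hd, ContinuousLinearEquiv.apply_symm_apply, hv]
  · ext y
    constructor
    · rintro ⟨hy, hyU⟩
      exact ⟨hyU, funext fun i => (hN y hyU.1).1 hy i⟩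
    · rintro ⟨hyU, hy⟩
      exact ⟨(hN y hyU.1).2 fun i => congrFun hy i, hyU⟩
  · ext v
    rw [hT, LinearMap.mem_ker, ContinuousLinearMap.coe_coe, funext_iff]
    simp only [hd, Pi.zero_apply]

/-- Away from the poles all subsystems are given by their relations. -/
theorem mem_rsub_iff {e g : ℝ} (i : Fin 4) {u : Phase} (hu : u.2 0 ^ 2 + u.2 1 ^ 2 ≠ 0) :
    u ∈ rsub e g i ↔ rG u = g ∧ relA e i u = 0 ∧ relB e i u = 0 := by
  fin_cases i
  exacts [Iff.rfl, Iff.rfl, mem_rsub_two_iff hu, Iff.rfl]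

theorem fderiv_sub_const_apply (f : Phase → ℝ) (c : ℝ) (u v : Phase) :
    fderiv ℝ (fun y => f y - c) u v = fderiv ℝ f u v := by
  rw [fderiv_sub_const]

/-- The common kernel of the differentials of the relations of the `i`-th subsystem. -/
def relKer {s : ℝ} (hs : s ≠ 0) (e : ℝ) (i : Fin 4) (x : Phase) : Submodule ℝ Phase :=
  ((LinearMap.ker (fderiv ℝ (relA e i) (red hs x) : Phase →ₗ[ℝ] ℝ)) ⊓
    (LinearMap.ker (fderiv ℝ (relB e i) (red hs x) : Phase →ₗ[ℝ] ℝ))).comap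
      ((red hs : Phase →L[ℝ] Phase) : Phase →ₗ[ℝ] Phase)

theorem mem_relKer {s : ℝ} (hs : s ≠ 0) {e : ℝ} {i : Fin 4} {x v : Phase} :
    v ∈ relKer hs e i x ↔ fderiv ℝ (relA e i) (red hs x) (red hs v) = 0 ∧
      fderiv ℝ (relB e i) (red hs x) (red hs v) = 0 := Iff.rfl

theorem isOpen_not_pole : IsOpen {u : Phase | u.2 0 ^ 2 + u.2 1 ^ 2 ≠ 0} :=
  isOpen_ne_fun (by fun_prop) continuous_const

theorem isSmoothPiece_subsystem (p : Params) (h0 : 0 < p.e0) (h1 : 0 < p.e1) {i : Fin 4}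
    {x : Phase} (hx : x ∈ subsystem p i)
    (hu : (red h1.ne' x).2 0 ^ 2 + (red h1.ne' x).2 1 ^ 2 ≠ 0)
    (hsurj : ∀ a b c : ℝ, ∃ v, fderiv ℝ (relA (p.e0 / p.e1) i) (red h1.ne' x) v = a ∧
      fderiv ℝ (relB (p.e0 / p.e1) i) (red h1.ne' x) v = b ∧
      fderiv ℝ rG (red h1.ne' x) v = c) :
    IsSmoothPiece (subsystem p i) x 3 (relKer h1.ne' (p.e0 / p.e1) i x ⊓ T5 x) := by
  refine isSmoothPiece_of_relations h1.ne' (m := 3) rfl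
    (h := ![relA (p.e0 / p.e1) i, relB (p.e0 / p.e1) i, fun u => rG u - (p.e1 * p.a) ^ 2])
    (fun k => ?_) isOpen_not_pole hu (fun y hy => ?_) hx (fun w => ?_) (fun v => ?_)
  · fin_cases k
    exacts [contDiff_relA _ i, contDiff_relB _ i, contDiff_rG.sub contDiff_const]
  · rw [subsystem_eq p h1 h0, Set.mem_preimage, mem_rsub_iff i hy]
    simp [Fin.forall_fin_succ, sub_eq_zero]
    tauto
  · obtain ⟨v, ha, hb, hc⟩ := hsurj (w 0) (w 1) (w 2)
    refine ⟨v, fun k => ?_⟩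
    fin_cases k
    exacts [ha, hb, (fderiv_sub_const_apply _ _ _ _).trans hc]
  · rw [Submodule.mem_inf, mem_relKer, mem_T5 h1.ne']
    simp [Fin.forall_fin_succ, fderiv_sub_const_apply, and_assoc]

theorem isSmoothPiece_subsystem_inter (p : Params) (h0 : 0 < p.e0) (h1 : 0 < p.e1) {i : Fin 4}
    {x : Phase} (hx : x ∈ subsystem p i) (hx5 : x ∈ P5 p)
    (hu : (red h1.ne' x).2 0 ^ 2 + (red h1.ne' x).2 1 ^ 2 ≠ 0)
    (hsurj : ∀ a b c d : ℝ, ∃ v, fderiv ℝ (relA (p.e0 / p.e1) i) (red h1.ne' x) v = a ∧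
      fderiv ℝ (relB (p.e0 / p.e1) i) (red h1.ne' x) v = b ∧
      fderiv ℝ rL (red h1.ne' x) v = c ∧ fderiv ℝ rG (red h1.ne' x) v = d) :
    IsSmoothPiece (subsystem p i ∩ P4 p (L x)) x 2
      (relKer h1.ne' (p.e0 / p.e1) i x ⊓ T4 x) := by
  refine isSmoothPiece_of_relations h1.ne' (m := 4) rfl
    (h := ![relA (p.e0 / p.e1) i, relB (p.e0 / p.e1) i, fun u => rL u - rL (red h1.ne' x),
      fun u => rG u - (p.e1 * p.a) ^ 2])
    (fun k => ?_) isOpen_not_pole hu (fun y hy => ?_)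
    (Set.mem_inter hx (show x ∈ P4 p (L x) from ⟨rfl, hx5⟩)) (fun w => ?_) (fun v => ?_)
  · fin_cases k
    exacts [contDiff_relA _ i, contDiff_relB _ i, contDiff_rL.sub contDiff_const,
      contDiff_rG.sub contDiff_const]
  · have e1 : y ∈ P4 p (L x) ↔ rL (red h1.ne' y) = rL (red h1.ne' x) ∧
        rG (red h1.ne' y) = (p.e1 * p.a) ^ 2 := by
      rw [← rG_red h1.ne', P4, Set.mem_ofPred_eq, P5, Set.mem_ofPred_eq, L_eq h1.ne']
      simp [h1.ne']
    rw [Set.mem_inter_iff, e1, subsystem_eq p h1 h0, Set.mem_preimage, mem_rsub_iff i hy]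
    simp [Fin.forall_fin_succ, sub_eq_zero]
    tauto
  · obtain ⟨v, ha, hb, hc, hd⟩ := hsurj (w 0) (w 1) (w 2) (w 3)
    refine ⟨v, fun k => ?_⟩
    fin_cases k
    exacts [ha, hb, (fderiv_sub_const_apply _ _ _ _).trans hc,
      (fderiv_sub_const_apply _ _ _ _).trans hd]
  · rw [Submodule.mem_inf, mem_relKer, mem_T4 h1.ne']
    simp [Fin.forall_fin_succ, fderiv_sub_const_apply, and_assoc]

theorem meetTransversally_of_surjective (p : Params) (h0 : 0 < p.e0) (h1 : 0 < p.e1) {i j : Fin 4}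
    {x : Phase} (hx5 : x ∈ P5 p) (hxi : x ∈ subsystem p i) (hxj : x ∈ subsystem p j)
    (hu : (red h1.ne' x).2 0 ^ 2 + (red h1.ne' x).2 1 ^ 2 ≠ 0)
    (hsurj : ∀ a b c d k l : ℝ, ∃ v, fderiv ℝ (relA (p.e0 / p.e1) i) (red h1.ne' x) v = a ∧
      fderiv ℝ (relB (p.e0 / p.e1) i) (red h1.ne' x) v = b ∧
      fderiv ℝ (relA (p.e0 / p.e1) j) (red h1.ne' x) v = c ∧
      fderiv ℝ (relB (p.e0 / p.e1) j) (red h1.ne' x) v = d ∧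
      fderiv ℝ rL (red h1.ne' x) v = k ∧ fderiv ℝ rG (red h1.ne' x) v = l) :
    MeetTransversally p (subsystem p i) (subsystem p j) x := by
  have hs := h1.ne'
  -- Independence of all relations gives `w` with the same relation values as `v` on the second
  -- branch and zero on the first and on the Casimir functions. The decomposition `v = w + (v - w)`
  -- serves both in `P5` and in the leaf, since `w` is tangent to the leaf.
  have split : ∀ v, ∃ w, w ∈ relKer hs (p.e0 / p.e1) i x ∧ v - w ∈ relKer hs (p.e0 / p.e1) j x ∧
      w ∈ T4 x := by
    intro v
    obtain ⟨w, ha, hb, hc, hd, hk, hl⟩ := hsurj 0 0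
      (fderiv ℝ (relA (p.e0 / p.e1) j) (red hs x) (red hs v))
      (fderiv ℝ (relB (p.e0 / p.e1) j) (red hs x) (red hs v)) 0 0
    refine ⟨(red hs).symm w, ?_, ?_, ?_⟩
    · simp [mem_relKer, ha, hb]
    · simp [mem_relKer, hc, hd]
    · simp [mem_T4 hs, hk, hl]
  refine ⟨⟨_, _, isSmoothPiece_subsystem p h0 h1 hxi hu fun a b c => ?_,
    isSmoothPiece_subsystem p h0 h1 hxj hu fun a b c => ?_, ?_⟩,
    ⟨_, _, isSmoothPiece_subsystem_inter p h0 h1 hxi hx5 hu fun a b c d => ?_,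
      isSmoothPiece_subsystem_inter p h0 h1 hxj hx5 hu fun a b c d => ?_, ?_⟩⟩
  · obtain ⟨v, h⟩ := hsurj a b 0 0 0 c
    exact ⟨v, h.1, h.2.1, h.2.2.2.2.2⟩
  · obtain ⟨v, h⟩ := hsurj 0 0 a b 0 c
    exact ⟨v, h.2.2.1, h.2.2.2.1, h.2.2.2.2.2⟩
  · refine le_antisymm (sup_le inf_le_right inf_le_right) fun v hv => ?_
    obtain ⟨w, hw, hvw, hw4⟩ := split v
    rw [← add_sub_cancel w v]
    exact Submodule.add_mem_sup ⟨hw, hw4.2⟩ ⟨hvw, Submodule.sub_mem _ hv hw4.2⟩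
  · obtain ⟨v, h⟩ := hsurj a b 0 0 c d
    exact ⟨v, h.1, h.2.1, h.2.2.2.2⟩
  · obtain ⟨v, h⟩ := hsurj 0 0 a b c d
    exact ⟨v, h.2.2.1, h.2.2.2.1, h.2.2.2.2⟩
  · refine le_antisymm (sup_le inf_le_right inf_le_right) fun v hv => ?_
    obtain ⟨w, hw, hvw, hw4⟩ := split v
    rw [← add_sub_cancel w v]
    exact Submodule.add_mem_sup ⟨hw, hw4⟩ ⟨hvw, Submodule.sub_mem _ hv hw4⟩

/-! ### Types -/

theorem redCharpoly_conj (φ : Phase ≃ₗ[ℝ] Phase) (A : Module.End ℝ Phase) :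
    redCharpoly (φ.conj A) = redCharpoly A := by
  rw [redCharpoly, LinearEquiv.charpoly_conj, redCharpoly]

theorem eigs_conj (φ : Phase ≃ₗ[ℝ] Phase) (A : Module.End ℝ Phase) :
    eigs (φ.conj A) = eigs A := by
  rw [eigs, redCharpoly_conj, eigs]

theorem isRegularElement_iff (p : Params) (hs : p.e1 ≠ 0) (x : Phase) (A : Module.End ℝ Phase) :
    IsRegularElement p x A ↔ (∃ c d : ℝ, A = (red hs).symm.toLinearEquiv.conj
      (c • opH (p.e0 / p.e1) (red hs x) + d • opK (p.e0 / p.e1) (red hs x))) ∧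
      (eigs A).Nodup := by
  simp only [IsRegularElement, linOp_H p hs, linOp_K p hs, map_add, map_smul]

namespace BranchPair

variable {e : ℝ} {u : Phase} {i j : Fin 4} {f1 f2 f3 f4 : Phase →ₗ[ℝ] ℝ} {U1 U2 U3 U4 : Phase}

/-- At a non-degenerate point both symplectic operators have nonzero eigenvalues. -/
theorem ne_zero_of_isNondegenerate {p : Params} (hs : p.e1 ≠ 0) {x : Phase}
    (h : BranchPair (p.e0 / p.e1) (red hs x) i j f1 f2 f3 f4 U1 U2 U3 U4)
    (hx : IsNondegenerate p x) :
    f1 U1 ^ 2 + f1 U2 * f2 U1 ≠ 0 ∧ f3 U3 ^ 2 + f3 U4 * f4 U3 ≠ 0 := by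
  obtain ⟨-, -, A, hA⟩ := hx
  rw [isRegularElement_iff p hs] at hA
  obtain ⟨⟨c, d, rfl⟩, hn⟩ := hA
  rw [eigs_conj] at hn
  obtain ⟨n1, n2, -⟩ := eigs_nodup (h.charpoly_comb c d) hn
  exact ⟨right_ne_zero_of_mul n1, right_ne_zero_of_mul n2⟩

/-- The squared eigenvalues of a regular combination are the external ones multiplied by squares.
Regularity makes these squares nonzero, so the signs are those of the external types. -/
theorem exists_types {p : Params} (hs : p.e1 ≠ 0) (ha : p.a ≠ 0) {x : Phase}
    (h : BranchPair (p.e0 / p.e1) (red hs x) i j f1 f2 f3 f4 U1 U2 U3 U4)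
    (hx : IsNondegenerate p x) (hz : rXH (p.e0 / p.e1) (red hs x) = 0) :
    ∃ s t : ExtType, HasExtType p i x s ∧ HasExtType p j x t ∧ HasPointType p x (combine s t) := by
  obtain ⟨n1, n2⟩ := h.ne_zero_of_isNondegenerate hs hx
  obtain ⟨s, hs1⟩ := exists_signOf n1
  obtain ⟨t, ht1⟩ := exists_signOf n2
  refine ⟨s, t, ⟨_, ?_, hs1⟩, ⟨_, ?_, ht1⟩, hx, fun A hA => ?_⟩
  · rw [extOp_eq p hs ha hx.1.1 hz, LinearEquiv.charpoly_conj, h.charpoly_left]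
  · rw [extOp_eq p hs ha hx.1.1 hz, LinearEquiv.charpoly_conj, h.charpoly_right]
  · rw [isRegularElement_iff p hs] at hA
    obtain ⟨⟨c, d, rfl⟩, hn⟩ := hA
    rw [eigs_conj] at hn ⊢
    have hc := h.charpoly_comb c d
    obtain ⟨m1, m2, -⟩ := eigs_nodup hc hn
    refine eigsHaveType_combine hc (hs1.mul_sq ?_) (ht1.mul_sq ?_)
    · exact fun h0 => m1 (by rw [h0]; ring)
    · exact fun h0 => m2 (by rw [h0]; ring)

/-- The claims about a non-degenerate point of rank zero follow from a pair of branches. -/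
theorem conclusion {p : Params} (ha : 0 < p.a) (h0 : 0 < p.e0) (h1 : 0 < p.e1) {x : Phase}
    (h : BranchPair (p.e0 / p.e1) (red h1.ne' x) i j f1 f2 f3 f4 U1 U2 U3 U4)
    (hx : IsNondegenerate p x) (hz : rXH (p.e0 / p.e1) (red h1.ne' x) = 0)
    (hu : (red h1.ne' x).2 0 ≠ 0) (hij : i ≠ j)
    (hmem : ∀ k, (relA (p.e0 / p.e1) k (red h1.ne' x) = 0 ∧ relB (p.e0 / p.e1) k (red h1.ne' x) = 0)
      ↔ k = i ∨ k = j) :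
    ∃ i j : Fin 4, i ≠ j ∧ (∀ k : Fin 4, x ∈ subsystem p k ↔ k = i ∨ k = j) ∧
      MeetTransversally p (subsystem p i) (subsystem p j) x ∧
      ∃ e f : ExtType, HasExtType p i x e ∧ HasExtType p j x f ∧
        HasPointType p x (combine e f) := by
  have hR : (red h1.ne' x).2 0 ^ 2 + (red h1.ne' x).2 1 ^ 2 ≠ 0 := by positivity
  have hmem' : ∀ k : Fin 4, x ∈ subsystem p k ↔ k = i ∨ k = j := fun k => by
    rw [subsystem_eq p h1 h0, Set.mem_preimage, mem_rsub_iff k hR, hmem k]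
    exact and_iff_right ((rG_red h1.ne').1 hx.1.1)
  obtain ⟨n1, n2⟩ := h.ne_zero_of_isNondegenerate h1.ne' hx
  exact ⟨i, j, hij, hmem', meetTransversally_of_surjective p h0 h1 hx.1.1
    ((hmem' i).2 (Or.inl rfl)) ((hmem' j).2 (Or.inr rfl)) hR (h.surjective hu n1 n2),
    h.exists_types h1.ne' ha.ne' hx hz⟩

end BranchPair

/-! ### The families of equilibria -/

/-- The linear function with the given coefficients. -/
def covec (a b c d e f : ℝ) : Phase →ₗ[ℝ] ℝ :=
  ((a • cm 0 + b • cm 1 + c • cm 2 + d • ca 0 + e • ca 1 + f • ca 2 : Phase →L[ℝ] ℝ) :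
    Phase →ₗ[ℝ] ℝ)

@[simp] theorem covec_apply (a b c d e f : ℝ) (v : Phase) : covec a b c d e f v =
    a * v.1 0 + b * v.1 1 + c * v.1 2 + d * v.2 0 + e * v.2 1 + f * v.2 2 := rfl

theorem fderiv_rZ21 (e : ℝ) (u v : Phase) : fderiv ℝ (rZ21 e) u v =
    2 * u.1 2 * v.1 2 - 2 * u.2 1 * v.2 1 - 2 * e * v.2 0 := by
  unfold rZ21
  simp (disch := fun_prop) only [fderiv_fun_add, fderiv_fun_sub, fderiv_fun_mul, fderiv_fun_pow,
    fderiv_fst_apply, fderiv_snd_apply, fderiv_fun_const]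
  simp

theorem fderiv_rZ22 (e : ℝ) (u v : Phase) : fderiv ℝ (rZ22 e) u v =
    v.2 0 * (e * u.1 1 + (u.1 2 + u.2 1) * u.1 0)
      + u.2 0 * (e * v.1 1 + (v.1 2 + v.2 1) * u.1 0 + (u.1 2 + u.2 1) * v.1 0)
      + v.2 1 * ((u.1 2 + u.2 1) * u.1 1 - e * u.1 0)
      + u.2 1 * ((v.1 2 + v.2 1) * u.1 1 + (u.1 2 + u.2 1) * v.1 1 - e * v.1 0) := by
  unfold rZ22
  simp (disch := fun_prop) only [fderiv_fun_add, fderiv_fun_sub, fderiv_fun_mul, fderiv_fun_pow,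
    fderiv_fst_apply, fderiv_snd_apply, fderiv_fun_const]
  simp
  ring

theorem fderiv_rZ31 (u v : Phase) : fderiv ℝ rZ31 u v =
    (2 * u.2 0 * v.2 0 + 2 * u.2 1 * v.2 1) * (u.1 2 - u.2 1)
      + (u.2 0 ^ 2 + u.2 1 ^ 2) * (v.1 2 - v.2 1)
      - 2 * (v.1 0 * u.2 0 + u.1 0 * v.2 0 + v.1 1 * u.2 1 + u.1 1 * v.2 1) * u.2 2
      - 2 * (u.1 0 * u.2 0 + u.1 1 * u.2 1) * v.2 2 := by
  unfold rZ31
  simp (disch := fun_prop) only [fderiv_fun_add, fderiv_fun_sub, fderiv_fun_mul, fderiv_fun_pow,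
    fderiv_fst_apply, fderiv_snd_apply, fderiv_fun_const]
  simp
  ring

theorem fderiv_rZ32 (e : ℝ) (u v : Phase) : fderiv ℝ (rZ32 e) u v =
    (2 * u.2 0 * v.2 0 - 2 * u.2 1 * v.2 1) * rZ2 e u
      + (u.2 0 ^ 2 - u.2 1 ^ 2) * fderiv ℝ (rZ2 e) u v
      - 2 * (v.2 0 * u.2 1 + u.2 0 * v.2 1) * rZ1 e u
      - 2 * u.2 0 * u.2 1 * fderiv ℝ (rZ1 e) u v := by
  unfold rZ32
  simp (disch := fun_prop) only [fderiv_fun_add, fderiv_fun_sub, fderiv_fun_mul, fderiv_fun_pow,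
    fderiv_fst_apply, fderiv_snd_apply, fderiv_fun_const]
  simp
  ring

theorem fderiv_rZ41 (u v : Phase) : fderiv ℝ rZ41 u v = v.1 1 - v.2 2 := by
  unfold rZ41
  simp (disch := fun_prop) only [fderiv_fun_sub, fderiv_fst_apply, fderiv_snd_apply]
  simp

theorem fderiv_rZ42 (e : ℝ) (u v : Phase) : fderiv ℝ (rZ42 e) u v =
    v.1 0 * (u.1 2 - u.2 1) + u.1 0 * (v.1 2 - v.2 1) + e * v.2 2 := by
  unfold rZ42
  simp (disch := fun_prop) only [fderiv_fun_add, fderiv_fun_sub, fderiv_fun_mul, fderiv_fun_pow,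
    fderiv_fst_apply, fderiv_snd_apply, fderiv_fun_const]
  simp
  ring

/-- The equilibria with `α` directed along the first axis. -/
def axisPoint (b k : ℝ) : Phase := (![-k * b, 0, 0], ![b, 0, 0])

/-- The equilibria in the intersection of the second and the third subsystems. -/
def midPoint (b k z : ℝ) : Phase := (![-k * b, -k * (k * z), -k * z], ![b, k * z, z])

/-- The equilibria in the intersection of the first and the fourth subsystems. -/
def sidePoint (b k q : ℝ) : Phase := (![-k * b, -k * q, k ^ 2 * q], ![b, q, -k * q])

theorem extCoeff_axisPoint_two {b : ℝ} (hb : b ≠ 0) (k E : ℝ) :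
    extCoeff (E * b) (axisPoint b k) 2 = 2 * b ^ 2 * (1 - E - k ^ 2) := by
  simp [extCoeff, rH, rG, rL, axisPoint]
  field_simp
  ring

theorem extCoeff_axisPoint_three (b k E : ℝ) :
    extCoeff (E * b) (axisPoint b k) 3 = 2 * b ^ 2 * (1 + k ^ 2) := by
  simp [extCoeff, rH, rG, rL, axisPoint]
  ring

/-- The covectors `f`, `g` are the differentials of the relations up to factors, and the vectors are
read off from the resulting factorization of the symplectic operator. The other branches below are
of the same kind. -/
theorem branch_axisPoint_two {b : ℝ} (hb : b ≠ 0) (k E : ℝ) :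
    Branch (E * b) (axisPoint b k) 2 (covec 0 0 1 0 (-1) (2 * k))
      (covec 0 (2 * k) 1 0 (2 * k ^ 2 + E - 1) 0)
      (![0, 0, b ^ 3 * (-2 * k ^ 2 - 2 * E + 2)], ![0, b ^ 3 * (-2 * k ^ 2 - 2 * E + 2), 0])
      (![0, b ^ 3 * (2 * k), b ^ 3 * (2 * (E - 1))], ![0, b ^ 3 * -2, b ^ 3 * (2 * k)]) where
  op v := by
    rw [extCoeff_axisPoint_two hb]
    apply phase_ext <;> simp [opK, opH, fderiv_rXK, fderiv_rXH, fderiv_rX1, fderiv_rX2, fderiv_rZ1,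
      fderiv_rZ2, rZ1, rZ2, rX1, rX2, axisPoint] <;> ring
  trace := by simp; ring
  dA := ⟨b ^ 2, by positivity, fun v => by simp [relA, fderiv_rZ31, axisPoint]; ring⟩
  dB := ⟨0, -b ^ 3, neg_ne_zero.2 (by positivity), fun v => by
    simp [relB, fderiv_rZ32, fderiv_rZ1, fderiv_rZ2, rZ1, rZ2, axisPoint]; ring⟩
  L_left := by simp [fderiv_rL, axisPoint]
  L_right := by simp [fderiv_rL, axisPoint]
  G_left := by simp [fderiv_rG, axisPoint]
  G_right := by simp [fderiv_rG, axisPoint]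

theorem branch_axisPoint_three {b : ℝ} (hb : b ≠ 0) (k E : ℝ) :
    Branch (E * b) (axisPoint b k) 3 (covec 0 1 0 0 0 (-1)) (covec 0 0 (-k) 0 k E)
      (![0, b ^ 3 * (4 * k ^ 2), b ^ 3 * (4 * k * E - 4 * k)],
        ![0, b ^ 3 * (-4 * k), b ^ 3 * (-2 * E)])
      (![0, b ^ 3 * (2 * k ^ 2 + E - 2), b ^ 3 * (2 * k)],
        ![0, b ^ 3 * (-2 * k), b ^ 3 * -2]) where
  op v := by
    rw [extCoeff_axisPoint_three]
    apply phase_ext <;> simp [opK, opH, fderiv_rXK, fderiv_rXH, fderiv_rX1, fderiv_rX2, fderiv_rZ1,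
      fderiv_rZ2, rZ1, rZ2, rX1, rX2, axisPoint] <;> ring
  trace := by simp; ring
  dA := ⟨1, one_ne_zero, fun v => by simp [relA, fderiv_rZ41, axisPoint]; ring⟩
  dB := ⟨0, b, hb, fun v => by simp [relB, fderiv_rZ42, axisPoint]; ring⟩
  L_left := by simp [fderiv_rL, axisPoint]
  L_right := by simp [fderiv_rL, axisPoint]
  G_left := by simp [fderiv_rG, axisPoint]
  G_right := by simp [fderiv_rG, axisPoint]

/-- The condition on `E` says that the coefficients of the two subsystems differ. The factors `1 - E
- k²` and `1 - E / 2` vanish exactly where the point enters the first or the second subsystem. -/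
theorem branchPair_axisPoint {b k E : ℝ} (hb : b ≠ 0) (hE : 2 * k ^ 2 + E ≠ 0) :
    ∃ f1 f2 f3 f4 U1 U2 U3 U4, BranchPair (E * b) (axisPoint b k) 2 3 f1 f2 f3 f4 U1 U2 U3 U4 ∧
      f1 U1 ^ 2 + f1 U2 * f2 U1 = (2 * b ^ 2 * (2 * k ^ 2 + E)) ^ 2 * (b ^ 2 * (1 - E - k ^ 2)) ∧
      f3 U3 ^ 2 + f3 U4 * f4 U3 = (2 * b ^ 2 * (2 * k ^ 2 + E)) ^ 2 * (b ^ 2 * (1 - E / 2)) := by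
  refine ⟨_, _, _, _, _, _, _, _, {
    left := branch_axisPoint_two hb k E
    right := branch_axisPoint_three hb k E
    c13 := by simp; ring
    c14 := by simp; ring
    c23 := by simp; ring
    c24 := by simp; ring
    c31 := by simp
    c32 := by simp
    c41 := by simp
    c42 := by simp; ring
    ne h := by
      rw [extCoeff_axisPoint_two hb, extCoeff_axisPoint_three] at h
      have : b ^ 2 * (2 * k ^ 2 + E) = 0 := by linear_combination -h / 2
      exact mul_ne_zero (pow_ne_zero 2 hb) hE this }, ?_, ?_⟩
  · simp; ring
  · simp; ring

theorem rXH_axisPoint (b k E : ℝ) : rXH (E * b) (axisPoint b k) = 0 := by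
  apply phase_ext <;> simp [rXH, axisPoint]

theorem extCoeff_midPoint_one (b k z : ℝ) :
    extCoeff (2 * b) (midPoint b k z) 1 = 2 * (k ^ 2 + 1) * (b ^ 2 + k ^ 2 * z ^ 2) := by
  simp [extCoeff, rH, rG, rL, midPoint]
  ring

theorem extCoeff_midPoint_two {b : ℝ} (hb : b ≠ 0) (k z : ℝ) :
    extCoeff (2 * b) (midPoint b k z) 2 = -(2 * (k ^ 2 + 1) * (b ^ 2 + k ^ 2 * z ^ 2)) := by
  have h1 : rL (midPoint b k z) = -2 * k * rG (midPoint b k z) := by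
    simp [rG, rL, midPoint]; ring
  have h2 : rG (midPoint b k z) ≠ 0 := by
    simp [rG, midPoint]; positivity
  rw [extCoeff, h1, mul_pow, pow_two (rG _), ← mul_assoc, mul_div_cancel_right₀ _ h2]
  simp [rH, rG, midPoint]
  ring

theorem branch_midPoint_one {b : ℝ} (hb : b ≠ 0) (k z : ℝ) :
    Branch (2 * b) (midPoint b k z) 1 (covec 0 0 (k * z) (2 * b) (k * z) 0)
      (covec (-2 * k * z) (2 * b) (-k * b) 0 (k * b) 0)
      (![2 * k * z ^ 2 * (k ^ 2 + 1) ^ 2, -2 * b * z * (k ^ 2 + 1) ^ 2,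
          2 * k * b * z * (k ^ 2 + 1)],
        ![-2 * k ^ 2 * z ^ 2 * (k ^ 2 + 1), 2 * k * b * z * (k ^ 2 + 1), 0])
      (![-2 * k * b * z * (k ^ 2 + 1), -2 * k ^ 2 * z ^ 2 + 2 * k ^ 2 * b ^ 2,
          4 * k ^ 3 * z ^ 2 + 2 * k * z ^ 2 + 2 * k * b ^ 2],
        ![2 * k ^ 2 * b * z + 2 * b * z, 2 * k * z ^ 2 - 2 * k * b ^ 2,
          -2 * k ^ 2 * z ^ 2 - 2 * b ^ 2]) where
  op v := by
    rw [extCoeff_midPoint_one]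
    apply phase_ext <;> simp [opK, opH, fderiv_rXK, fderiv_rXH, fderiv_rX1, fderiv_rX2, fderiv_rZ1,
      fderiv_rZ2, rZ1, rZ2, rX1, rX2, midPoint] <;> ring
  trace := by simp; ring
  dA := ⟨-2, by norm_num, fun v => by simp [relA, fderiv_rZ21, midPoint]; ring⟩
  dB := ⟨-k ^ 2 * z, b, hb, fun v => by simp [relB, fderiv_rZ22, midPoint]; ring⟩
  L_left := by simp [fderiv_rL, midPoint]; ring
  L_right := by simp [fderiv_rL, midPoint]; ring
  G_left := by simp [fderiv_rG, midPoint]; ring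
  G_right := by simp [fderiv_rG, midPoint]; ring

theorem branch_midPoint_two {b : ℝ} (hb : b ≠ 0) (k z : ℝ) :
    Branch (2 * b) (midPoint b k z) 2
      (covec (-2 * b * z) (-2 * k * z ^ 2) (b ^ 2 + k ^ 2 * z ^ 2) (-2 * k * b * z)
        (-3 * k ^ 2 * z ^ 2 - b ^ 2) (2 * k * (b ^ 2 + k ^ 2 * z ^ 2)))
      (covec (2 * k ^ 2 * z) (-2 * k * b) (-b) (2 * k * z * (k ^ 2 + 1))
        (-b * (2 * k ^ 2 + 1)) 0)
      (![0, 0, (k ^ 2 + 1) * (-2 * b)], ![(k ^ 2 + 1) * (2 * k * z), (k ^ 2 + 1) * (-2 * b), 0])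
      (![2 * b * z * (k ^ 2 + 1), 2 * k * (z ^ 2 - b ^ 2), -2 * (b ^ 2 + k ^ 2 * z ^ 2)],
        ![0, 2 * (b ^ 2 + k ^ 2 * z ^ 2), -2 * k * (b ^ 2 + k ^ 2 * z ^ 2)]) where
  op v := by
    rw [extCoeff_midPoint_two hb]
    apply phase_ext <;> simp [opK, opH, fderiv_rXK, fderiv_rXH, fderiv_rX1, fderiv_rX2, fderiv_rZ1,
      fderiv_rZ2, rZ1, rZ2, rX1, rX2, midPoint] <;> ring
  trace := by simp; ring
  dA := ⟨1, one_ne_zero, fun v => by simp [relA, fderiv_rZ31, midPoint]; ring⟩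
  dB := ⟨0, b ^ 2 + k ^ 2 * z ^ 2, by positivity, fun v => by
    simp [relB, fderiv_rZ32, fderiv_rZ1, fderiv_rZ2, rZ1, rZ2, midPoint]; ring⟩
  L_left := by simp [fderiv_rL, midPoint]; ring
  L_right := by simp [fderiv_rL, midPoint]; ring
  G_left := by simp [fderiv_rG, midPoint]; ring
  G_right := by simp [fderiv_rG, midPoint]; ring

/-- The two coefficients are opposite and nonzero, so they never coincide. The left eigenvalue
vanishes only for `z = 0`, where the family meets the axis family. -/
theorem branchPair_midPoint {b : ℝ} (hb : b ≠ 0) (k z : ℝ) :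
    ∃ f1 f2 f3 f4 U1 U2 U3 U4, BranchPair (2 * b) (midPoint b k z) 1 2 f1 f2 f3 f4 U1 U2 U3 U4 ∧
      f1 U1 ^ 2 + f1 U2 * f2 U1
        = -(4 * (k ^ 2 + 1) * (b ^ 2 + k ^ 2 * z ^ 2)) ^ 2 * (z ^ 2 * (1 + k ^ 2)) := by
  refine ⟨_, _, _, _, _, _, _, _, {
    left := branch_midPoint_one hb k z
    right := branch_midPoint_two hb k z
    c13 := by simp; ring
    c14 := by simp
    c23 := by simp
    c24 := by simp; ring
    c31 := by simp; ring
    c32 := by simp; ring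
    c41 := by simp; ring
    c42 := by simp; ring
    ne := by
      rw [extCoeff_midPoint_one, extCoeff_midPoint_two hb]
      have : 0 < 2 * (k ^ 2 + 1) * (b ^ 2 + k ^ 2 * z ^ 2) := by positivity
      linarith }, ?_⟩
  simp; ring

theorem rXH_midPoint (b k z : ℝ) : rXH (2 * b) (midPoint b k z) = 0 := by
  apply phase_ext <;> simp [rXH, midPoint] <;> ring

theorem extCoeff_sidePoint_three (b k q : ℝ) :
    extCoeff ((1 - k ^ 2) * b) (sidePoint b k q) 3 = 2 * (1 + k ^ 2) * (b ^ 2 + q ^ 2) := by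
  simp [extCoeff, rH, rG, rL, sidePoint]
  ring

/-- At a point with `Z = 0` the linearization of the field of `K = Z1² + Z2²` is `2 (dZ1 ⊗ X1 + dZ2
⊗ X2)`. -/
theorem branch_sidePoint_zero (b k q : ℝ) :
    Branch ((1 - k ^ 2) * b) (sidePoint b k q) 0
      (covec (-2 * k * b) (2 * k * q) q (-(k ^ 2 + 1) * b) (k ^ 2 * q) 0)
      (covec (-2 * k * q) (-2 * k * b) (-b) (-(k ^ 2 + 1) * q) (-k ^ 2 * b) 0)
      ((2 : ℝ) • rX1 ((1 - k ^ 2) * b) (sidePoint b k q))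
      ((2 : ℝ) • rX2 ((1 - k ^ 2) * b) (sidePoint b k q)) where
  op v := by
    rw [extCoeff]
    apply phase_ext <;> simp [opK, opH, fderiv_rXK, fderiv_rXH, fderiv_rX1, fderiv_rX2, fderiv_rZ1,
      fderiv_rZ2, rZ1, rZ2, rX1, rX2, sidePoint] <;> ring
  trace := by simp [rX1, rX2, sidePoint]; ring
  dA := ⟨1, one_ne_zero, fun v => by simp [relA, fderiv_rZ1, sidePoint]; ring⟩
  dB := ⟨0, 1, one_ne_zero, fun v => by simp [relB, fderiv_rZ2, sidePoint]; ring⟩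
  L_left := by simp [fderiv_rL, rX1, rX2, sidePoint]; ring
  L_right := by simp [fderiv_rL, rX1, rX2, sidePoint]; ring
  G_left := by simp [fderiv_rG, rX1, rX2, sidePoint]; ring
  G_right := by simp [fderiv_rG, rX1, rX2, sidePoint]; ring

theorem branch_sidePoint_three (b k q : ℝ) :
    Branch ((1 - k ^ 2) * b) (sidePoint b k q) 3
      (covec 0 1 0 0 0 (-1)) (covec ((k ^ 2 - 1) * q) 0 (-k * b) 0 (k * b) ((1 - k ^ 2) * b))
      (![(b ^ 2 + q ^ 2) * (-(k ^ 2 + 1) ^ 2 * q), (b ^ 2 + q ^ 2) * (4 * k ^ 2 * b),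
          (b ^ 2 + q ^ 2) * (-4 * k ^ 3 * b)],
        ![(b ^ 2 + q ^ 2) * (2 * k * (k ^ 2 + 1) * q), (b ^ 2 + q ^ 2) * (-4 * k * b),
          (b ^ 2 + q ^ 2) * (-2 * b * (1 - k ^ 2))])
      (![0, (b ^ 2 + q ^ 2) * (-(1 - k ^ 2)), (b ^ 2 + q ^ 2) * (2 * k)],
        ![0, (b ^ 2 + q ^ 2) * (-2 * k), (b ^ 2 + q ^ 2) * -2]) where
  op v := by
    rw [extCoeff_sidePoint_three]
    apply phase_ext <;> simp [opK, opH, fderiv_rXK, fderiv_rXH, fderiv_rX1, fderiv_rX2, fderiv_rZ1,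
      fderiv_rZ2, rZ1, rZ2, rX1, rX2, sidePoint] <;> ring
  trace := by simp; ring
  dA := ⟨1, one_ne_zero, fun v => by simp [relA, fderiv_rZ41, sidePoint]; ring⟩
  dB := ⟨0, 1, one_ne_zero, fun v => by simp [relB, fderiv_rZ42, sidePoint]; ring⟩
  L_left := by simp [fderiv_rL, sidePoint]; ring
  L_right := by simp [fderiv_rL, sidePoint]; ring
  G_left := by simp [fderiv_rG, sidePoint]; ring
  G_right := by simp [fderiv_rG, sidePoint]; ring

theorem branchPair_sidePoint {b : ℝ} (hb : b ≠ 0) (k q : ℝ) :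
    ∃ f1 f2 f3 f4 U1 U2 U3 U4, BranchPair ((1 - k ^ 2) * b) (sidePoint b k q) 0 3 f1 f2 f3 f4 U1 U2 U3 U4 ∧
      f1 U1 ^ 2 + f1 U2 * f2 U1
        = -4 * (1 + k ^ 2) ^ 4 * (b ^ 2 + q ^ 2) ^ 2 * q ^ 2 := by
  refine ⟨_, _, _, _, _, _, _, _, {
    left := branch_sidePoint_zero b k q
    right := branch_sidePoint_three b k q
    c13 := by simp; ring
    c14 := by simp; ring
    c23 := by simp; ring
    c24 := by simp; ring
    c31 := by simp [rX1, rX2, sidePoint]; ring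
    c32 := by simp [rX1, rX2, sidePoint]; ring
    c41 := by simp [rX1, rX2, sidePoint]; ring
    c42 := by simp [rX1, rX2, sidePoint]; ring
    ne := by
      rw [extCoeff_sidePoint_three, extCoeff]
      positivity }, ?_⟩
  simp [rX1, rX2, sidePoint]; ring

theorem rXH_sidePoint (b k q : ℝ) : rXH ((1 - k ^ 2) * b) (sidePoint b k q) = 0 := by
  apply phase_ext <;> simp [rXH, sidePoint] <;> ring

/-! ### Points of rank zero -/

theorem fderiv_H_eq_zero_of_rank_zero (p : Params) (hs : p.e1 ≠ 0) {x : Phase}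
    (hx : x ∈ rankZeroSet p) {v : Phase} (hv : v ∈ T4 x) : fderiv ℝ (H p) x v = 0 := by
  have h := hx.2
  rw [reducedRank, Submodule.finrank_eq_zero, LinearMap.range_eq_bot] at h
  have h1 := congrArg (fun l : T4 x →ₗ[ℝ] ℝ × ℝ => (l ⟨v, hv⟩).1) h
  have h2 := ((differentiable_H p hs x).hasFDerivAt.prodMk
    (differentiable_K p hs x).hasFDerivAt).fderiv
  simp only [LinearMap.domRestrict_apply, ContinuousLinearMap.coe_coe, LinearMap.zero_apply] at h1
  rw [h2] at h1
  exact h1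

/-- The points of rank zero belong to three families. -/
theorem exists_family (p : Params) (h0 : 0 < p.e0) (h1 : 0 < p.e1) {x : Phase}
    (hx : x ∈ rankZeroSet p) : ∃ b k : ℝ, b ≠ 0 ∧
      ((∃ E, p.e0 / p.e1 = E * b ∧ red h1.ne' x = axisPoint b k) ∨
        (∃ z, p.e0 / p.e1 = 2 * b ∧ red h1.ne' x = midPoint b k z) ∨
        ∃ q, p.e0 / p.e1 = (1 - k ^ 2) * b ∧ red h1.ne' x = sidePoint b k q) := by
  have hs := h1.ne'
  have he : p.e0 / p.e1 ≠ 0 := (div_pos h0 h1).ne'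
  set e := p.e0 / p.e1
  set u := red hs x
  -- The vanishing of `dH` on the leaf alone suffices; it gives Lagrange multipliers, and the
  -- equations are those of `equilibrium_cases`.
  obtain ⟨c, d, h⟩ := mem_span_pair_of_ker (V := Phase) (f := (fderiv ℝ rL u : Phase →ₗ[ℝ] ℝ))
    (g := (fderiv ℝ rG u : Phase →ₗ[ℝ] ℝ)) (k := (fderiv ℝ (rH e) u : Phase →ₗ[ℝ] ℝ))
    (fun v hL hG => by
      have := fderiv_H_eq_zero_of_rank_zero p hs hx (v := (red hs).symm v)
        ((mem_T4 hs).2 (by simpa using ⟨hL, hG⟩))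
      rw [fderiv_H p hs, ContinuousLinearEquiv.apply_symm_apply] at this
      exact this)
  simp only [ContinuousLinearMap.coe_coe, fderiv_rL, fderiv_rG, fderiv_rH] at h
  have k1 := h (![1, 0, 0], 0)
  have k2 := h (![0, 1, 0], 0)
  have k3 := h (![0, 0, 1], 0)
  have k4 := h (0, ![1, 0, 0])
  have k5 := h (0, ![0, 1, 0])
  have k6 := h (0, ![0, 0, 1])
  simp at k1 k2 k3 k4 k5 k6
  have j1 : u.1 0 = -(-c) * u.2 0 := by linarith
  have j2 : u.1 1 = -(-c) * u.2 1 := by linarith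
  have j3 : u.1 2 = -(-c) * u.2 2 := by linarith
  have j4 : e = (2 * -d - 2 * (-c) ^ 2) * u.2 0 := by rw [j1] at k4; linarith
  -- Since `e ≠ 0`, an equilibrium never lies over a pole, so all four subsystems are given by their
  -- relations near it.
  have hb : u.2 0 ≠ 0 := fun hb => he (by rw [j4, hb, mul_zero])
  refine ⟨u.2 0, -c, hb, ?_⟩
  rcases equilibrium_cases (e := e) (C := -c) (D := -d) j1 j2 j3 (by linarith) (by linarith)
    (by linarith) with ⟨hz, ha⟩ | ⟨hE, ha⟩ | ⟨hE, hz⟩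
  · refine Or.inl ⟨_, j4, ?_⟩
    apply phase_ext <;> simp [axisPoint, j1, j2, j3, hz, ha]
  · refine Or.inr (Or.inl ⟨u.2 2, hE, ?_⟩)
    apply phase_ext <;> simp [midPoint, j1, j2, j3, ha]
  · refine Or.inr (Or.inr ⟨u.2 1, hE, ?_⟩)
    apply phase_ext <;> simp [sidePoint, j1, j2, j3, hz]
    ring

/-- The matrix of the exceptional combination on the coordinates `O2`, `r`, `a2`, `z`. The
contribution `w` of the common symplectic operator does not influence the spectrum, and the two
pairs of eigenvalues coincide. -/
theorem charpoly_degenerate (k s w : ℝ) :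
    (!![w * (4 * k ^ 2), k * s + w * (2 * k), k * s - w * (2 * k), 2 * (1 + k ^ 2) * s;
      -(w * (4 * k * (2 * k ^ 2 + 1))), -(w * (2 * k ^ 2)),
        -(2 * (1 + 2 * k ^ 2) * s) + w * (2 * k ^ 2), -(2 * k * s) + w * (4 * k * (k ^ 2 + 1));
      -(w * (4 * k)), -(2 * s) + w * (2 * k ^ 2), -(w * (2 * k ^ 2)),
        -(2 * k * s) + w * (4 * k * (k ^ 2 + 1));
      2 * s + w * (4 * k ^ 2), w * (2 * k), 2 * k * s - w * (2 * k), 0] :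
        Matrix (Fin 4) (Fin 4) ℝ).charpoly
      = (X ^ 2 - C (4 * s ^ 2 * (1 + k ^ 2))) * (X ^ 2 - C (4 * s ^ 2 * (1 + k ^ 2))) := by
  have h2 : (C (2 : ℝ)) = 2 := rfl
  have h4 : (C (4 : ℝ)) = 4 := rfl
  rw [Matrix.charpoly, Matrix.det_succ_row_zero]
  simp [Fin.sum_univ_succ, Matrix.det_fin_three, Matrix.charmatrix_apply, Fin.succAbove, h2, h4]
  ring

/-- The case in which the symplectic operators of both subsystems coincide. -/
theorem charpoly_axisPoint_of_eq {b : ℝ} (hb : b ≠ 0) (k c d : ℝ) :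
    ∃ α, (c • opH (-2 * k ^ 2 * b) (axisPoint b k)
      + d • opK (-2 * k ^ 2 * b) (axisPoint b k)).charpoly
        = X ^ 2 * ((X ^ 2 - C α) * (X ^ 2 - C α)) := by
  let A := c • opH (-2 * k ^ 2 * b) (axisPoint b k) + d • opK (-2 * k ^ 2 * b) (axisPoint b k)
  -- For `E = -2k²` both coefficients equal `σ = 2 b² (1 + k²)`, and `t` is chosen so that the
  -- combination is `(2t/b) A_H + d (A_K - σ A_H)`.
  obtain ⟨t, ht⟩ : ∃ t, c = 2 * t / b - d * (2 * b ^ 2 * (1 + k ^ 2)) :=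
    ⟨(c + d * (2 * b ^ 2 * (1 + k ^ 2))) * b / 2, by field_simp; ring⟩
  have hA : ∀ v, A v =
      (![0, t * k * (v.1 2 + v.2 1) + 2 * (1 + k ^ 2) * t * v.2 2,
        -(2 * k * t) * v.2 2 - 2 * (1 + 2 * k ^ 2) * t * v.2 1],
        ![0, -(2 * k * t) * v.2 2 - 2 * t * v.1 2, 2 * t * v.1 1 + 2 * k * t * v.2 1])
      + (d * b ^ 3) • ((v.1 2 - v.2 1 + 2 * k * v.2 2) •
        (![0, 0, 2 * k ^ 2 + 2], ![0, 2 * k ^ 2 + 2, 0])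
        + (2 * k * v.1 1 + v.1 2 - v.2 1) •
        (![0, 2 * k, -2 * (2 * k ^ 2 + 1)], ![0, -2, 2 * k])) := by
    intro v
    have := (branch_axisPoint_two hb k (-2 * k ^ 2)).op v
    rw [extCoeff_axisPoint_two hb] at this
    simp only [A, LinearMap.add_apply, LinearMap.smul_apply, this, ht]
    apply phase_ext <;> simp [opH, fderiv_rXH, axisPoint] <;> field_simp <;> ring
  refine ⟨4 * t ^ 2 * (1 + k ^ 2), ?_⟩
  change A.charpoly = _
  clear_value A
  generalize d * b ^ 3 = w at hA
  rw [charpoly_of_factors (m := 4) (by norm_num) (A := A)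
    (V := ![covec 0 1 0 0 0 0, covec 0 0 1 0 0 0, covec 0 0 0 0 1 0, covec 0 0 0 0 0 1])
    (U := ![A (![0, 1, 0], 0), A (![0, 0, 1], 0), A (0, ![0, 1, 0]), A (0, ![0, 0, 1])]),
    ← charpoly_degenerate k t w]
  · congr 2
    simp only [hA]
    ext i j
    fin_cases i <;> fin_cases j <;> simp [-mul_eq_mul_left_iff] <;> ring
  · intro v
    simp only [hA]
    apply phase_ext <;> simp [Fin.sum_univ_succ] <;> ring

theorem not_isNondegenerate_axisPoint {p : Params} (hs : p.e1 ≠ 0) {x : Phase} {b k : ℝ}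
    (hb : b ≠ 0) (he : p.e0 / p.e1 = -2 * k ^ 2 * b) (hu : red hs x = axisPoint b k) :
    ¬ IsNondegenerate p x := by
  rintro ⟨-, -, A, hA⟩
  rw [isRegularElement_iff p hs, he, hu] at hA
  obtain ⟨⟨c, d, rfl⟩, hn⟩ := hA
  rw [eigs_conj] at hn
  obtain ⟨α, hα⟩ := charpoly_axisPoint_of_eq hb k c d
  exact (eigs_nodup hα hn).2.2 rfl

/-- The claims of the theorem about a non-degenerate point of rank zero. -/
theorem exists_transversal_pair (p : Params) (ha : 0 < p.a) (h0 : 0 < p.e0) (h1 : 0 < p.e1)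
    {x : Phase} (hx : IsNondegenerate p x) :
    ∃ i j : Fin 4, i ≠ j ∧ (∀ k : Fin 4, x ∈ subsystem p k ↔ k = i ∨ k = j) ∧
      MeetTransversally p (subsystem p i) (subsystem p j) x ∧
      ∃ e f : ExtType, HasExtType p i x e ∧ HasExtType p j x f ∧
        HasPointType p x (combine e f) := by
  have he0 : p.e0 / p.e1 ≠ 0 := (div_pos h0 h1).ne'
  obtain ⟨b, k, hb, ⟨E, he, hu⟩ | ⟨z, he, hu⟩ | ⟨q, he, hu⟩⟩ := exists_family p h0 h1 hx.1
  · have hE : 2 * k ^ 2 + E ≠ 0 := fun hE =>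
      not_isNondegenerate_axisPoint h1.ne' hb (by rw [he]; linear_combination b * hE) hu hx
    obtain ⟨f1, f2, f3, f4, U1, U2, U3, U4, h, hl, hm⟩ := branchPair_axisPoint hb hE
    rw [← he, ← hu] at h
    have hne := h.ne_zero_of_isNondegenerate h1.ne' hx
    rw [hl, hm] at hne
    -- These inequalities, consequences of non-degeneracy, keep the point out of the first and the
    -- second subsystem.
    have n1 : 1 - E - k ^ 2 ≠ 0 := fun h => hne.1 (by rw [h]; ring)
    have n2 : 1 - E / 2 ≠ 0 := fun h => hne.2 (by rw [h]; ring)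
    have n3 : E ≠ 0 := fun h => he0 (by rw [he, h, zero_mul])
    refine h.conclusion ha h0 h1 hx (by rw [he, hu, rXH_axisPoint]) (by rw [hu]; exact hb)
      (by decide) fun i => ?_
    rw [he, hu]
    fin_cases i <;> simp [relA, relB, axisPoint, rZ1, rZ2, rZ21, rZ22, rZ31, rZ32, rZ41, rZ42]
    · intro h
      refine absurd ?_ (mul_ne_zero (pow_ne_zero 2 hb) n1)
      linear_combination -h
    · intro h
      refine absurd ?_ (mul_ne_zero (mul_ne_zero n3 (pow_ne_zero 2 hb)) n2)
      linear_combination -h / 2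
  · obtain ⟨f1, f2, f3, f4, U1, U2, U3, U4, h, hl⟩ := branchPair_midPoint hb k z
    rw [← he, ← hu] at h
    have hne := h.ne_zero_of_isNondegenerate h1.ne' hx
    rw [hl] at hne
    have hz : z ≠ 0 := fun h => hne.1 (by rw [h]; ring)
    refine h.conclusion ha h0 h1 hx (by rw [he, hu, rXH_midPoint]) (by rw [hu]; exact hb)
      (by decide) fun i => ?_
    rw [he, hu]
    fin_cases i <;> simp [relA, relB, midPoint, rZ1, rZ2, rZ21, rZ22, rZ31, rZ32, rZ41, rZ42]
    · intro hA hB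
      have hkz : k * z = 0 := by
        have : b * (2 * (k ^ 2 + 1)) * (k * z) = 0 := by linear_combination hB
        exact (mul_eq_zero.1 this).resolve_left (mul_ne_zero hb (by positivity))
      have : (k ^ 2 + 1) * b ^ 2 = 0 := by linear_combination hA + (k ^ 2 + 1) * (k * z) * hkz
      exact absurd this (by positivity)
    · constructor <;> ring
    · constructor <;> ring
    · intro h
      exact absurd (show (k ^ 2 + 1) * z = 0 by linear_combination -h)
        (mul_ne_zero (by positivity) hz)
  · obtain ⟨f1, f2, f3, f4, U1, U2, U3, U4, h, hl⟩ := branchPair_sidePoint hb k q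
    rw [← he, ← hu] at h
    have hne := h.ne_zero_of_isNondegenerate h1.ne' hx
    rw [hl] at hne
    have hq : q ≠ 0 := fun h => hne.1 (by rw [h]; ring)
    -- This excludes the second subsystem, while `q ≠ 0` excludes the third.
    have hk : 1 - k ^ 2 ≠ 0 := fun h => he0 (by rw [he, h, zero_mul])
    refine h.conclusion ha h0 h1 hx (by rw [he, hu, rXH_sidePoint]) (by rw [hu]; exact hb)
      (by decide) fun i => ?_
    rw [he, hu]
    fin_cases i <;> simp [relA, relB, sidePoint, rZ1, rZ2, rZ21, rZ22, rZ31, rZ32, rZ41, rZ42]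
    · constructor <;> ring
    · intro h
      have : (1 - k ^ 2) * ((1 + k ^ 2) * (b ^ 2 + q ^ 2)) = 0 := by linear_combination -h
      exact absurd this (mul_ne_zero hk (by positivity))
    · intro h
      have : (b ^ 2 + q ^ 2) * (1 + k ^ 2) * q = 0 := by linear_combination -h
      exact absurd this (mul_ne_zero (by positivity) hq)
    · ring

end

end KS

theorem theorem6 (p : KS.Params) (ha : 0 < p.a) (h0 : 0 < p.e0) (h1 : 0 < p.e1) :
    KS.criticalSet p = (⋃ i : Fin 4, KS.subsystem p i) ∧
    ∀ x : KS.Phase, KS.IsNondegenerate p x →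
      ∃ i j : Fin 4, i ≠ j ∧ (∀ k : Fin 4, x ∈ KS.subsystem p k ↔ k = i ∨ k = j) ∧
        KS.MeetTransversally p (KS.subsystem p i) (KS.subsystem p j) x ∧
        ∃ e f : KS.ExtType, KS.HasExtType p i x e ∧ KS.HasExtType p j x f ∧
          KS.HasPointType p x (KS.combine e f) :=
  ⟨KS.criticalSet_eq_iUnion p ha h0 h1, fun _ hx => KS.exists_transversal_pair p ha h0 h1 hx⟩
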